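/- Consider a board bounded by the lines $x=0$, $x=w$ and the $x$-axis (the floor), unbounded above. A rectangle means an axis-aligned rectangle with integer coordinates and positive width and height that lies on the board; two rectangles are independent if their interiors do not intersect. Dropping a rectangle at position $x_d$ on a finite set $S$ of rectangles means letting it fall vertically from above, with its left border at $x=x_d$, until it comes to rest on the highest top border of a rectangle of $S$ whose horizontal extent overlaps its own in an interval of positive length, or on the floor if there is none; the rectangle is then added to $S$ in that position. The model of computation is the unit-cost word RAM, and $n\ge 2$ is a parameter known to the data structure. Theorem. There is a data structure, given by three deterministic word RAM programs (construction, update, query), such that for all constants $c,d\in\mathbb N$ there are constants $K\in\mathbb{N}$ and $C\in\mathbb{R}$ for which the following holds for every $n\ge2$, every word length $W$ with $2^W\ge n^K$ (that is, $W\ge K\log_2 n$), and every board of integer width $w\le n^d$. The data structure is constructed from an arbitrary list of at most $cn$ pairwise independent rectangles on the board, whose top borders have height at most $n^d$, and then maintains the current set $S$ of rectangles under any sequence of the following operations, as long as $|S|\le cn$. - (Update) Given a rectangle of width $a \geq 1$ and height $b$ with $1\le b\le n^d$, and a position $x_d \geq 0$ with $x_d+a\le w$, drop the rectangle at position $x_d$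 on $S$. - (Query) Given an integer height $0\le h<2^W$, return the largest width $a$ of a rectangle that can be dropped on $S$, within the board, so that its bottom lies at or below height $h$, together with a position at which a rectangle of width $a$ has to be dropped to achieve this; return $a=0$ (with an arbitrary position) if no rectangle can be dropped so. In the worst case, the construction takes at most $C\,n\log n$ time, every update takes at most $C\,n^{1/2}\log^{3/2}n$ time, and every query takes at most $C\,n^{1/2}\log^{1/2}n$ time. -/

import Mathlib

namespace RectDrop

/-! ## The word RAM -/

/-- Configuration of a word RAM with words of `W` bits: registers, and a random access memory that
is addressed by words. (A program mentions only finitely many registers.) -/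
structure State (W : ℕ) where
  reg : ℕ → BitVec W
  mem : BitVec W → BitVec W

namespace State

/-- Write a register. -/
def setReg {W : ℕ} (σ : State W) (r : ℕ) (v : BitVec W) : State W :=
  { σ with reg := Function.update σ.reg r v }

/-- Write a memory cell. -/
def setMem {W : ℕ} (σ : State W) (a v : BitVec W) : State W :=
  { σ with mem := Function.update σ.mem a v }

end State

/-- The unit-cost binary operations on words. -/
inductive BinOp
  | add | sub | mul | div | mod | and | or | xor | shl | shr

/-- Arithmetic is unsigned and modulo `2 ^ W` (and division by `0` gives `0`). -/
def BinOp.apply {W : ℕ} : BinOp → BitVec W → BitVec W → BitVec W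
  | .add, u, v => u + v
  | .sub, u, v => u - v
  | .mul, u, v => u * v
  | .div, u, v => u / v
  | .mod, u, v => u % v
  | .and, u, v => u &&& v
  | .or, u, v => u ||| v
  | .xor, u, v => u ^^^ v
  | .shl, u, v => u <<< v
  | .shr, u, v => u >>> v

/-- Tests that may guard a branch or a loop: comparison of two registers. -/
inductive Test
  | eq (r s : ℕ)
  | lt (r s : ℕ)

/-- The comparison `lt` is that of unsigned integers. -/
def Test.holds {W : ℕ} (σ : State W) : Test → Prop
  | .eq r s => σ.reg r = σ.reg s
  | .lt r s => (σ.reg r).toNat < (σ.reg s).toNat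

/-- Word RAM programs. The text of a program depends neither on the input nor on the word length. -/
inductive Prog
  /-- do nothing -/
  | skip
  /-- `reg r := k` (modulo `2 ^ W`) -/
  | const (r k : ℕ)
  /-- `reg r := reg s` -/
  | move (r s : ℕ)
  /-- `reg r := reg s ∘ reg t` -/
  | op (o : BinOp) (r s t : ℕ)
  /-- `reg r := mem[reg s]` -/
  | load (r s : ℕ)
  /-- `mem[reg r] := reg s` -/
  | store (r s : ℕ)
  /-- sequential composition -/
  | seq (p q : Prog)
  /-- two-way branch -/
  | branch (b : Test) (p q : Prog)
  /-- while loop -/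
  | loop (b : Test) (p : Prog)

/-- `Exec p σ t σ'`: program `p`, started in configuration `σ`, halts after `t` steps in
configuration `σ'`. Every elementary instruction and every evaluation of a test costs one step. -/
inductive Exec {W : ℕ} : Prog → State W → ℕ → State W → Prop
  | skip (σ : State W) : Exec .skip σ 1 σ
  | const (r k : ℕ) (σ : State W) : Exec (.const r k) σ 1 (σ.setReg r (BitVec.ofNat W k))
  | move (r s : ℕ) (σ : State W) : Exec (.move r s) σ 1 (σ.setReg r (σ.reg s))
  | op (o : BinOp) (r s t : ℕ) (σ : State W) :
      Exec (.op o r s t) σ 1 (σ.setReg r (o.apply (σ.reg s) (σ.reg t)))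
  | load (r s : ℕ) (σ : State W) : Exec (.load r s) σ 1 (σ.setReg r (σ.mem (σ.reg s)))
  | store (r s : ℕ) (σ : State W) : Exec (.store r s) σ 1 (σ.setMem (σ.reg r) (σ.reg s))
  | seq {p q : Prog} {σ₁ σ₂ σ₃ : State W} {t₁ t₂ : ℕ} :
      Exec p σ₁ t₁ σ₂ → Exec q σ₂ t₂ σ₃ → Exec (.seq p q) σ₁ (t₁ + t₂) σ₃
  | branch_true {b : Test} {p q : Prog} {σ σ' : State W} {t : ℕ} :
      b.holds σ → Exec p σ t σ' → Exec (.branch b p q) σ (t + 1) σ'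
  | branch_false {b : Test} {p q : Prog} {σ σ' : State W} {t : ℕ} :
      ¬ b.holds σ → Exec q σ t σ' → Exec (.branch b p q) σ (t + 1) σ'
  | loop_true {b : Test} {p : Prog} {σ₁ σ₂ σ₃ : State W} {t₁ t₂ : ℕ} :
      b.holds σ₁ → Exec p σ₁ t₁ σ₂ → Exec (.loop b p) σ₂ t₂ σ₃ →
        Exec (.loop b p) σ₁ (t₁ + t₂ + 1) σ₃
  | loop_false {b : Test} {p : Prog} {σ : State W} :
      ¬ b.holds σ → Exec (.loop b p) σ 1 σ

/-- The machine is deterministic, so "there is an execution" means "the execution". -/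
theorem Exec.deterministic {W : ℕ} {p : Prog} {σ σ₁ σ₂ : State W} {t₁ t₂ : ℕ}
    (h₁ : Exec p σ t₁ σ₁) (h₂ : Exec p σ t₂ σ₂) : t₁ = t₂ ∧ σ₁ = σ₂ := by
  induction h₁ generalizing t₂ σ₂ with
  | skip | const | move | op | load | store => cases h₂; exact ⟨rfl, rfl⟩
  | seq _ _ ih₁ ih₂ =>
    cases h₂ with
    | seq g₁ g₂ =>
      obtain ⟨rfl, rfl⟩ := ih₁ g₁
      obtain ⟨rfl, rfl⟩ := ih₂ g₂
      exact ⟨rfl, rfl⟩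
  | branch_true hb _ ih =>
    cases h₂ with
    | branch_true _ g =>
      obtain ⟨rfl, rfl⟩ := ih g
      exact ⟨rfl, rfl⟩
    | branch_false hb' _ => exact absurd hb hb'
  | branch_false hb _ ih =>
    cases h₂ with
    | branch_true hb' _ => exact absurd hb' hb
    | branch_false _ g =>
      obtain ⟨rfl, rfl⟩ := ih g
      exact ⟨rfl, rfl⟩
  | loop_true hb _ _ ih₁ ih₂ =>
    cases h₂ with
    | loop_true _ g₁ g₂ =>
      obtain ⟨rfl, rfl⟩ := ih₁ g₁
      obtain ⟨rfl, rfl⟩ := ih₂ g₂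
      exact ⟨rfl, rfl⟩
    | loop_false hb' => exact absurd hb hb'
  | loop_false hb =>
    cases h₂ with
    | loop_true hb' _ _ => exact absurd hb' hb
    | loop_false _ => exact ⟨rfl, rfl⟩

/-! ## Rectangles and dropping -/

/-- An axis-aligned rectangle with integer coordinates, on or above the `x`-axis and to the right
of the line `x = 0`. -/
@[ext] structure Rect where
  left : ℕ
  bottom : ℕ
  width : ℕ
  height : ℕ
  deriving DecidableEq

namespace Rect

/-- The `x`-coordinate of the right border. -/
def right (R : Rect) : ℕ := R.left + R.width

/-- The `y`-coordinate of the top border. -/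
def top (R : Rect) : ℕ := R.bottom + R.height

/-- The closed region of the plane covered by the rectangle. -/
def region (R : Rect) : Set (ℝ × ℝ) :=
  Set.Icc (R.left : ℝ) R.right ×ˢ Set.Icc (R.bottom : ℝ) R.top

/-- Two rectangles are independent if their interiors do not intersect. -/
def Independent (R R' : Rect) : Prop :=
  Disjoint (interior R.region) (interior R'.region)

end Rect

/-- The height at which the bottom of a rectangle of positive width `a` comes to rest when it is
dropped from above, with left border at `x`, on the rectangles of `S`: the largest height of a top
border of a rectangle of `S` whose horizontal extent overlaps the interval `(x, x + a)`, and the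
floor `0` if there is none. -/
def restHeight (S : Finset Rect) (x a : ℕ) : ℕ :=
  (S.filter fun R => R.left < x + a ∧ x < R.right).sup Rect.top

/-- The final position of a rectangle of width `a` and height `b` dropped with left border
at `x`. -/
def dropped (S : Finset Rect) (x a b : ℕ) : Rect :=
  ⟨x, restHeight S x a, a, b⟩

/-- `a` is the largest width of a rectangle that can be dropped between the lines `x = 0` and
`x = w` so that its bottom lies at or below height `h`, and dropping it with left border at `x`
achieves this. If no rectangle can be dropped in this way, then `a = 0` (and `x` is
irrelevant). -/
def IsWidestDrop (w : ℕ) (S : Finset Rect) (h a x : ℕ) : Prop :=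
  (0 < a → x + a ≤ w ∧ restHeight S x a ≤ h) ∧
    ∀ a' x' : ℕ, 0 < a' → x' + a' ≤ w → restHeight S x' a' ≤ h → a' ≤ a

/-! ## Data structures -/

/-- The three procedures of a data structure. They work on a common memory, which persists from
one call to the next. -/
structure DataStructure where
  build : Prog
  update : Prog
  query : Prog

/-- Admissible sets of rectangles for the construction, listed in an arbitrary order: at most
`c * n` pairwise independent nondegenerate rectangles between the lines `x = 0` and `x = w`, with
coordinates at most `n ^ d`. -/
structure ValidInput (c d n w : ℕ) (L : List Rect) : Prop where
  length_le : L.length ≤ c * n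
  width_pos : ∀ R ∈ L, 0 < R.width
  height_pos : ∀ R ∈ L, 0 < R.height
  right_le : ∀ R ∈ L, R.right ≤ w
  top_le : ∀ R ∈ L, R.top ≤ n ^ d
  independent : L.Pairwise Rect.Independent

/-- Input convention of the construction: registers `0`, `1`, `2` hold `n`, the width `w` of the
board and the number of rectangles, and the `i`-th rectangle occupies the memory cells
`4 * i, …, 4 * i + 3`. All other registers and cells are arbitrary. -/
structure Loaded {W : ℕ} (n w : ℕ) (L : List Rect) (σ : State W) : Prop where
  reg_zero : σ.reg 0 = BitVec.ofNat W n
  reg_one : σ.reg 1 = BitVec.ofNat W w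
  reg_two : σ.reg 2 = BitVec.ofNat W L.length
  left : ∀ (i : ℕ) (hi : i < L.length),
    σ.mem (BitVec.ofNat W (4 * i)) = BitVec.ofNat W L[i].left
  bottom : ∀ (i : ℕ) (hi : i < L.length),
    σ.mem (BitVec.ofNat W (4 * i + 1)) = BitVec.ofNat W L[i].bottom
  width : ∀ (i : ℕ) (hi : i < L.length),
    σ.mem (BitVec.ofNat W (4 * i + 2)) = BitVec.ofNat W L[i].width
  height : ∀ (i : ℕ) (hi : i < L.length),
    σ.mem (BitVec.ofNat W (4 * i + 3)) = BitVec.ofNat W L[i].height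

/-- A rectangle of width `a` and height `b` may be dropped with left border at `x`: it is
nondegenerate, will lie between the lines `x = 0` and `x = w`, its dimensions are at most `n ^ d`
(for the width this follows from `w ≤ n ^ d`), and the set will still have at most `c * n`
elements. -/
structure ValidDrop (c d n w : ℕ) (S : Finset Rect) (x a b : ℕ) : Prop where
  width_pos : 0 < a
  height_pos : 0 < b
  right_le : x + a ≤ w
  height_le : b ≤ n ^ d
  card_lt : S.card < c * n

/-- Calling convention of an update: left border, width and height in registers `0`, `1`, `2`. -/
def State.updateCall {W : ℕ} (σ : State W) (x a b : ℕ) : State W :=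
  ((σ.setReg 0 (BitVec.ofNat W x)).setReg 1 (BitVec.ofNat W a)).setReg 2 (BitVec.ofNat W b)

/-- Calling convention of a query: the height in register `0`. -/
def State.queryCall {W : ℕ} (σ : State W) (h : ℕ) : State W :=
  σ.setReg 0 (BitVec.ofNat W h)

/-- `Reachable D c d n w S σ`: the machine can be in configuration `σ` while the maintained set of
rectangles is `S`, after a construction and any sequence of updates and queries. -/
inductive Reachable (D : DataStructure) (c d n w : ℕ) {W : ℕ} : Finset Rect → State W → Prop
  | build {L : List Rect} {σ σ' : State W} {t : ℕ} :
      ValidInput c d n w L → Loaded n w L σ → Exec D.build σ t σ' →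
        Reachable D c d n w L.toFinset σ'
  | update {S : Finset Rect} {σ σ' : State W} {x a b t : ℕ} :
      Reachable D c d n w S σ → ValidDrop c d n w S x a b →
        Exec D.update (σ.updateCall x a b) t σ' →
        Reachable D c d n w (insert (dropped S x a b) S) σ'
  | query {S : Finset Rect} {σ σ' : State W} {h t : ℕ} :
      Reachable D c d n w S σ → h < 2 ^ W → Exec D.query (σ.queryCall h) t σ' →
        Reachable D c d n w S σ'

end RectDrop

namespace RectDrop

-- Only the skyline matters: the function `sky S` that assigns to each unit column of the board the
-- largest top border above it. A dropped rectangle comes to rest at the largest skyline value over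
-- its columns (`restHeight_le_iff`), and the drop makes the skyline constant over these columns
-- (`sky_insert_dropped`). A query at height `h` asks for a longest run of consecutive columns that
-- are free, that is, of skyline at most `h`.
--
-- The skyline is kept as a sequence of `O(n)` pieces, intervals of constant height, grouped from
-- left to right into blocks of at most `N` pieces, where `N` is about `√(n log n)`. For a fixed
-- threshold `h`, a segment of columns is described well enough by a few numbers: whether it is
-- entirely free, its longest free prefix and suffix, and a longest free run. The description of two
-- neighbouring segments determines that of their union (`Good.join`). As a function of `h` the
-- description is a step function that jumps only at heights of pieces, so a block of `k` pieces has
-- a table of `k` entries sorted by height. Merge sort produces it in `O(k log k)` steps: it merges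
-- the tables of neighbouring segments, carries along the values in force on both sides, and joins
-- them at every key (`ev_mergeE`, `Tree.good`).
--
-- A query finds its threshold in the table of each block by binary search and joins the values from
-- left to right, in `O((n / N) log n)` steps. An update cuts the sequence of blocks at the two ends
-- of the dropped rectangle, reads the largest height of each block in between off the last key of
-- its table, and puts a single block with a single piece in place of these blocks
-- (`dropProg_spec`). This takes a bounded number of table constructions, `O(N log n)`, and of
-- passes over the directory of blocks, `O(n / N)`. The choice of `N` gives the two bounds of the
-- theorem.
--
-- The number of blocks has to stay `O(n / N)`. A drop creates at most two additional blocks and is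
-- followed by two attempts to join neighbouring blocks that have at most `N` pieces together.
-- Either both attempts succeed, or at some moment there is no such pair, and then the number of
-- blocks is bounded by the number of pieces (`Sparse.length_le`, `Rep.update`). The construction
-- computes the skyline with the same merge sort, as a pointwise maximum of the step functions of
-- the single rectangles (`Tree.skyline`).
--
-- Programs are verified by triples `Tri` with a time bound, over natural numbers, where the absence
-- of overflow is a side condition. Memory is never reused: register 3 points to the first free
-- cell, and cells below it stay as they are. Every drop adds a new element to `S`
-- (`dropped_notMem`), so there are at most `c * n` updates, all addresses are polynomial in `n`,
-- and they fit into words if `2 ^ W ≥ n ^ K` (`space_le`, `exists_fits`).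

infixr:60 " ;; " => Prog.seq

/-! ## Natural-number view of the machine -/

/-- A configuration read as natural numbers. -/
structure NS where
  reg : ℕ → ℕ
  mem : ℕ → ℕ

namespace NS

def set (s : NS) (r v : ℕ) : NS := ⟨Function.update s.reg r v, s.mem⟩

def put (s : NS) (a v : ℕ) : NS := ⟨s.reg, Function.update s.mem a v⟩

@[simp] theorem set_reg (s : NS) (r v r' : ℕ) :
    (s.set r v).reg r' = if r' = r then v else s.reg r' := by
  simp [set, Function.update_apply]

@[simp] theorem set_mem (s : NS) (r v : ℕ) : (s.set r v).mem = s.mem := rfl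

@[simp] theorem put_reg (s : NS) (a v : ℕ) : (s.put a v).reg = s.reg := rfl

@[simp] theorem put_mem (s : NS) (a v a' : ℕ) :
    (s.put a v).mem a' = if a' = a then v else s.mem a' := by
  simp [put, Function.update_apply]

end NS

/-- Memory becomes a function on all natural numbers, so that address arithmetic needs no reduction;
the value `0` outside the address space is a mere default. -/
def abs {W : ℕ} (σ : State W) : NS :=
  ⟨fun r => (σ.reg r).toNat, fun a => if a < 2 ^ W then (σ.mem (BitVec.ofNat W a)).toNat else 0⟩

theorem abs_setReg {W : ℕ} (σ : State W) (r : ℕ) (v : BitVec W) :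
    abs (σ.setReg r v) = (abs σ).set r v.toNat := by
  simp only [abs, State.setReg, NS.set, NS.mk.injEq, and_true]
  funext r'
  by_cases h : r' = r <;> simp [h]

theorem abs_setMem {W : ℕ} (σ : State W) (a v : BitVec W) :
    abs (σ.setMem a v) = (abs σ).put a.toNat v.toNat := by
  simp only [abs, State.setMem, NS.put, NS.mk.injEq, true_and]
  funext b
  by_cases h : b = a.toNat
  · subst h; simp [a.isLt]
  · by_cases hb : b < 2 ^ W
    · have : BitVec.ofNat W b ≠ a := by
        intro e; apply h; rw [← e]; simp [Nat.mod_eq_of_lt hb]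
      simp [h, hb, this]
    · simp [h, hb]

def Test.ev (s : NS) : Test → Prop
  | .eq r t => s.reg r = s.reg t
  | .lt r t => s.reg r < s.reg t

instance (s : NS) (b : Test) : Decidable (b.ev s) := by
  cases b <;> unfold Test.ev <;> infer_instance

theorem Test.holds_iff {W : ℕ} (σ : State W) (b : Test) : b.holds σ ↔ b.ev (abs σ) := by
  cases b with
  | eq r s => exact BitVec.toNat_inj.symm
  | lt r s => exact Iff.rfl

/-- `Tri W p s T Q`: started in a configuration that reads as `s`, the program `p` halts within `T`
steps in a configuration that satisfies `Q`. -/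
def Tri (W : ℕ) (p : Prog) (s : NS) (T : ℕ) (Q : NS → Prop) : Prop :=
  ∀ σ : State W, abs σ = s → ∃ t σ', Exec p σ t σ' ∧ t ≤ T ∧ Q (abs σ')

namespace Tri

variable {W : ℕ} {p q : Prog} {s : NS} {T T' T₁ T₂ : ℕ} {Q Q' : NS → Prop} {b : Test}

theorem mono (h : Tri W p s T Q) (hT : T ≤ T') (hQ : ∀ s', Q s' → Q' s') : Tri W p s T' Q' := by
  intro σ hσ
  obtain ⟨t, σ', h1, h2, h3⟩ := h σ hσ
  exact ⟨t, σ', h1, h2.trans hT, hQ _ h3⟩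

theorem seq (h : Tri W p s T₁ fun s₁ => Tri W q s₁ T₂ Q) : Tri W (p ;; q) s (T₁ + T₂) Q := by
  intro σ hσ
  obtain ⟨t, σ₁, h1, h2, h3⟩ := h σ hσ
  obtain ⟨t', σ₂, g1, g2, g3⟩ := h3 σ₁ rfl
  exact ⟨_, σ₂, .seq h1 g1, add_le_add h2 g2, g3⟩

theorem branch (h₁ : b.ev s → Tri W p s T Q) (h₂ : ¬ b.ev s → Tri W q s T Q) :
    Tri W (.branch b p q) s (T + 1) Q := by
  intro σ hσ
  by_cases hb : b.ev s
  · obtain ⟨t, σ', h, h', h''⟩ := h₁ hb σ hσ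
    exact ⟨_, σ', .branch_true ((Test.holds_iff σ b).2 (hσ ▸ hb)) h, by omega, h''⟩
  · obtain ⟨t, σ', h, h', h''⟩ := h₂ hb σ hσ
    exact ⟨_, σ', .branch_false (fun e => hb (hσ ▸ (Test.holds_iff σ b).1 e)) h, by omega, h''⟩

theorem loop_false (hb : ¬ b.ev s) (hQ : Q s) : Tri W (.loop b p) s 1 Q := by
  intro σ hσ
  exact ⟨1, σ, .loop_false (fun e => hb (hσ ▸ (Test.holds_iff σ b).1 e)), le_rfl, hσ ▸ hQ⟩

theorem loop_true (hb : b.ev s) (h : Tri W p s T₁ fun s₁ => Tri W (.loop b p) s₁ T₂ Q) :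
    Tri W (.loop b p) s (T₁ + T₂ + 1) Q := by
  intro σ hσ
  obtain ⟨t, σ₁, h1, h2, h3⟩ := h σ hσ
  obtain ⟨t', σ₂, g1, g2, g3⟩ := h3 σ₁ rfl
  exact ⟨_, σ₂, .loop_true ((Test.holds_iff σ b).2 (hσ ▸ hb)) h1 g1, by omega, g3⟩

end Tri

/-! ## Loop-free programs -/

/-- Effect of a loop-free program, arithmetic modulo `M`. -/
def Prog.runMod (M : ℕ) : Prog → NS → NS
  | .skip, s => s
  | .const r k, s => s.set r (k % M)
  | .move r t, s => s.set r (s.reg t)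
  | .op .add r t u, s => s.set r ((s.reg t + s.reg u) % M)
  | .op .sub r t u, s => s.set r ((M - s.reg u + s.reg t) % M)
  | .op .mul r t u, s => s.set r (s.reg t * s.reg u % M)
  | .op .div r t u, s => s.set r (s.reg t / s.reg u)
  | .op _ _ _ _, s => s
  | .load r t, s => s.set r (s.mem (s.reg t))
  | .store r t, s => s.put (s.reg r) (s.reg t)
  | .seq p q, s => q.runMod M (p.runMod M s)
  | .branch b p q, s => if b.ev s then p.runMod M s else q.runMod M s
  | .loop _ _, s => s

/-- Effect of a loop-free program, exact arithmetic. -/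
def Prog.run : Prog → NS → NS
  | .skip, s => s
  | .const r k, s => s.set r k
  | .move r t, s => s.set r (s.reg t)
  | .op .add r t u, s => s.set r (s.reg t + s.reg u)
  | .op .sub r t u, s => s.set r (s.reg t - s.reg u)
  | .op .mul r t u, s => s.set r (s.reg t * s.reg u)
  | .op .div r t u, s => s.set r (s.reg t / s.reg u)
  | .op _ _ _ _, s => s
  | .load r t, s => s.set r (s.mem (s.reg t))
  | .store r t, s => s.put (s.reg r) (s.reg t)
  | .seq p q, s => q.run (p.run s)
  | .branch b p q, s => if b.ev s then p.run s else q.run s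
  | .loop _ _, s => s

/-- The program uses only the instructions that `Prog.run` covers. -/
def Prog.plain : Prog → Prop
  | .skip | .const _ _ | .move _ _ | .load _ _ | .store _ _ => True
  | .op .add _ _ _ | .op .sub _ _ _ | .op .mul _ _ _ | .op .div _ _ _ => True
  | .op _ _ _ _ => False
  | .seq p q => p.plain ∧ q.plain
  | .branch _ p q => p.plain ∧ q.plain
  | .loop _ _ => False

/-- No arithmetic operation of the loop-free program leaves the range of words. -/
def Prog.ok (M : ℕ) : Prog → NS → Prop
  | .skip, _ => True
  | .const _ k, _ => k < M
  | .move _ _, _ => True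
  | .op .add _ t u, s => s.reg t + s.reg u < M
  | .op .sub _ t u, s => s.reg u ≤ s.reg t
  | .op .mul _ t u, s => s.reg t * s.reg u < M
  | .op .div _ _ _, _ => True
  | .op _ _ _ _, _ => False
  | .load _ _, _ => True
  | .store _ _, _ => True
  | .seq p q, s => p.ok M s ∧ q.ok M (p.run s)
  | .branch b p q, s => (b.ev s → p.ok M s) ∧ (¬ b.ev s → q.ok M s)
  | .loop _ _, _ => False

def Prog.cost : Prog → ℕ
  | .seq p q => p.cost + q.cost
  | .branch _ p q => max p.cost q.cost + 1
  | _ => 1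

/-- The modular semantics asks nothing of the register contents. This is what `Computes` needs,
whose specification ranges over all states. -/
theorem Tri.runMod {W : ℕ} {p : Prog} (hp : p.plain) (s : NS) :
    Tri W p s p.cost fun s' => s' = p.runMod (2 ^ W) s := by
  induction p generalizing s with
  | skip => intro σ hσ; exact ⟨_, _, .skip σ, le_rfl, hσ⟩
  | const r k =>
    intro σ hσ
    exact ⟨_, _, .const r k σ, le_rfl, by rw [abs_setReg, hσ]; simp [Prog.runMod]⟩
  | move r t =>
    intro σ hσ
    exact ⟨_, _, .move r t σ, le_rfl, by rw [abs_setReg, hσ]; simp [Prog.runMod, ← hσ, abs]⟩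
  | op o r t u =>
    intro σ hσ
    refine ⟨_, _, .op o r t u σ, le_rfl, ?_⟩
    rw [abs_setReg]
    cases o <;> simp [Prog.plain] at hp <;>
      simp [Prog.runMod, ← hσ, abs, BinOp.apply, BitVec.toNat_sub]
  | load r t =>
    intro σ hσ
    refine ⟨_, _, .load r t σ, le_rfl, ?_⟩
    rw [abs_setReg]
    simp [Prog.runMod, ← hσ, abs, (σ.reg t).isLt]
  | store r t =>
    intro σ hσ
    refine ⟨_, _, .store r t σ, le_rfl, ?_⟩
    rw [abs_setMem]
    simp [Prog.runMod, ← hσ, abs]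
  | seq p q ihp ihq =>
    exact Tri.seq ((ihp hp.1 s).mono le_rfl fun s' h => h ▸ ihq hp.2 _)
  | branch b p q ihp ihq =>
    refine Tri.branch (fun hb => ?_) fun hb => ?_
    · exact (ihp hp.1 s).mono (le_max_left _ _) fun s' h => by simp [Prog.runMod, hb, h]
    · exact (ihq hp.2 s).mono (le_max_right _ _) fun s' h => by simp [Prog.runMod, hb, h]
  | loop b p => exact hp.elim

/-- The bounds on all registers and cells are hypothesis and conclusion at once, because the next
instruction of a sequence needs them again: the machine computes `t - u` as `2 ^ W - u + t`, which
is correct only for words. -/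
theorem Prog.runMod_eq_run {W : ℕ} {p : Prog} {s : NS} (hs : ∀ r, s.reg r < 2 ^ W)
    (hm : ∀ a, s.mem a < 2 ^ W) (h : p.ok (2 ^ W) s) :
    p.runMod (2 ^ W) s = p.run s ∧ (∀ r, (p.run s).reg r < 2 ^ W) ∧ ∀ a, (p.run s).mem a < 2 ^ W := by
  have key : ∀ (r v : ℕ), v < 2 ^ W →
      (∀ r', (s.set r v).reg r' < 2 ^ W) ∧ ∀ a, (s.set r v).mem a < 2 ^ W := by
    intro r v hv
    refine ⟨fun r' => ?_, hm⟩
    rw [NS.set_reg]; split_ifs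
    · exact hv
    · exact hs r'
  induction p generalizing s with
  | skip => exact ⟨rfl, hs, hm⟩
  | const r k =>
    have h : k < 2 ^ W := h
    refine ⟨by simp [runMod, run, Nat.mod_eq_of_lt h], key r k h⟩
  | move r t => exact ⟨rfl, key r _ (hs t)⟩
  | op o r t u =>
    cases o <;> simp only [ok] at h
    · exact ⟨by simp [runMod, run, Nat.mod_eq_of_lt h], key r _ h⟩
    · have : 2 ^ W - s.reg u + s.reg t = (s.reg t - s.reg u) + 2 ^ W := by
        have := hs u; omega
      have h2 : s.reg t - s.reg u < 2 ^ W := lt_of_le_of_lt (Nat.sub_le _ _) (hs t)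
      exact ⟨by simp [runMod, run, this, Nat.mod_eq_of_lt h2], key r _ h2⟩
    · exact ⟨by simp [runMod, run, Nat.mod_eq_of_lt h], key r _ h⟩
    · exact ⟨rfl, key r _ (lt_of_le_of_lt (Nat.div_le_self _ _) (hs t))⟩
  | load r t => exact ⟨rfl, key r _ (hm _)⟩
  | store r t =>
    refine ⟨rfl, hs, fun a => ?_⟩
    show (s.put _ _).mem a < _
    rw [NS.put_mem]; split_ifs
    · exact hs t
    · exact hm a
  | seq p q ihp ihq =>
    obtain ⟨e, h1, h2⟩ := ihp hs hm h.1 key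
    obtain ⟨e', h1', h2'⟩ := ihq h1 h2 h.2 (by
      intro r v hv
      refine ⟨fun r' => ?_, h2⟩
      rw [NS.set_reg]; split_ifs
      · exact hv
      · exact h1 r')
    exact ⟨by rw [runMod, run, e, e'], h1', h2'⟩
  | branch b p q ihp ihq =>
    by_cases hb : b.ev s
    · obtain ⟨e, h'⟩ := ihp hs hm (h.1 hb) key
      simp only [runMod, run, hb, if_true]; exact ⟨e, h'⟩
    · obtain ⟨e, h'⟩ := ihq hs hm (h.2 hb) key
      simp only [runMod, run, hb, if_false]; exact ⟨e, h'⟩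
  | loop b p => exact h.elim

theorem abs_reg_lt {W : ℕ} (σ : State W) (r : ℕ) : (abs σ).reg r < 2 ^ W := (σ.reg r).isLt

theorem abs_mem_lt {W : ℕ} (σ : State W) (a : ℕ) : (abs σ).mem a < 2 ^ W := by
  simp only [abs]; split_ifs
  · exact BitVec.isLt _
  · positivity

theorem Tri.run {W : ℕ} {p : Prog} {s : NS} {Q : NS → Prop} (hp : p.plain) (h : p.ok (2 ^ W) s)
    (hQ : Q (p.run s)) : Tri W p s p.cost Q := by
  intro σ hσ
  obtain ⟨t, σ', h1, h2, h3⟩ := Tri.runMod (W := W) hp s σ hσ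
  refine ⟨t, σ', h1, h2, ?_⟩
  rw [h3, (Prog.runMod_eq_run (hσ ▸ abs_reg_lt σ) (hσ ▸ abs_mem_lt σ) h).1]
  exact hQ

theorem Tri.run' {W : ℕ} {p : Prog} {s : NS} {T : ℕ} {Q : NS → Prop} (hp : p.plain)
    (h : p.ok (2 ^ W) s) (hT : p.cost ≤ T) (hQ : Q (p.run s)) : Tri W p s T Q :=
  (Tri.run hp h hQ).mono hT fun _ h => h

/-! ## Frames -/

/-- The registers that a program may write. -/
def Prog.writes : Prog → ℕ → Prop
  | .skip, _ | .store _ _, _ => False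
  | .const r _, r' | .move r _, r' | .op _ r _ _, r' | .load r _, r' => r' = r
  | .seq p q, r' | .branch _ p q, r' => p.writes r' ∨ q.writes r'
  | .loop _ p, r' => p.writes r'

/-- The program does not write the memory. -/
def Prog.readOnly : Prog → Prop
  | .store _ _ => False
  | .seq p q | .branch _ p q => p.readOnly ∧ q.readOnly
  | .loop _ p => p.readOnly
  | _ => True

theorem Exec.reg_eq {W : ℕ} {p : Prog} {σ σ' : State W} {t r : ℕ} (h : Exec p σ t σ')
    (hr : ¬ p.writes r) : σ'.reg r = σ.reg r := by
  induction h with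
  | skip | store => rfl
  | const | move | op | load =>
    exact Function.update_of_ne (fun e => hr e) _ _
  | seq _ _ ih₁ ih₂ =>
    rw [Prog.writes, not_or] at hr
    rw [ih₂ hr.2, ih₁ hr.1]
  | branch_true _ _ ih => exact ih fun e => hr (Or.inl e)
  | branch_false _ _ ih => exact ih fun e => hr (Or.inr e)
  | loop_true _ _ _ ih₁ ih₂ => rw [ih₂ hr, ih₁ hr]
  | loop_false => rfl

theorem Exec.mem_eq {W : ℕ} {p : Prog} {σ σ' : State W} {t : ℕ} (h : Exec p σ t σ')
    (hp : p.readOnly) : σ'.mem = σ.mem := by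
  induction h with
  | skip | const | move | op | load | loop_false => rfl
  | store => exact hp.elim
  | seq _ _ ih₁ ih₂ => rw [ih₂ hp.2, ih₁ hp.1]
  | branch_true _ _ ih => exact ih hp.1
  | branch_false _ _ ih => exact ih hp.2
  | loop_true _ _ _ ih₁ ih₂ => rw [ih₂ hp, ih₁ hp]

namespace Tri

variable {W : ℕ} {p : Prog} {s : NS} {T : ℕ} {Q : NS → Prop}

theorem frame (h : Tri W p s T Q) :
    Tri W p s T fun s' => Q s' ∧ ∀ r, ¬ p.writes r → s'.reg r = s.reg r := by
  intro σ hσ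
  obtain ⟨t, σ', h1, h2, h3⟩ := h σ hσ
  refine ⟨t, σ', h1, h2, h3, fun r hr => ?_⟩
  rw [← hσ]
  exact congrArg BitVec.toNat (h1.reg_eq hr)

/-- Scratch registers are allotted in layers, so that a subroutine writes only from some number `l`
on. The exception is register 3, the pointer to the first free cell. -/
theorem frame_lt {l : ℕ} (h : Tri W p s T Q) (hp : ∀ r, p.writes r → r = 3 ∨ l ≤ r) :
    Tri W p s T fun s' => Q s' ∧ ∀ r < l, r ≠ 3 → s'.reg r = s.reg r :=
  h.frame.mono le_rfl fun s' ⟨h1, h2⟩ => ⟨h1, fun r hr h3 => h2 r fun hw => by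
    have := hp r hw
    omega⟩

theorem frame_mem (h : Tri W p s T Q) (hp : p.readOnly) :
    Tri W p s T fun s' => Q s' ∧ s'.mem = s.mem := by
  intro σ hσ
  obtain ⟨t, σ', h1, h2, h3⟩ := h σ hσ
  refine ⟨t, σ', h1, h2, h3, ?_⟩
  rw [← hσ]
  simp only [abs, h1.mem_eq hp]

end Tri

/-! ## Entries, arrays, merging -/

/-- The value part of an entry. For a segment of columns and a height bound: `f` is `1` if all
columns are free, `p` and `s` are the lengths of the longest free prefix and suffix, `sp` is the
start of that suffix, `b` and `bp` are length and start of a longest free run. -/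
@[ext] structure V where
  (f p s sp b bp : ℕ)

def V.zero : V := ⟨0, 0, 0, 0, 0, 0⟩

/-- A key and a value; occupies seven words. -/
abbrev Entry := ℕ × V

def vreg (s : NS) (r : ℕ) : V :=
  ⟨s.reg r, s.reg (r + 1), s.reg (r + 2), s.reg (r + 3), s.reg (r + 4), s.reg (r + 5)⟩

def EntryAt (mem : ℕ → ℕ) (a : ℕ) (e : Entry) : Prop :=
  mem a = e.1 ∧ mem (a + 1) = e.2.f ∧ mem (a + 2) = e.2.p ∧ mem (a + 3) = e.2.s ∧
    mem (a + 4) = e.2.sp ∧ mem (a + 5) = e.2.b ∧ mem (a + 6) = e.2.bp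

def Ents (mem : ℕ → ℕ) : ℕ → List Entry → Prop
  | _, [] => True
  | a, e :: l => EntryAt mem a e ∧ Ents mem (a + 7) l

theorem EntryAt.copy {mem mem' : ℕ → ℕ} {a a' : ℕ} {e : Entry} (h : EntryAt mem a e)
    (hm : ∀ t < 7, mem' (a' + t) = mem (a + t)) : EntryAt mem' a' e := by
  obtain ⟨h0, h1, h2, h3, h4, h5, h6⟩ := h
  have e0 := hm 0 (by norm_num)
  simp only [add_zero] at e0
  exact ⟨e0.trans h0, (hm 1 (by norm_num)).trans h1, (hm 2 (by norm_num)).trans h2,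
    (hm 3 (by norm_num)).trans h3, (hm 4 (by norm_num)).trans h4, (hm 5 (by norm_num)).trans h5,
    (hm 6 (by norm_num)).trans h6⟩

theorem Ents.copy {mem mem' : ℕ → ℕ} {a a' : ℕ} {l : List Entry} (h : Ents mem a l)
    (hm : ∀ t < 7 * l.length, mem' (a' + t) = mem (a + t)) : Ents mem' a' l := by
  induction l generalizing a a' with
  | nil => trivial
  | cons e l ih =>
    simp only [List.length_cons] at hm
    refine ⟨h.1.copy fun t ht => hm t (by omega), ih h.2 fun t ht => ?_⟩
    have := hm (7 + t) (by omega)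
    simpa only [add_assoc] using this

theorem Ents.congr {mem mem' : ℕ → ℕ} {a n : ℕ} {l : List Entry} (h : Ents mem a l)
    (hm : ∀ x < n, mem' x = mem x) (hn : a + 7 * l.length ≤ n) : Ents mem' a l :=
  h.copy fun t ht => hm _ (by omega)

theorem Ents_append {mem : ℕ → ℕ} {a : ℕ} {l l' : List Entry} :
    Ents mem a (l ++ l') ↔ Ents mem a l ∧ Ents mem (a + 7 * l.length) l' := by
  induction l generalizing a with
  | nil => simp [Ents]
  | cons e l ih =>
    simp only [List.cons_append, Ents, ih, List.length_cons, and_assoc]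
    rw [show a + 7 + 7 * l.length = a + 7 * (l.length + 1) by ring]

/-- Merge two key-sorted step functions, given as lists of entries, combining their values with
`f`; `c₁` and `c₂` are the current values. -/
def mergeE (f : V → V → V) : V → V → List Entry → List Entry → List Entry
  | _, _, [], [] => []
  | _, c₂, a :: A, [] => (a.1, f a.2 c₂) :: mergeE f a.2 c₂ A []
  | c₁, _, [], b :: B => (b.1, f c₁ b.2) :: mergeE f c₁ b.2 [] B
  | c₁, c₂, a :: A, b :: B =>
    if b.1 < a.1 then (b.1, f c₁ b.2) :: mergeE f c₁ b.2 (a :: A) B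
    else (a.1, f a.2 c₂) :: mergeE f a.2 c₂ A (b :: B)
  termination_by _ _ A B => A.length + B.length

/-- Equal keys are not fused, so the size of every table is known beforehand. -/
theorem length_mergeE (f : V → V → V) (c₁ c₂ : V) (A B : List Entry) :
    (mergeE f c₁ c₂ A B).length = A.length + B.length := by
  fun_induction mergeE f c₁ c₂ A B <;> simp_all <;> omega

/-! ### Copying -/

def copyLoop : Prog :=
  .loop (.lt 102 101) (.load 104 100 ;; .store 3 104 ;; .op .add 100 100 103 ;;
    .op .add 3 3 103 ;; .op .sub 101 101 103)

/-- Append a copy of the `reg 101` words at address `reg 100`. -/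
def copyProg : Prog := .const 102 0 ;; .const 103 1 ;; copyLoop

theorem copyProg_writes (r : ℕ) (h : copyProg.writes r) : r = 3 ∨ 100 ≤ r := by
  simp [copyProg, copyLoop, Prog.writes] at h
  omega

/-- The source ends at or below the free pointer, hence no cell is read after it has been
overwritten. -/
theorem copyLoop_spec {W : ℕ} (k : ℕ) (s : NS) (hk : s.reg 101 = k) (h2 : s.reg 102 = 0)
    (h3 : s.reg 103 = 1) (hs : s.reg 100 + k ≤ s.reg 3) (hb : s.reg 3 + k < 2 ^ W) :
    Tri W copyLoop s (6 * k + 1) fun s' => s'.reg 3 = s.reg 3 + k ∧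
      (∀ a < s.reg 3, s'.mem a = s.mem a) ∧
      ∀ t < k, s'.mem (s.reg 3 + t) = s.mem (s.reg 100 + t) := by
  induction k generalizing s with
  | zero =>
    refine Tri.loop_false (by simp [Test.ev, hk, h2]) ⟨by simp, fun _ _ => rfl, by simp⟩
  | succ k ih =>
    refine (Tri.loop_true (T₁ := 5) (T₂ := 6 * k + 1) (by simp [Test.ev, hk, h2])
      (Tri.run' (by simp [Prog.plain]) ?_ (by simp [Prog.cost]) ?_)).mono (by omega) fun _ h => h
    · simp [Prog.ok, Prog.run, h3, hk]; omega
    · refine (ih _ ?_ ?_ ?_ ?_ ?_).mono le_rfl ?_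
      · simp [Prog.run, h3, hk]
      · simp [Prog.run, h2]
      · simp [Prog.run, h3]
      · simp [Prog.run, h3]; omega
      · simp [Prog.run, h3]; omega
      · rintro s' ⟨e1, e2, e3⟩
        simp only [Prog.run, h3, hk, NS.set_reg, NS.put_reg, NS.set_mem, NS.put_mem] at e1 e2 e3
        norm_num at e1 e2 e3
        refine ⟨by omega, fun a ha => ?_, fun t ht => ?_⟩
        · rw [e2 a (by omega), if_neg (by omega)]
        · rcases t with _ | t
          · rw [add_zero, e2 _ (by omega), if_pos rfl, add_zero]
          · have := e3 t (by omega)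
            rw [show s.reg 3 + (t + 1) = s.reg 3 + 1 + t by omega, this, if_neg (by omega)]
            congr 1; omega

theorem copyProg_spec {W : ℕ} (s : NS) (hW : 1 < 2 ^ W) (hs : s.reg 100 + s.reg 101 ≤ s.reg 3)
    (hb : s.reg 3 + s.reg 101 < 2 ^ W) :
    Tri W copyProg s (6 * s.reg 101 + 3) fun s' => (s'.reg 3 = s.reg 3 + s.reg 101 ∧
      (∀ a < s.reg 3, s'.mem a = s.mem a) ∧
      ∀ t < s.reg 101, s'.mem (s.reg 3 + t) = s.mem (s.reg 100 + t)) ∧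
      ∀ r < 100, r ≠ 3 → s'.reg r = s.reg r := by
  refine Tri.frame_lt ?_ copyProg_writes
  refine (Tri.seq (Tri.run' (T := 1) (by simp [Prog.plain]) (by simp [Prog.ok])
    (by simp [Prog.cost]) (Tri.seq (Tri.run' (T := 1) (by simp [Prog.plain])
    (by simp [Prog.ok, hW]) (by simp [Prog.cost])
    (copyLoop_spec (s.reg 101) _ ?_ ?_ ?_ ?_ ?_))))).mono (by omega) ?_
  all_goals simp [Prog.run]
  all_goals omega

/-! ### Merging -/

/-- Register 153 tells which list supplies the next entry, `0` for the first and `1` for the second.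
Ties go to the first list, as in `mergeE`. -/
def mergeFlag : Prog :=
  .branch (.eq 110 111) (.const 153 1) (.branch (.eq 112 113) (.const 153 0)
    (.load 154 110 ;; .load 155 112 ;; .branch (.lt 155 154) (.const 153 1) (.const 153 0)))

def loadAt (a r : ℕ) : Prog := .load r a ;; .op .add a a 150

/-- Load the entry at address `reg a`, advance the address. -/
def takeProg (a v : ℕ) : Prog :=
  loadAt a 146 ;; loadAt a v ;; loadAt a (v + 1) ;; loadAt a (v + 2) ;; loadAt a (v + 3) ;;
    loadAt a (v + 4) ;; loadAt a (v + 5)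

def emitReg (r : ℕ) : Prog := .store 3 r ;; .op .add 3 3 150

/-- Append the entry in registers `140, …, 146`. -/
def emitEntry : Prog :=
  emitReg 146 ;; emitReg 140 ;; emitReg 141 ;; emitReg 142 ;; emitReg 143 ;; emitReg 144 ;;
    emitReg 145

/-- Registers 110, 111 and 112, 113 hold the current address and the end of the two lists, 120 to
125 and 130 to 135 the values in force on the two sides, 140 to 145 the combined value, 146 the key,
and 156 the number of entries left. Registers 150 and 151 hold the constants `1` and `0`. -/
def mergeBody (comb : Prog) : Prog :=
  mergeFlag ;; .branch (.eq 153 151) (takeProg 110 120) (takeProg 112 130) ;; comb ;;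
    emitEntry ;; .op .sub 156 156 150

def mergeLoop (comb : Prog) : Prog := .loop (.lt 151 156) (mergeBody comb)

/-- `comb` computes `f` on two values in registers. -/
structure Computes (W : ℕ) (comb : Prog) (f : V → V → V) (c : ℕ) : Prop where
  spec : ∀ s, Tri W comb s c fun s' => vreg s' 140 = f (vreg s 120) (vreg s 130)
  readOnly : comb.readOnly
  writes : ∀ r, comb.writes r → 140 ≤ r ∧ r ≤ 145 ∨ 160 ≤ r

theorem mergeFlag_spec {W : ℕ} (s : NS) (hW : 1 < 2 ^ W) :
    Tri W mergeFlag s 6 fun s' => (s'.reg 153 =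
      (if s.reg 110 = s.reg 111 then 1 else if s.reg 112 = s.reg 113 then 0
        else if s.mem (s.reg 112) < s.mem (s.reg 110) then 1 else 0) ∧ s'.mem = s.mem) ∧
      ∀ r, ¬ mergeFlag.writes r → s'.reg r = s.reg r := by
  refine Tri.frame (Tri.run' (by simp [mergeFlag, Prog.plain]) ?_ (by simp [mergeFlag, Prog.cost]) ?_)
  · simp [mergeFlag, Prog.ok, hW]
  · by_cases h1 : s.reg 110 = s.reg 111
    · simp [mergeFlag, Prog.run, Test.ev, h1]
    by_cases h2 : s.reg 112 = s.reg 113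
    · simp [mergeFlag, Prog.run, Test.ev, h1, h2]
    by_cases h3 : s.mem (s.reg 112) < s.mem (s.reg 110)
    · simp [mergeFlag, Prog.run, Test.ev, h1, h2, h3]
    · simp [mergeFlag, Prog.run, Test.ev, h1, h2, h3]

theorem takeProg_A {W : ℕ} {s : NS} {e : Entry} (h1 : s.reg 150 = 1)
    (he : EntryAt s.mem (s.reg 110) e) (hb : s.reg 110 + 7 < 2 ^ W) :
    Tri W (takeProg 110 120) s 14 fun s' => (s'.reg 146 = e.1 ∧ vreg s' 120 = e.2 ∧
      s'.reg 110 = s.reg 110 + 7 ∧ s'.mem = s.mem) ∧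
      ∀ r, ¬ (takeProg 110 120).writes r → s'.reg r = s.reg r := by
  obtain ⟨e0, e1, e2, e3, e4, e5, e6⟩ := he
  refine Tri.frame (Tri.run' (by simp [takeProg, loadAt, Prog.plain]) ?_
    (by simp [takeProg, loadAt, Prog.cost]) ?_)
  · simp [takeProg, loadAt, Prog.ok, Prog.run, h1]; omega
  · simp [takeProg, loadAt, Prog.run, h1, vreg, e0, e1, e2, e3, e4, e5, e6, add_assoc]

theorem takeProg_B {W : ℕ} {s : NS} {e : Entry} (h1 : s.reg 150 = 1)
    (he : EntryAt s.mem (s.reg 112) e) (hb : s.reg 112 + 7 < 2 ^ W) :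
    Tri W (takeProg 112 130) s 14 fun s' => (s'.reg 146 = e.1 ∧ vreg s' 130 = e.2 ∧
      s'.reg 112 = s.reg 112 + 7 ∧ s'.mem = s.mem) ∧
      ∀ r, ¬ (takeProg 112 130).writes r → s'.reg r = s.reg r := by
  obtain ⟨e0, e1, e2, e3, e4, e5, e6⟩ := he
  refine Tri.frame (Tri.run' (by simp [takeProg, loadAt, Prog.plain]) ?_
    (by simp [takeProg, loadAt, Prog.cost]) ?_)
  · simp [takeProg, loadAt, Prog.ok, Prog.run, h1]; omega
  · simp [takeProg, loadAt, Prog.run, h1, vreg, e0, e1, e2, e3, e4, e5, e6, add_assoc]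

theorem emitEntry_spec {W : ℕ} {s : NS} (h1 : s.reg 150 = 1) (hb : s.reg 3 + 7 < 2 ^ W) :
    Tri W emitEntry s 14 fun s' => (s'.reg 3 = s.reg 3 + 7 ∧
      (∀ a < s.reg 3, s'.mem a = s.mem a) ∧
      EntryAt s'.mem (s.reg 3) (s.reg 146, vreg s 140)) ∧
      ∀ r, ¬ emitEntry.writes r → s'.reg r = s.reg r := by
  refine Tri.frame (Tri.run' (by simp [emitEntry, emitReg, Prog.plain]) ?_
    (by simp [emitEntry, emitReg, Prog.cost]) ?_)
  · simp [emitEntry, emitReg, Prog.ok, Prog.run, h1]; omega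
  · refine ⟨by simp [emitEntry, emitReg, Prog.run, h1], fun a ha => ?_, ?_⟩
    · simp [emitEntry, emitReg, Prog.run, h1]
      repeat rw [if_neg (by omega)]
    · simp [emitEntry, emitReg, Prog.run, h1, vreg, EntryAt, add_assoc]

theorem vreg_congr {s s' : NS} {r : ℕ} (h : ∀ t < 6, s'.reg (r + t) = s.reg (r + t)) :
    vreg s' r = vreg s r := by
  have e0 := h 0 (by norm_num)
  simp only [add_zero] at e0
  simp only [vreg, e0, h 1 (by norm_num), h 2 (by norm_num), h 3 (by norm_num), h 4 (by norm_num),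
    h 5 (by norm_num)]

/-- The part of a merge step after the entry has been loaded. -/
theorem mergeTail_spec {W : ℕ} {comb : Prog} {f : V → V → V} {c : ℕ} (hc : Computes W comb f c)
    {s : NS} (h1 : s.reg 150 = 1) (hk : 0 < s.reg 156) (hb : s.reg 3 + 7 < 2 ^ W) :
    Tri W (comb ;; emitEntry ;; .op .sub 156 156 150) s (c + 15) fun s' =>
      s'.reg 3 = s.reg 3 + 7 ∧ (∀ a < s.reg 3, s'.mem a = s.mem a) ∧
      EntryAt s'.mem (s.reg 3) (s.reg 146, f (vreg s 120) (vreg s 130)) ∧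
      s'.reg 156 = s.reg 156 - 1 ∧
      ∀ r, r < 140 ∧ r ≠ 3 ∨ 150 ≤ r ∧ r ≤ 155 → s'.reg r = s.reg r := by
  refine (Tri.seq (((hc.spec s).frame_mem hc.readOnly).frame.mono le_rfl ?_)).mono
    (T := c + (14 + 1)) le_rfl fun _ h => h
  rintro s1 ⟨⟨hv, hm⟩, hf⟩
  have fr : ∀ r, r < 140 ∨ 146 ≤ r ∧ r < 160 → s1.reg r = s.reg r := fun r hr =>
    hf r fun hw => by have := hc.writes r hw; omega
  refine Tri.seq ((emitEntry_spec (by rw [fr _ (by omega), h1])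
    (by rw [fr _ (by omega)]; exact hb)).mono le_rfl ?_)
  rintro s2 ⟨⟨g1, g2, g3⟩, hg⟩
  have fr2 : ∀ r, r < 140 ∧ r ≠ 3 ∨ 147 ≤ r ∧ r < 160 → s2.reg r = s.reg r := fun r hr => by
    rw [hg r (by simp [emitEntry, emitReg, Prog.writes]; omega), fr r (by omega)]
  refine Tri.run' (by simp [Prog.plain]) ?_ (by simp [Prog.cost]) ?_
  · simp [Prog.ok, fr2, h1]; omega
  · rw [fr 3 (by omega)] at g1 g2 g3
    rw [fr 146 (by omega), hv] at g3
    refine ⟨by simp [Prog.run, g1], fun a ha => ?_, by simpa [Prog.run] using g3,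
      by simp [Prog.run, fr2, h1], fun r hr => ?_⟩
    · simp [Prog.run, g2 a ha, hm]
    · simp [Prog.run, show r ≠ 156 by omega, fr2 r (by omega)]

theorem mergeBody_A {W : ℕ} {comb : Prog} {f : V → V → V} {c : ℕ} (hc : Computes W comb f c)
    (hW : 1 < 2 ^ W) {s : NS} {e : Entry} (h1 : s.reg 150 = 1) (h0 : s.reg 151 = 0)
    (hk : 0 < s.reg 156) (hb : s.reg 3 + 7 < 2 ^ W) (he : EntryAt s.mem (s.reg 110) e)
    (ha : s.reg 110 + 7 < 2 ^ W) (hne : s.reg 110 ≠ s.reg 111)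
    (hle : s.reg 112 ≠ s.reg 113 → s.mem (s.reg 110) ≤ s.mem (s.reg 112)) :
    Tri W (mergeBody comb) s (c + 36) fun s' =>
      s'.reg 3 = s.reg 3 + 7 ∧ (∀ a < s.reg 3, s'.mem a = s.mem a) ∧
      EntryAt s'.mem (s.reg 3) (e.1, f e.2 (vreg s 130)) ∧ s'.reg 156 = s.reg 156 - 1 ∧
      vreg s' 120 = e.2 ∧ vreg s' 130 = vreg s 130 ∧ s'.reg 110 = s.reg 110 + 7 ∧
      s'.reg 111 = s.reg 111 ∧ s'.reg 112 = s.reg 112 ∧ s'.reg 113 = s.reg 113 ∧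
      s'.reg 150 = 1 ∧ s'.reg 151 = 0 := by
  refine (Tri.seq ((mergeFlag_spec s hW).mono le_rfl ?_)).mono
    (T := 6 + (15 + (c + 15))) (by omega) fun _ h => h
  rintro s1 ⟨⟨hv, hm⟩, hf⟩
  have fr : ∀ r, r < 153 ∨ 156 ≤ r → s1.reg r = s.reg r := fun r hr =>
    hf r (by simp [mergeFlag, Prog.writes]; omega)
  have hv0 : s1.reg 153 = 0 := by
    rw [hv, if_neg hne]
    by_cases h : s.reg 112 = s.reg 113
    · rw [if_pos h]
    · rw [if_neg h, if_neg (by have := hle h; omega)]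
  refine Tri.seq (Tri.branch (T := 14) (fun _ => ?_) fun hx => ?_)
  swap
  · exact absurd (by simp [Test.ev, hv0, fr, h0]) hx
  refine (takeProg_A (e := e) (by rw [fr _ (by omega), h1])
    (by rw [fr _ (by omega), hm]; exact he) (by rw [fr _ (by omega)]; exact ha)).mono le_rfl ?_
  rintro s2 ⟨⟨g1, g2, g3, g4⟩, hg⟩
  have fr2 : ∀ r, r < 110 ∨ 111 ≤ r ∧ r < 120 ∨ 126 ≤ r ∧ r < 146 ∨ 147 ≤ r ∧ r < 153 ∨ 156 ≤ r →
      s2.reg r = s.reg r := fun r hr => by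
    rw [hg r (by simp [takeProg, loadAt, Prog.writes]; omega), fr r (by omega)]
  refine (mergeTail_spec hc (by rw [fr2 _ (by omega), h1])
    (by rw [fr2 _ (by omega)]; exact hk) (by rw [fr2 _ (by omega)]; exact hb)).mono le_rfl ?_
  rintro s3 ⟨k1, k2, k3, k4, k5⟩
  have v3 : vreg s2 130 = vreg s 130 := vreg_congr fun t ht => fr2 _ (by omega)
  rw [fr2 3 (by omega)] at k1 k2 k3
  rw [fr2 156 (by omega)] at k4
  rw [g1, g2, v3] at k3
  refine ⟨k1, fun a h => by rw [k2 a h, g4, hm], k3, k4, ?_, ?_, ?_, ?_, ?_, ?_, ?_, ?_⟩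
  · rw [← g2]; exact vreg_congr fun t ht => k5 _ (by omega)
  · rw [← v3]; exact vreg_congr fun t ht => k5 _ (by omega)
  · rw [k5 _ (by omega), g3, fr _ (by omega)]
  all_goals rw [k5 _ (by omega), fr2 _ (by omega)]
  · exact h1
  · exact h0

theorem mergeBody_B {W : ℕ} {comb : Prog} {f : V → V → V} {c : ℕ} (hc : Computes W comb f c)
    (hW : 1 < 2 ^ W) {s : NS} {e : Entry} (h1 : s.reg 150 = 1) (h0 : s.reg 151 = 0)
    (hk : 0 < s.reg 156) (hb : s.reg 3 + 7 < 2 ^ W) (he : EntryAt s.mem (s.reg 112) e)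
    (ha : s.reg 112 + 7 < 2 ^ W) (hne : s.reg 112 ≠ s.reg 113)
    (hle : s.reg 110 ≠ s.reg 111 → s.mem (s.reg 112) < s.mem (s.reg 110)) :
    Tri W (mergeBody comb) s (c + 36) fun s' =>
      s'.reg 3 = s.reg 3 + 7 ∧ (∀ a < s.reg 3, s'.mem a = s.mem a) ∧
      EntryAt s'.mem (s.reg 3) (e.1, f (vreg s 120) e.2) ∧ s'.reg 156 = s.reg 156 - 1 ∧
      vreg s' 120 = vreg s 120 ∧ vreg s' 130 = e.2 ∧ s'.reg 112 = s.reg 112 + 7 ∧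
      s'.reg 110 = s.reg 110 ∧ s'.reg 111 = s.reg 111 ∧ s'.reg 113 = s.reg 113 ∧
      s'.reg 150 = 1 ∧ s'.reg 151 = 0 := by
  refine (Tri.seq ((mergeFlag_spec s hW).mono le_rfl ?_)).mono
    (T := 6 + (15 + (c + 15))) (by omega) fun _ h => h
  rintro s1 ⟨⟨hv, hm⟩, hf⟩
  have fr : ∀ r, r < 153 ∨ 156 ≤ r → s1.reg r = s.reg r := fun r hr =>
    hf r (by simp [mergeFlag, Prog.writes]; omega)
  have hv0 : s1.reg 153 = 1 := by
    rw [hv, if_neg hne]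
    by_cases h : s.reg 110 = s.reg 111
    · rw [if_pos h]
    · rw [if_neg h, if_pos (hle h)]
  refine Tri.seq (Tri.branch (T := 14) (fun hx => ?_) fun _ => ?_)
  · exact absurd hx (by simp [Test.ev, hv0, fr, h0])
  refine (takeProg_B (e := e) (by rw [fr _ (by omega), h1])
    (by rw [fr _ (by omega), hm]; exact he) (by rw [fr _ (by omega)]; exact ha)).mono le_rfl ?_
  rintro s2 ⟨⟨g1, g2, g3, g4⟩, hg⟩
  have fr2 : ∀ r, r < 112 ∨ 113 ≤ r ∧ r < 130 ∨ 136 ≤ r ∧ r < 146 ∨ 147 ≤ r ∧ r < 153 ∨ 156 ≤ r →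
      s2.reg r = s.reg r := fun r hr => by
    rw [hg r (by simp [takeProg, loadAt, Prog.writes]; omega), fr r (by omega)]
  refine (mergeTail_spec hc (by rw [fr2 _ (by omega), h1])
    (by rw [fr2 _ (by omega)]; exact hk) (by rw [fr2 _ (by omega)]; exact hb)).mono le_rfl ?_
  rintro s3 ⟨k1, k2, k3, k4, k5⟩
  have v3 : vreg s2 120 = vreg s 120 := vreg_congr fun t ht => fr2 _ (by omega)
  rw [fr2 3 (by omega)] at k1 k2 k3
  rw [fr2 156 (by omega)] at k4
  rw [g1, g2, v3] at k3
  refine ⟨k1, fun a h => by rw [k2 a h, g4, hm], k3, k4, ?_, ?_, ?_, ?_, ?_, ?_, ?_, ?_⟩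
  · rw [← v3]; exact vreg_congr fun t ht => k5 _ (by omega)
  · rw [← g2]; exact vreg_congr fun t ht => k5 _ (by omega)
  · rw [k5 _ (by omega), g3, fr _ (by omega)]
  all_goals rw [k5 _ (by omega), fr2 _ (by omega)]
  · exact h1
  · exact h0

theorem mergeLoop_writes {W : ℕ} {comb : Prog} {f : V → V → V} {c : ℕ} (hc : Computes W comb f c)
    (r : ℕ) (h : (mergeLoop comb).writes r) : r = 3 ∨ 100 ≤ r := by
  by_cases hw : comb.writes r
  · have := hc.writes r hw
    omega
  · simp [mergeLoop, mergeBody, mergeFlag, takeProg, loadAt, emitEntry, emitReg, Prog.writes, hw] at h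
    omega

/-- The arguments `c₁`, `c₂` of `mergeE` are the contents of the value registers. The output goes to
fresh cells above both inputs, which therefore stay intact throughout the recursion. -/
theorem mergeLoop_spec {W : ℕ} {comb : Prog} {f : V → V → V} {c : ℕ} (hc : Computes W comb f c)
    (hW : 1 < 2 ^ W) (A B : List Entry) (s : NS) (hk : s.reg 156 = A.length + B.length)
    (h1 : s.reg 150 = 1) (h0 : s.reg 151 = 0) (hA : Ents s.mem (s.reg 110) A)
    (hA' : s.reg 111 = s.reg 110 + 7 * A.length) (hB : Ents s.mem (s.reg 112) B)
    (hB' : s.reg 113 = s.reg 112 + 7 * B.length) (hA3 : s.reg 111 ≤ s.reg 3)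
    (hB3 : s.reg 113 ≤ s.reg 3) (hb : s.reg 3 + 7 * (A.length + B.length) < 2 ^ W) :
    Tri W (mergeLoop comb) s ((A.length + B.length) * (c + 37) + 1) fun s' =>
      s'.reg 3 = s.reg 3 + 7 * (A.length + B.length) ∧ (∀ a < s.reg 3, s'.mem a = s.mem a) ∧
      Ents s'.mem (s.reg 3) (mergeE f (vreg s 120) (vreg s 130) A B) := by
  obtain ⟨k, hkk⟩ : ∃ k, A.length + B.length = k := ⟨_, rfl⟩
  induction k generalizing A B s with
  | zero =>
    have hA0 : A = [] := List.length_eq_zero_iff.1 (by omega)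
    have hB0 : B = [] := List.length_eq_zero_iff.1 (by omega)
    subst hA0 hB0
    refine (Tri.loop_false ?_ ⟨by simp, fun _ _ => rfl, by simp [mergeE, Ents]⟩).mono (by simp)
      fun _ h => h
    rw [hkk] at hk
    simp [Test.ev, hk, h0]
  | succ k ih =>
    rw [hkk] at hk hb ⊢
    have hev : (Test.lt 151 156).ev s := by simp [Test.ev, hk, h0]
    have stepA : ∀ a A', A = a :: A' →
        (s.reg 112 ≠ s.reg 113 → s.mem (s.reg 110) ≤ s.mem (s.reg 112)) →
        mergeE f (vreg s 120) (vreg s 130) A B =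
          (a.1, f a.2 (vreg s 130)) :: mergeE f a.2 (vreg s 130) A' B →
        Tri W (mergeLoop comb) s ((k + 1) * (c + 37) + 1) fun s' =>
          s'.reg 3 = s.reg 3 + 7 * (k + 1) ∧ (∀ a < s.reg 3, s'.mem a = s.mem a) ∧
          Ents s'.mem (s.reg 3) (mergeE f (vreg s 120) (vreg s 130) A B) := by
      rintro a A' rfl hle hE
      simp only [List.length_cons] at hkk hA'
      refine (Tri.loop_true (T₂ := k * (c + 37) + 1) hev
        ((mergeBody_A hc hW h1 h0 (by omega) (by omega) hA.1 (by omega) (by omega) hle).mono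
          le_rfl ?_)).mono (by rw [add_mul]; omega) fun _ h => h
      rintro s1 ⟨q1, q2, q3, q4, q5, q6, q7, q8, q9, q10, q11, q12⟩
      refine (ih A' B s1 (by omega) q11 q12 ?_ (by omega) ?_ (by omega) (by omega) (by omega)
        (by omega) (by omega)).mono (by rw [show A'.length + B.length = k by omega]) ?_
      · rw [q7]; exact hA.2.congr q2 (by omega)
      · rw [q9]; exact hB.congr q2 (by omega)
      · rintro s2 ⟨p1, p2, p3⟩
        refine ⟨by omega, fun x hx => by rw [p2 x (by omega), q2 x hx], ?_⟩
        rw [hE]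
        refine ⟨q3.copy fun t ht => p2 _ (by omega), ?_⟩
        rw [← q1, ← q5, ← q6]; exact p3
    have stepB : ∀ b B', B = b :: B' →
        (s.reg 110 ≠ s.reg 111 → s.mem (s.reg 112) < s.mem (s.reg 110)) →
        mergeE f (vreg s 120) (vreg s 130) A B =
          (b.1, f (vreg s 120) b.2) :: mergeE f (vreg s 120) b.2 A B' →
        Tri W (mergeLoop comb) s ((k + 1) * (c + 37) + 1) fun s' =>
          s'.reg 3 = s.reg 3 + 7 * (k + 1) ∧ (∀ a < s.reg 3, s'.mem a = s.mem a) ∧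
          Ents s'.mem (s.reg 3) (mergeE f (vreg s 120) (vreg s 130) A B) := by
      rintro b B' rfl hle hE
      simp only [List.length_cons] at hkk hB'
      refine (Tri.loop_true (T₂ := k * (c + 37) + 1) hev
        ((mergeBody_B hc hW h1 h0 (by omega) (by omega) hB.1 (by omega) (by omega) hle).mono
          le_rfl ?_)).mono (by rw [add_mul]; omega) fun _ h => h
      rintro s1 ⟨q1, q2, q3, q4, q5, q6, q7, q8, q9, q10, q11, q12⟩
      refine (ih A B' s1 (by omega) q11 q12 ?_ (by omega) ?_ (by omega) (by omega) (by omega)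
        (by omega) (by omega)).mono (by rw [show A.length + B'.length = k by omega]) ?_
      · rw [q8]; exact hA.congr q2 (by omega)
      · rw [q7]; exact hB.2.congr q2 (by omega)
      · rintro s2 ⟨p1, p2, p3⟩
        refine ⟨by omega, fun x hx => by rw [p2 x (by omega), q2 x hx], ?_⟩
        rw [hE]
        refine ⟨q3.copy fun t ht => p2 _ (by omega), ?_⟩
        rw [← q1, ← q5, ← q6]; exact p3
    match A, B, hA, hB with
    | [], [], _, _ => simp at hkk
    | a :: A', [], _, _ =>
      exact stepA a A' rfl (fun h => absurd (by simpa using hB'.symm) h) (by rw [mergeE])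
    | [], b :: B', _, _ =>
      exact stepB b B' rfl (fun h => absurd (by simpa using hA'.symm) h) (by rw [mergeE])
    | a :: A', b :: B', hA, hB =>
      by_cases hab : b.1 < a.1
      · exact stepB b B' rfl (fun _ => by rw [hA.1.1, hB.1.1]; exact hab) (by rw [mergeE, if_pos hab])
      · exact stepA a A' rfl (fun _ => by rw [hA.1.1, hB.1.1]; omega) (by rw [mergeE, if_neg hab])

/-! ### Merge sort -/

/-- `Tree f k l o`: the list `o` is obtained from chunks of length `k` of the list `l` by merging
neighbours. -/
inductive Tree (f : V → V → V) (k : ℕ) : List Entry → List Entry → Prop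
  | base {l : List Entry} : l.length = k → Tree f k l l
  | node {l₁ l₂ o₁ o₂ : List Entry} : Tree f k l₁ o₁ → Tree f k l₂ o₂ →
      Tree f k (l₁ ++ l₂) (mergeE f V.zero V.zero o₁ o₂)

theorem Tree.length_eq {f : V → V → V} {k : ℕ} {l o : List Entry} (h : Tree f k l o) :
    o.length = l.length := by
  induction h with
  | base => rfl
  | node _ _ ih₁ ih₂ => rw [length_mergeE, List.length_append, ih₁, ih₂]

theorem Tree.length_pos {f : V → V → V} {k : ℕ} (hk : 0 < k) {l o : List Entry}
    (h : Tree f k l o) : 0 < o.length := by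
  induction h with
  | base h => omega
  | node _ _ ih₁ ih₂ => rw [length_mergeE]; omega

/-- A list of merged chunks, all of length `s` but possibly the last one. -/
inductive Chunked (f : V → V → V) (k s : ℕ) : List Entry → List Entry → Prop
  | nil : Chunked f k s [] []
  | last {l o : List Entry} : Tree f k l o → l.length ≤ s → Chunked f k s l o
  | cons {l₁ l₂ o₁ o₂ : List Entry} : Tree f k l₁ o₁ → l₁.length = s → Chunked f k s l₂ o₂ →
      Chunked f k s (l₁ ++ l₂) (o₁ ++ o₂)

theorem Chunked.base {f : V → V → V} {k m : ℕ} {l : List Entry} (h : l.length = m * k) :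
    Chunked f k k l l := by
  induction m generalizing l with
  | zero => rw [List.length_eq_zero_iff.1 (by omega : l.length = 0)]; exact .nil
  | succ m ih =>
    have h1 : (l.take k).length = k := by rw [List.length_take, h, add_mul]; omega
    have := Chunked.cons (f := f) (.base h1) h1 (ih (l := l.drop k) (by
      rw [List.length_drop, h, add_mul]; omega))
    rwa [List.take_append_drop] at this

/-- Trees are nonempty because `0 < k`, so a chunk length that covers the whole list leaves no room
for a second chunk. -/
theorem Chunked.tree {f : V → V → V} {k s : ℕ} {l o : List Entry} (h : Chunked f k s l o)
    (hk : 0 < k) (hs : l.length ≤ s) : Tree f k l o ∨ l = [] ∧ o = [] := by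
  cases h with
  | nil => exact .inr ⟨rfl, rfl⟩
  | last h _ => exact .inl h
  | cons h₁ h₂ h₃ =>
    rename_i l₁ l₂ o₁ o₂
    rw [List.length_append] at hs
    have h0 : l₂ = [] := List.length_eq_zero_iff.1 (by omega)
    subst h0
    generalize hl : ([] : List Entry) = l at h₃
    cases h₃ with
    | nil => simpa using Or.inl h₁
    | last h _ => have := h.length_pos hk; rw [h.length_eq, ← hl] at this; simp at this
    | cons h h' _ =>
      have := h.length_pos hk
      rw [h.length_eq] at this
      have := congrArg List.length hl
      simp at this; omega

def passSizes : Prog :=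
  .branch (.lt 72 74) (.move 75 72) (.move 75 74) ;; .op .sub 74 74 75 ;;
    .branch (.lt 72 74) (.move 76 72) (.move 76 74) ;; .op .sub 74 74 76 ;;
    .op .mul 82 75 81 ;; .op .mul 83 76 81

def mergeInit : Prog :=
  .move 110 73 ;; .op .add 111 73 82 ;; .move 112 111 ;; .op .add 113 112 83 ;;
    .op .add 156 75 76 ;; .const 150 1 ;; .const 151 0 ;;
    .move 120 151 ;; .move 121 151 ;; .move 122 151 ;; .move 123 151 ;; .move 124 151 ;;
    .move 125 151 ;; .move 130 151 ;; .move 131 151 ;; .move 132 151 ;; .move 133 151 ;;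
    .move 134 151 ;; .move 135 151

def passCopy : Prog := .move 100 73 ;; .move 101 82 ;; copyProg

def passMerge (comb : Prog) : Prog := mergeInit ;; mergeLoop comb

def passBody (comb : Prog) : Prog :=
  passSizes ;; .branch (.eq 76 79) passCopy (passMerge comb) ;;
    .op .add 73 73 82 ;; .op .add 73 73 83

def passLoop (comb : Prog) : Prog := .loop (.lt 79 74) (passBody comb)

/-- One pass of merge sort on the `reg 71` entries at address `reg 70`, merging chunks of length
`reg 72`. -/
def passProg (comb : Prog) : Prog :=
  .move 73 70 ;; .move 74 71 ;; .move 77 3 ;; passLoop comb ;; .move 70 77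

def sortLoop (comb : Prog) : Prog := .loop (.lt 72 71) (passProg comb ;; .op .add 72 72 72)

/-- Merge sort of the `reg 71` entries at address `reg 70`, starting with chunks of length
`reg 72`; the address of the result is returned in `reg 70`. -/
def sortProg (comb : Prog) : Prog := .const 79 0 ;; .const 81 7 ;; sortLoop comb

section

variable {W : ℕ} {comb : Prog} {f : V → V → V} {c : ℕ}

theorem passCopy_spec (hW : 1 < 2 ^ W) {s : NS} {A : List Entry} (hA : Ents s.mem (s.reg 73) A)
    (h82 : s.reg 82 = 7 * A.length) (hA3 : s.reg 73 + 7 * A.length ≤ s.reg 3)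
    (hb : s.reg 3 + 7 * A.length < 2 ^ W) :
    Tri W passCopy s (42 * A.length + 5) fun s' => (s'.reg 3 = s.reg 3 + 7 * A.length ∧
      (∀ a < s.reg 3, s'.mem a = s.mem a) ∧ Ents s'.mem (s.reg 3) A) ∧
      ∀ r < 100, r ≠ 3 → s'.reg r = s.reg r := by
  refine Tri.frame_lt ?_ (fun r h => ?_)
  swap
  · simp [passCopy, Prog.writes] at h
    rcases h with h | h | h
    · omega
    · omega
    · exact copyProg_writes r h
  refine (Tri.seq (Tri.run' (T := 1) (by simp [Prog.plain]) (by simp [Prog.ok]) (by simp [Prog.cost])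
    (Tri.seq (Tri.run' (T := 1) (by simp [Prog.plain]) (by simp [Prog.ok]) (by simp [Prog.cost])
    ((copyProg_spec _ hW ?_ ?_).mono (T' := 42 * A.length + 3) ?_ ?_))))).mono (by omega) fun _ h => h
  · simp [Prog.run, h82]; exact hA3
  · simp [Prog.run, h82]; exact hb
  · simp [Prog.run, h82]; omega
  · rintro s' ⟨⟨e1, e2, e3⟩, _⟩
    simp [Prog.run, h82] at e1 e2 e3
    exact ⟨e1, e2, hA.copy e3⟩

theorem passMerge_spec (hc : Computes W comb f c) (hW : 1 < 2 ^ W) {s : NS} {A B : List Entry}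
    (hA : Ents s.mem (s.reg 73) (A ++ B)) (h75 : s.reg 75 = A.length) (h76 : s.reg 76 = B.length)
    (h82 : s.reg 82 = 7 * A.length) (h83 : s.reg 83 = 7 * B.length)
    (hA3 : s.reg 73 + 7 * (A.length + B.length) ≤ s.reg 3)
    (hb : s.reg 3 + 7 * (A.length + B.length) < 2 ^ W) :
    Tri W (passMerge comb) s ((A.length + B.length) * (c + 37) + 20) fun s' =>
      (s'.reg 3 = s.reg 3 + 7 * (A.length + B.length) ∧ (∀ a < s.reg 3, s'.mem a = s.mem a) ∧
      Ents s'.mem (s.reg 3) (mergeE f V.zero V.zero A B)) ∧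
      ∀ r < 100, r ≠ 3 → s'.reg r = s.reg r := by
  refine Tri.frame_lt ?_ (fun r h => ?_)
  swap
  · simp only [passMerge, Prog.writes] at h
    rcases h with h | h
    · simp [mergeInit, Prog.writes] at h
      omega
    · exact mergeLoop_writes hc r h
  obtain ⟨hA, hB⟩ := Ents_append.1 hA
  refine (Tri.seq (Tri.run' (T := 19) (by simp [mergeInit, Prog.plain]) ?_
    (by simp [mergeInit, Prog.cost])
    ((mergeLoop_spec hc hW A B _ ?_ ?_ ?_ ?_ ?_ ?_ ?_ ?_ ?_ ?_).mono le_rfl ?_))).mono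
    (by omega) fun _ h => h
  · simp [mergeInit, Prog.ok, Prog.run, h75, h76, h82, h83, hW]; omega
  · simp [mergeInit, Prog.run, h75, h76]
  · simp [mergeInit, Prog.run]
  · simp [mergeInit, Prog.run]
  · simpa [mergeInit, Prog.run] using hA
  · simp [mergeInit, Prog.run, h82]
  · simpa [mergeInit, Prog.run, h82] using hB
  · simp [mergeInit, Prog.run, h83]
  · simp [mergeInit, Prog.run, h82]; omega
  · simp [mergeInit, Prog.run, h82, h83]; omega
  · simpa [mergeInit, Prog.run] using hb
  · rintro s' h
    simpa [mergeInit, Prog.run, vreg, V.zero] using h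

theorem passSizes_spec {s : NS} (h81 : s.reg 81 = 7)
    (hb : 7 * s.reg 74 < 2 ^ W) :
    Tri W passSizes s 8 fun s' => (s'.reg 75 = min (s.reg 72) (s.reg 74) ∧
      s'.reg 76 = min (s.reg 72) (s.reg 74 - s'.reg 75) ∧
      s'.reg 74 = s.reg 74 - s'.reg 75 - s'.reg 76 ∧ s'.reg 82 = 7 * s'.reg 75 ∧
      s'.reg 83 = 7 * s'.reg 76 ∧ s'.mem = s.mem) ∧
      ∀ r, ¬ passSizes.writes r → s'.reg r = s.reg r := by
  refine Tri.frame (Tri.run' (by simp [passSizes, Prog.plain]) ?_ (by simp [passSizes, Prog.cost]) ?_)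
  all_goals
    by_cases h1 : s.reg 72 < s.reg 74
    · by_cases h2 : s.reg 72 < s.reg 74 - s.reg 72
      · simp [passSizes, Prog.ok, Prog.run, Test.ev, h1, h2, h81]
        omega
      · simp [passSizes, Prog.ok, Prog.run, Test.ev, h1, h2, h81]
        omega
    · simp [passSizes, Prog.ok, Prog.run, Test.ev, h1, h81]
      omega

theorem passBody_spec (hc : Computes W comb f c) (hW : 1 < 2 ^ W) {s : NS} {A B C : List Entry}
    (h81 : s.reg 81 = 7) (h79 : s.reg 79 = 0)
    (hE : Ents s.mem (s.reg 73) (A ++ B ++ C))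
    (h74 : s.reg 74 = A.length + B.length + C.length)
    (hA : A.length = min (s.reg 72) (s.reg 74))
    (hB : B.length = min (s.reg 72) (s.reg 74 - A.length))
    (hE3 : s.reg 73 + 7 * s.reg 74 ≤ s.reg 3) (hb : s.reg 3 + 7 * s.reg 74 < 2 ^ W) :
    Tri W (passBody comb) s ((A.length + B.length) * (c + 42) + 31) fun s' =>
      s'.reg 3 = s.reg 3 + 7 * (A.length + B.length) ∧ (∀ a < s.reg 3, s'.mem a = s.mem a) ∧
      Ents s'.mem (s.reg 3) (if B = [] then A else mergeE f V.zero V.zero A B) ∧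
      s'.reg 74 = C.length ∧ s'.reg 73 = s.reg 73 + 7 * (A.length + B.length) ∧
      s'.reg 72 = s.reg 72 ∧ s'.reg 79 = 0 ∧ s'.reg 81 = 7 := by
  refine (Tri.seq ((passSizes_spec h81 (by omega)).mono le_rfl ?_)).mono
    (T := 8 + ((A.length + B.length) * (c + 42) + 21 + 2)) (by omega) fun _ h => h
  rintro s1 ⟨⟨e1, e2, e3, e4, e5, e6⟩, hf⟩
  rw [← hA] at e1
  rw [e1, ← hB] at e2
  rw [e1, e2] at e3
  rw [e1] at e4
  rw [e2] at e5
  have fr : ∀ r, r < 74 ∨ 77 ≤ r ∧ r < 82 ∨ 84 ≤ r → s1.reg r = s.reg r := fun r hr =>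
    hf r (by simp [passSizes, Prog.writes]; omega)
  refine Tri.seq (Tri.mono (T := (A.length + B.length) * (c + 42) + 21) (Q := fun s' =>
      (s'.reg 3 = s1.reg 3 + 7 * (A.length + B.length) ∧ (∀ a < s1.reg 3, s'.mem a = s1.mem a) ∧
        Ents s'.mem (s1.reg 3) (if B = [] then A else mergeE f V.zero V.zero A B)) ∧
        ∀ r < 100, r ≠ 3 → s'.reg r = s1.reg r) ?_ le_rfl ?_)
  · rw [Ents_append] at hE
    refine Tri.branch (fun hx => ?_) (fun hx => ?_)
    · have hB0 : B = [] := by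
        simp [Test.ev, fr, h79, e2] at hx
        exact hx
      subst hB0
      rw [if_pos rfl]
      refine (passCopy_spec hW (A := A) ?_ e4 ?_ ?_).mono ?_ ?_
      · rw [fr _ (by omega), e6]; simpa using hE.1
      · rw [fr _ (by omega), fr _ (by omega)]; omega
      · rw [fr _ (by omega)]; omega
      · have : A.length * 42 ≤ A.length * (c + 42) := Nat.mul_le_mul_left _ (by omega)
        simp; omega
      · rintro s' h; simpa using h
    · have hB0 : B ≠ [] := by
        rintro rfl
        exact hx (by simp [Test.ev, fr, h79, e2])
      rw [if_neg hB0]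
      refine (passMerge_spec hc hW (A := A) (B := B) ?_ e1 e2 e4 e5 ?_ ?_).mono ?_ fun _ h => h
      · rw [fr _ (by omega), e6]; exact hE.1
      · rw [fr _ (by omega), fr _ (by omega)]; omega
      · rw [fr _ (by omega)]; omega
      · have : (A.length + B.length) * (c + 37) ≤ (A.length + B.length) * (c + 42) :=
          Nat.mul_le_mul_left _ (by omega)
        omega
  · rintro s2 ⟨⟨g1, g2, g3⟩, hg⟩
    rw [fr 3 (by omega)] at g1 g2 g3
    have fr2 : ∀ r, r ≠ 3 ∧ r < 74 ∨ 77 ≤ r ∧ r < 82 → s2.reg r = s.reg r := fun r hr => by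
      rw [hg r (by omega) (by omega), fr r (by omega)]
    refine Tri.run' (by simp [Prog.plain]) ?_ (by simp [Prog.cost]) ?_
    · simp [Prog.ok, Prog.run, fr2, hg, e4, e5]; omega
    · refine ⟨by simp [Prog.run, g1], fun a ha => ?_, by simpa [Prog.run] using g3, ?_, ?_, ?_, ?_, ?_⟩
      · simp [Prog.run, g2 a ha, e6]
      · simp [Prog.run, hg, e3]; omega
      · simp [Prog.run, hg, fr, e4, e5]; omega
      all_goals simp [Prog.run, fr2, h79, h81]

/-- Each round merges the next two chunks, or copies the last one if it has no partner. Only the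
last chunk may be short, so the merged chunks again have equal length, now `2 * z`, except possibly
at the end. -/
theorem passLoop_spec (hc : Computes W comb f c) (hW : 1 < 2 ^ W) {k : ℕ} (hk : 0 < k)
    {s : NS} {z : ℕ} {l o : List Entry} (ho : Chunked f k z l o)
    (h72 : s.reg 72 = z) (h81 : s.reg 81 = 7) (h79 : s.reg 79 = 0)
    (hE : Ents s.mem (s.reg 73) o) (h74 : s.reg 74 = o.length)
    (hE3 : s.reg 73 + 7 * o.length ≤ s.reg 3) (hb : s.reg 3 + 7 * o.length < 2 ^ W) :
    Tri W (passLoop comb) s (o.length * (c + 80) + 1) fun s' =>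
      s'.reg 3 = s.reg 3 + 7 * o.length ∧ (∀ a < s.reg 3, s'.mem a = s.mem a) ∧
      ∃ o', Chunked f k (2 * z) l o' ∧ o'.length = o.length ∧ Ents s'.mem (s.reg 3) o' := by
  obtain ⟨n, hn⟩ : ∃ n, o.length = n := ⟨_, rfl⟩
  induction n using Nat.strong_induction_on generalizing s l o with
  | _ n ih =>
  -- one round, with `A`, `B` merged to `D`
  have step : ∀ (l₁ l₂ A B C : List Entry), o = A ++ B ++ C → l = l₁ ++ l₂ →
      Chunked f k z l₂ C → A.length = min z o.length → B.length = min z (o.length - A.length) →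
      Tree f k l₁ (if B = [] then A else mergeE f V.zero V.zero A B) →
      (C = [] ∧ l₂ = [] ∧ l₁.length ≤ 2 * z ∨ l₁.length = 2 * z) → 0 < A.length →
      Tri W (passLoop comb) s (o.length * (c + 80) + 1) fun s' =>
      s'.reg 3 = s.reg 3 + 7 * o.length ∧ (∀ a < s.reg 3, s'.mem a = s.mem a) ∧
      ∃ o', Chunked f k (2 * z) l o' ∧ o'.length = o.length ∧ Ents s'.mem (s.reg 3) o' := by
    intro l₁ l₂ A B C ho' hl' hC hA hB hT hlen hA0
    have hol : o.length = A.length + B.length + C.length := by rw [ho']; simp; omega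
    have hDl : (if B = [] then A else mergeE f V.zero V.zero A B).length =
        A.length + B.length := by
      split_ifs with h
      · simp [h]
      · rw [length_mergeE]
    obtain ⟨D, hD⟩ : ∃ D, D = if B = [] then A else mergeE f V.zero V.zero A B := ⟨_, rfl⟩
    rw [← hD] at hT hDl
    refine (Tri.loop_true (T₂ := C.length * (c + 80) + 1) (by simp [Test.ev, h79, h74]; omega)
      ((passBody_spec hc hW (A := A) (B := B) (C := C) h81 h79 (by rw [← ho']; exact hE)
        (by omega) (by rw [h72, h74]; exact hA) (by rw [h72, h74]; exact hB) (by omega)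
        (by omega)).mono le_rfl ?_)).mono ?_ fun _ h => h
    · rintro s1 ⟨q1, q2, q3, q4, q5, q6, q7, q8⟩
      rw [← hD] at q3
      refine (ih C.length (by omega) (s := s1) hC (by omega) q8 q7 ?_ q4 (by omega) (by omega) rfl).mono
        le_rfl ?_
      · rw [ho', Ents_append] at hE
        rw [q5]
        rw [List.length_append] at hE
        exact hE.2.congr q2 (by omega)
      · rintro s2 ⟨p1, p2, o', p3, p4, p5⟩
        refine ⟨by omega, fun a ha => by rw [p2 a (by omega), q2 a ha], D ++ o', ?_, ?_, ?_⟩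
        · rw [hl']
          rcases hlen with ⟨hC0, hl0, hle⟩ | hlen
          · have : o' = [] := List.length_eq_zero_iff.1 (by rw [p4, hC0]; rfl)
            rw [this, hl0, List.append_nil, List.append_nil]
            exact .last hT hle
          · exact .cons hT hlen p3
        · rw [List.length_append, p4]; omega
        · rw [Ents_append]
          refine ⟨q3.congr p2 (by omega), ?_⟩
          rw [hDl, ← q1]; exact p5
    -- The overhead of a round, 32 steps, is charged to its entries, of which there is at least one;
    -- hence `c + 80` instead of `c + 42` per entry.
    · rw [hol]
      nlinarith
  have hpos : ∀ {l o : List Entry}, Tree f k l o → 0 < o.length := fun h => h.length_pos hk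
  cases ho with
  | nil =>
    refine (Tri.loop_false (by simp [Test.ev, h74]) ⟨by simp, fun _ _ => rfl, [], .nil, rfl, trivial⟩).mono
      (by simp) fun _ h => h
  | last h h' =>
    have := hpos h
    have := h.length_eq
    exact step l [] o [] [] (by simp) (by simp) .nil (by omega) (by simp) (by simpa using h)
      (.inl ⟨rfl, rfl, by omega⟩) (by omega)
  | cons h h' h'' =>
    rename_i l₁ l₂ o₁ o₂
    have := hpos h
    have := h.length_eq
    cases h'' with
    | nil =>
      exact step l₁ [] o₁ [] [] (by simp) (by simp) .nil (by simp; omega) (by simp)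
        (by simpa using h) (.inl ⟨rfl, rfl, by omega⟩) (by omega)
    | last g g' =>
      have := hpos g
      have := g.length_eq
      have hne : o₂ ≠ [] := List.ne_nil_of_length_pos (by omega)
      exact step (l₁ ++ l₂) [] o₁ o₂ [] (by simp) (by simp) .nil (by simp; omega) (by simp; omega)
        (by rw [if_neg hne]; exact .node h g)
        (.inl ⟨rfl, rfl, by rw [List.length_append]; omega⟩) (by omega)
    | cons g g' g'' =>
      rename_i l₃ l₄ o₃ o₄
      have := hpos g
      have := g.length_eq
      have hne : o₃ ≠ [] := List.ne_nil_of_length_pos (by omega)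
      exact step (l₁ ++ l₃) l₄ o₁ o₃ o₄ (by simp) (by simp) g'' (by simp; omega) (by simp; omega)
        (by rw [if_neg hne]; exact .node h g) (.inr (by rw [List.length_append]; omega)) (by omega)

theorem passProg_writes (hc : Computes W comb f c) (r : ℕ) (h : (passProg comb).writes r) :
    r = 3 ∨ 70 ≤ r ∧ r ≠ 71 ∧ r ≠ 72 ∧ r ≠ 79 ∧ r ≠ 81 := by
  have h1 := mergeLoop_writes hc r
  have h2 := copyProg_writes r
  by_cases hw1 : (mergeLoop comb).writes r
  · have := h1 hw1; omega
  by_cases hw2 : copyProg.writes r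
  · have := h2 hw2; omega
  simp [passProg, passLoop, passBody, passSizes, passCopy, passMerge, mergeInit, Prog.writes, hw1,
    hw2] at h
  omega

theorem passProg_spec (hc : Computes W comb f c) (hW : 1 < 2 ^ W) {k : ℕ} (hk : 0 < k)
    {s : NS} {z : ℕ} {l o : List Entry} (ho : Chunked f k z l o)
    (h72 : s.reg 72 = z) (h81 : s.reg 81 = 7) (h79 : s.reg 79 = 0)
    (hE : Ents s.mem (s.reg 70) o) (h71 : s.reg 71 = o.length)
    (hE3 : s.reg 70 + 7 * o.length ≤ s.reg 3) (hb : s.reg 3 + 7 * o.length < 2 ^ W) :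
    Tri W (passProg comb) s (o.length * (c + 80) + 5) fun s' =>
      s'.reg 3 = s.reg 3 + 7 * o.length ∧ (∀ a < s.reg 3, s'.mem a = s.mem a) ∧
      s'.reg 70 = s.reg 3 ∧ s'.reg 71 = s.reg 71 ∧ s'.reg 72 = s.reg 72 ∧ s'.reg 79 = 0 ∧
      s'.reg 81 = 7 ∧
      ∃ o', Chunked f k (2 * z) l o' ∧ o'.length = o.length ∧ Ents s'.mem (s.reg 3) o' := by
  refine Tri.mono (Q := fun s' => (s'.reg 3 = s.reg 3 + 7 * o.length ∧
    (∀ a < s.reg 3, s'.mem a = s.mem a) ∧ s'.reg 70 = s.reg 3 ∧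
      ∃ o', Chunked f k (2 * z) l o' ∧ o'.length = o.length ∧ Ents s'.mem (s.reg 3) o') ∧
      ∀ r, ¬ (passProg comb).writes r → s'.reg r = s.reg r) (Tri.frame ?_) le_rfl ?_
  · refine (Tri.seq (Tri.run' (T := 1) (by simp [Prog.plain]) (by simp [Prog.ok]) (by simp [Prog.cost])
      (Tri.seq (Tri.run' (T := 1) (by simp [Prog.plain]) (by simp [Prog.ok]) (by simp [Prog.cost])
      (Tri.seq (Tri.run' (T := 1) (by simp [Prog.plain]) (by simp [Prog.ok]) (by simp [Prog.cost])
      (Tri.seq ((passLoop_spec hc hW hk (s := _) ho ?_ ?_ ?_ ?_ ?_ ?_ ?_).frame.mono le_rfl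
        (fun s' hs' => Tri.run' (T := 1) (by simp [Prog.plain]) (by simp [Prog.ok])
          (by simp [Prog.cost]) ?_))))))))).mono (by omega) fun _ h => h
    any_goals simp [Prog.run]; first | assumption | omega
    obtain ⟨⟨e1, e2, e3⟩, e4⟩ := hs'
    simp only [Prog.run, NS.set_reg, NS.set_mem] at e1 e2 e3
    have := e4 77 (by
      have h1 := mergeLoop_writes hc 77
      have h2 := copyProg_writes 77
      simp [passLoop, passBody, passSizes, passCopy, passMerge, mergeInit, Prog.writes]
      exact ⟨fun h => by simpa using h2 h, fun h => by simpa using h1 h⟩)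
    simp [Prog.run] at e1 e2 e3 this ⊢
    exact ⟨e1, e2, this, e3⟩
  · rintro s' ⟨⟨e1, e2, e3, e4⟩, e5⟩
    have fr : ∀ r, r = 71 ∨ r = 72 ∨ r = 79 ∨ r = 81 → s'.reg r = s.reg r := fun r hr =>
      e5 r fun hw => by have := passProg_writes hc r hw; omega
    exact ⟨e1, e2, e3, fr _ (by simp), fr _ (by simp), by rw [fr _ (by simp), h79],
      by rw [fr _ (by simp), h81], e4⟩

/-- The parameter `j` bounds the number of remaining passes, since each pass doubles the chunk
length. Every pass writes a full new copy, whence the factor `j` in the memory bound. The chunk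
length itself is doubled only while it is below `o.length`, so `hb'` keeps it in range. -/
theorem sortLoop_spec (hc : Computes W comb f c) (hW : 1 < 2 ^ W) {k : ℕ} (hk : 0 < k) (j : ℕ)
    {s : NS} {z : ℕ} {l o : List Entry} (ho : Chunked f k z l o) (hz : 0 < z)
    (hj : o.length ≤ z * 2 ^ j) (hl : l.length = o.length)
    (h72 : s.reg 72 = z) (h81 : s.reg 81 = 7) (h79 : s.reg 79 = 0)
    (hE : Ents s.mem (s.reg 70) o) (h71 : s.reg 71 = o.length)
    (hE3 : s.reg 70 + 7 * o.length ≤ s.reg 3)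
    (hb : s.reg 3 + j * (7 * o.length) < 2 ^ W) (hb' : 2 * o.length < 2 ^ W) :
    Tri W (sortLoop comb) s (j * (o.length * (c + 80) + 7) + 1) fun s' =>
      s.reg 3 ≤ s'.reg 3 ∧ s'.reg 3 ≤ s.reg 3 + j * (7 * o.length) ∧
      (∀ a < s.reg 3, s'.mem a = s.mem a) ∧
      ∃ o', (Tree f k l o' ∨ l = [] ∧ o' = []) ∧ Ents s'.mem (s'.reg 70) o' ∧
        s'.reg 70 + 7 * o'.length ≤ s'.reg 3 := by
  induction j generalizing s z o with
  | zero =>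
    simp only [pow_zero, mul_one] at hj
    exact (Tri.loop_false (by simp [Test.ev, h71, h72]; omega)
      ⟨le_rfl, by simp, fun _ _ => rfl, o, ho.tree hk (by omega), hE, hE3⟩).mono (by simp) fun _ h => h
  | succ j ih =>
    by_cases hx : z < o.length
    · rw [add_mul] at hb
      refine (Tri.loop_true (T₁ := o.length * (c + 80) + 5 + 1)
        (T₂ := j * (o.length * (c + 80) + 7) + 1) (by simpa [Test.ev, h71, h72] using hx)
        (Tri.seq ((passProg_spec hc hW hk ho h72 h81 h79 hE h71 hE3 (by omega)).mono le_rfl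
        ?_))).mono (by rw [add_mul]; omega) fun _ h => h
      rintro s1 ⟨q1, q2, q3, q4, q5, q6, q7, o', q8, q9, q10⟩
      refine Tri.run' (by simp [Prog.plain]) ?_ (by simp [Prog.cost]) ?_
      · simp [Prog.ok, q5, h72]; omega
      · refine (ih (s := Prog.run _ s1) q8 (by omega) ?_ (by omega) ?_ ?_ ?_ ?_ ?_ ?_ ?_ ?_).mono
          (by rw [q9]) ?_
        · rw [q9]; rw [pow_succ] at hj; linarith
        · simp [Prog.run, q5, h72]; omega
        · simp [Prog.run, q7]
        · simp [Prog.run, q6]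
        · simpa [Prog.run, q3] using q10
        · simp [Prog.run, q4, h71, q9]
        · simp [Prog.run, q1, q3, q9]
        · simp [Prog.run, q1, q9]; omega
        · rw [q9]; exact hb'
        · rintro s2 ⟨p1, p2, p3, p4⟩
          simp [Prog.run] at p1 p2 p3
          refine ⟨by omega, ?_, fun a ha => by rw [p3 a (by omega), q2 a ha], p4⟩
          rw [add_mul]; rw [q9] at p2; omega
    · exact (Tri.loop_false (by simp [Test.ev, h71, h72]; omega)
        ⟨le_rfl, by simp, fun _ _ => rfl, o, ho.tree hk (by omega), hE, hE3⟩).mono (by omega) fun _ h => h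

theorem sortProg_writes (hc : Computes W comb f c) (r : ℕ) (h : (sortProg comb).writes r) :
    r = 3 ∨ 70 ≤ r := by
  by_cases hw : (passProg comb).writes r
  · have := passProg_writes hc r hw; omega
  simp [sortProg, sortLoop, Prog.writes, hw] at h
  omega

theorem sortProg_spec (hc : Computes W comb f c) (hW : 7 < 2 ^ W) {k m : ℕ} (hk : 0 < k) (j : ℕ)
    {s : NS} {l : List Entry} (hm : l.length = m * k) (hj : l.length ≤ k * 2 ^ j)
    (h72 : s.reg 72 = k) (hE : Ents s.mem (s.reg 70) l) (h71 : s.reg 71 = l.length)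
    (hE3 : s.reg 70 + 7 * l.length ≤ s.reg 3)
    (hb : s.reg 3 + j * (7 * l.length) < 2 ^ W) (hb' : 2 * l.length < 2 ^ W) :
    Tri W (sortProg comb) s (j * (l.length * (c + 80) + 7) + 3) fun s' =>
      (s.reg 3 ≤ s'.reg 3 ∧ s'.reg 3 ≤ s.reg 3 + j * (7 * l.length) ∧
      (∀ a < s.reg 3, s'.mem a = s.mem a) ∧
      ∃ o, (Tree f k l o ∨ l = [] ∧ o = []) ∧ Ents s'.mem (s'.reg 70) o ∧
        s'.reg 70 + 7 * o.length ≤ s'.reg 3) ∧ ∀ r < 70, r ≠ 3 → s'.reg r = s.reg r := by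
  refine Tri.frame_lt ?_ (sortProg_writes hc)
  refine (Tri.seq (Tri.run' (T := 1) (by simp [Prog.plain]) ?_ (by simp [Prog.cost])
    (Tri.seq (Tri.run' (T := 1) (by simp [Prog.plain]) ?_ (by simp [Prog.cost])
    ((sortLoop_spec hc (by omega) hk j (Chunked.base hm) hk hj rfl ?_ ?_ ?_ ?_ ?_ ?_ ?_ ?_).mono
      le_rfl ?_))))).mono (by omega) fun _ h => h
  · simp [Prog.ok]
  · simpa [Prog.ok] using hW
  any_goals simp [Prog.run]
  all_goals assumption

end

/-! ## Blocks -/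

/-- Combine the values of two neighbouring segments (modulo `M`). -/
def joinV (M : ℕ) (x y : V) : V where
  f := if x.f = 1 then y.f else 0
  p := if x.f = 1 then (x.p + y.p) % M else x.p
  s := if y.f = 1 then (y.s + x.s) % M else y.s
  sp := if y.f = 1 ∧ 0 < x.s then x.sp else y.sp
  b := if max x.b y.b < (x.s + y.p) % M then (x.s + y.p) % M else max x.b y.b
  bp := if max x.b y.b < (x.s + y.p) % M then x.sp else if x.b < y.b then y.bp else x.bp

def joinProg : Prog :=
  .const 160 0 ;; .const 161 1 ;;
    .branch (.eq 120 161) (.move 140 130 ;; .op .add 141 121 131) (.move 140 160 ;; .move 141 121) ;;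
    .branch (.eq 130 161) (.op .add 142 132 122 ;;
      .branch (.lt 160 122) (.move 143 123) (.move 143 133)) (.move 142 132 ;; .move 143 133) ;;
    .branch (.lt 124 134) (.move 144 134 ;; .move 145 135) (.move 144 124 ;; .move 145 125) ;;
    .op .add 162 122 131 ;;
    .branch (.lt 144 162) (.move 144 162 ;; .move 145 123) .skip

theorem joinProg_computes {W : ℕ} (hW : 1 < 2 ^ W) : Computes W joinProg (joinV (2 ^ W)) 16 where
  spec s := by
    refine (Tri.runMod (by simp [joinProg, Prog.plain]) s).mono (by simp [joinProg, Prog.cost]) ?_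
    rintro s' rfl
    have h1 : 1 % 2 ^ W = 1 := Nat.mod_eq_of_lt hW
    simp only [joinProg, Prog.runMod, Test.ev]
    by_cases a1 : s.reg 120 = 1 <;> by_cases a2 : s.reg 130 = 1 <;> by_cases a3 : 0 < s.reg 122 <;>
      by_cases a4 : s.reg 124 < s.reg 134 <;>
      by_cases a5 : max (s.reg 124) (s.reg 134) < (s.reg 122 + s.reg 131) % 2 ^ W <;>
      first
        | (have a6 : max (s.reg 124) (s.reg 134) = s.reg 134 := by omega
           rw [a6] at a5
           simp [vreg, joinV, h1, a1, a2, a3, a4, a5, a6])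
        | (have a6 : max (s.reg 124) (s.reg 134) = s.reg 124 := by omega
           rw [a6] at a5
           simp [vreg, joinV, h1, a1, a2, a3, a4, a5, a6])
  readOnly := by simp [joinProg, Prog.readOnly]
  writes r h := by
    simp [joinProg, Prog.writes] at h
    omega

/-! ### Pieces of the skyline, blocks and the directory in memory -/

/-- A maximal or non-maximal run of columns of equal height. -/
structure Piece where
  (start len h : ℕ)

def Piece.stopAt (c : Piece) : ℕ := c.start + c.len

/-- Keys are thresholds: a piece is entirely free from its height on, and entirely blocked below it.
-/
def leaf (c : Piece) : Entry := (c.h, ⟨1, c.len, c.len, c.start, c.len, c.start⟩)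

/-- Empty pieces get height `0`. -/
def mkPiece (x l h : ℕ) : Piece := ⟨x, l, if l = 0 then 0 else h⟩

/-- The right end of a list of pieces. -/
def stopL (P : List Piece) : ℕ := (P.getLast?.map Piece.stopAt).getD 0

/-- Append the entry of the piece with start, length and height in registers `60`, `61`, `62`. -/
def emitLeaf : Prog :=
  .const 150 1 ;; .const 63 0 ;; .branch (.eq 61 63) (.const 62 0) .skip ;;
    emitReg 62 ;; emitReg 150 ;; emitReg 61 ;; emitReg 61 ;; emitReg 60 ;; emitReg 61 ;; emitReg 60

/-- Memory only grows, by at most `T` words. -/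
structure Grow (s s' : NS) (T : ℕ) : Prop where
  le : s.reg 3 ≤ s'.reg 3
  le' : s'.reg 3 ≤ s.reg 3 + T
  mem : ∀ a < s.reg 3, s'.mem a = s.mem a

theorem Grow.trans {s s' s'' : NS} {T T' : ℕ} (h : Grow s s' T) (h' : Grow s' s'' T') :
    Grow s s'' (T + T') :=
  ⟨h.le.trans h'.le, by have := h.le'; have := h'.le'; omega,
    fun a ha => by rw [h'.mem a (by have := h.le; omega), h.mem a ha]⟩

theorem Grow.mono {s s' : NS} {T T' : ℕ} (h : Grow s s' T) (hT : T ≤ T') : Grow s s' T' :=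
  ⟨h.le, by have := h.le'; omega, h.mem⟩

theorem emitLeaf_spec {W : ℕ} (hW : 1 < 2 ^ W) {s : NS} (hb : s.reg 3 + 7 < 2 ^ W) :
    Tri W emitLeaf s 18 fun s' => (s'.reg 3 = s.reg 3 + 7 ∧
      (∀ a < s.reg 3, s'.mem a = s.mem a) ∧
      EntryAt s'.mem (s.reg 3) (leaf (mkPiece (s.reg 60) (s.reg 61) (s.reg 62)))) ∧
      ∀ r, ¬ emitLeaf.writes r → s'.reg r = s.reg r := by
  refine Tri.frame (Tri.run' (by simp [emitLeaf, emitReg, Prog.plain]) ?_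
    (by simp [emitLeaf, emitReg, Prog.cost]) ?_)
  · by_cases h : s.reg 61 = 0
    · simp [emitLeaf, emitReg, Prog.ok, Prog.run, Test.ev, h, hW]; omega
    · simp [emitLeaf, emitReg, Prog.ok, Prog.run, Test.ev, h, hW]; omega
  · by_cases h : s.reg 61 = 0
    · refine ⟨by simp [emitLeaf, emitReg, Prog.run, Test.ev, h], fun a ha => ?_, ?_⟩
      · simp [emitLeaf, emitReg, Prog.run, Test.ev, h]
        repeat rw [if_neg (by omega)]
      · simp [emitLeaf, emitReg, Prog.run, Test.ev, h, EntryAt, leaf, mkPiece, add_assoc]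
    · refine ⟨by simp [emitLeaf, emitReg, Prog.run, Test.ev, h], fun a ha => ?_, ?_⟩
      · simp [emitLeaf, emitReg, Prog.run, Test.ev, h]
        repeat rw [if_neg (by omega)]
      · simp [emitLeaf, emitReg, Prog.run, Test.ev, h, EntryAt, leaf, mkPiece, add_assoc]

/-- A directory entry at address `a` that describes the block `P`; all its data lie below `n`. -/
structure BlockAt (M : ℕ) (mem : ℕ → ℕ) (n a : ℕ) (P : List Piece) : Prop where
  stopAt : mem a = stopL P
  size : mem (a + 1) = P.length
  pieces : Ents mem (mem (a + 2)) (P.map leaf)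
  pieces_le : mem (a + 2) + 7 * P.length ≤ n
  summary : ∃ o, Tree (joinV M) 1 (P.map leaf) o ∧ Ents mem (mem (a + 3)) o
  summary_le : mem (a + 3) + 7 * P.length ≤ n

def DirAt (M : ℕ) (mem : ℕ → ℕ) (n : ℕ) : ℕ → List (List Piece) → Prop
  | _, [] => True
  | a, P :: Bs => BlockAt M mem n a P ∧ DirAt M mem n (a + 4) Bs

theorem BlockAt.copy {M : ℕ} {mem mem' : ℕ → ℕ} {n n' a a' : ℕ} {P : List Piece}
    (h : BlockAt M mem n a P) (ha : ∀ t < 4, mem' (a' + t) = mem (a + t))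
    (hm : ∀ x < n, mem' x = mem x) (hn : n ≤ n') : BlockAt M mem' n' a' P := by
  have e0 := ha 0 (by norm_num)
  simp only [add_zero] at e0
  have e1 := ha 1 (by norm_num)
  have e2 := ha 2 (by norm_num)
  have e3 := ha 3 (by norm_num)
  obtain ⟨o, ho, ho'⟩ := h.summary
  have hl : o.length = P.length := by rw [ho.length_eq, List.length_map]
  exact ⟨e0.trans h.stopAt, e1.trans h.size, by
    rw [e2]; exact h.pieces.congr hm (by simpa using h.pieces_le), by
    rw [e2]; exact h.pieces_le.trans hn, ⟨o, ho, by
      rw [e3]; exact ho'.congr hm (by rw [hl]; exact h.summary_le)⟩, by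
    rw [e3]; exact h.summary_le.trans hn⟩

theorem DirAt.copy {M : ℕ} {mem mem' : ℕ → ℕ} {n n' a a' : ℕ} {Bs : List (List Piece)}
    (h : DirAt M mem n a Bs) (ha : ∀ t < 4 * Bs.length, mem' (a' + t) = mem (a + t))
    (hm : ∀ x < n, mem' x = mem x) (hn : n ≤ n') : DirAt M mem' n' a' Bs := by
  induction Bs generalizing a a' with
  | nil => trivial
  | cons P Bs ih =>
    simp only [List.length_cons] at ha
    refine ⟨h.1.copy (fun t ht => ha t (by omega)) hm hn, ih h.2 fun t ht => ?_⟩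
    have := ha (4 + t) (by omega)
    simpa only [add_assoc] using this

theorem DirAt_append {M : ℕ} {mem : ℕ → ℕ} {n a : ℕ} {X Y : List (List Piece)} :
    DirAt M mem n a (X ++ Y) ↔ DirAt M mem n a X ∧ DirAt M mem n (a + 4 * X.length) Y := by
  induction X generalizing a with
  | nil => simp [DirAt]
  | cons P X ih =>
    simp only [List.cons_append, DirAt, ih, List.length_cons, and_assoc]
    rw [show a + 4 + 4 * X.length = a + 4 * (X.length + 1) by ring]

/-- The current directory describes the list `Bs` of blocks. -/
structure Dir (W : ℕ) (s : NS) (Bs : List (List Piece)) : Prop where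
  dir : DirAt (2 ^ W) s.mem (s.reg 3) (s.reg 4) Bs
  count : s.reg 5 = Bs.length
  le : s.reg 4 + 4 * Bs.length ≤ s.reg 3

/-- Nothing is modified in place, so a program that writes only fresh cells and keeps registers 4
and 5 cannot damage the directory. -/
theorem Dir.grow {W : ℕ} {s s' : NS} {T : ℕ} {Bs : List (List Piece)} (h : Dir W s Bs)
    (hg : Grow s s' T) (h4 : s'.reg 4 = s.reg 4) (h5 : s'.reg 5 = s.reg 5) : Dir W s' Bs :=
  ⟨h4 ▸ h.dir.copy (fun t ht => hg.mem _ (by have := h.le; omega)) hg.mem hg.le, h5 ▸ h.count,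
    h4 ▸ h.le.trans hg.le⟩

/-! ### Replacing blocks -/

/-- The sort starts from single pieces in the order of their positions and merges neighbours only.
The pieces below each node of the tree thus form a contiguous segment, as the noncommutative `joinV`
requires, although the output is sorted by height. -/
def blockSort : Prog := .move 70 42 ;; .move 71 43 ;; .const 72 1 ;; sortProg joinProg

/-- The last two words of the last piece are its length and its start; their sum is the right end of
the block. Register 49 keeps the address at which the new directory begins, and the copy that comes
next transfers the entries in front of the new block. -/
def blockStop : Prog :=
  .const 45 7 ;; .op .mul 46 43 45 ;; .op .add 46 46 42 ;; .const 45 1 ;; .op .sub 46 46 45 ;;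
    .load 47 46 ;; .op .sub 46 46 45 ;; .load 48 46 ;; .op .add 44 47 48 ;;
    .move 49 3 ;; .const 50 4 ;; .op .mul 51 50 40 ;; .move 100 4 ;; .move 101 51

def blockEmit : Prog :=
  .const 150 1 ;; emitReg 44 ;; emitReg 43 ;; emitReg 42 ;; emitReg 70 ;;
    .op .mul 51 50 41 ;; .op .add 100 4 51 ;; .op .sub 51 5 41 ;; .op .mul 101 50 51

def blockFinish : Prog := .move 4 49 ;; .op .add 5 40 51 ;; .op .add 5 5 45

/-- Build a block from the `reg 43` pieces at address `reg 42`; it replaces the blocks with indices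
`i`, `reg 40 ≤ i < reg 41`, in a new directory. -/
def setBlock : Prog :=
  blockSort ;; blockStop ;; copyProg ;; blockEmit ;; copyProg ;; blockFinish

theorem stopL_append (P Q : List Piece) (hQ : Q ≠ []) : stopL (P ++ Q) = stopL Q := by
  simp [stopL, List.getLast?_append_of_ne_nil _ hQ]

theorem stopL_concat (P : List Piece) (c : Piece) : stopL (P ++ [c]) = c.stopAt := by
  simp [stopL]

theorem Ents_stopL {mem : ℕ → ℕ} {a : ℕ} {P : List Piece} (h : Ents mem a (P.map leaf))
    (hP : P ≠ []) : mem (a + 7 * P.length - 1) + mem (a + 7 * P.length - 1 - 1) = stopL P ∧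
      mem (a + 7 * P.length - 1) ≤ stopL P := by
  obtain ⟨P, c, rfl⟩ := (List.eq_nil_or_concat P).resolve_left hP
  rw [List.concat_eq_append] at h ⊢
  rw [List.map_append, Ents_append] at h
  obtain ⟨-, -, -, -, -, h5, h6⟩ := h.2.1
  simp only [List.length_map, leaf] at h5 h6
  rw [stopL_concat, List.length_append, List.length_singleton,
    show a + 7 * (P.length + 1) - 1 = a + 7 * P.length + 6 by omega, h6,
    show a + 7 * P.length + 6 - 1 = a + 7 * P.length + 5 by omega, h5, Piece.stopAt]
  omega

theorem blockSort_spec {W : ℕ} (hW : 7 < 2 ^ W) (j : ℕ) {s : NS} {P : List Piece}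
    (hj : P.length ≤ 2 ^ j) (hP : P ≠ []) (hE : Ents s.mem (s.reg 42) (P.map leaf))
    (h43 : s.reg 43 = P.length) (hE3 : s.reg 42 + 7 * P.length ≤ s.reg 3)
    (hb : s.reg 3 + j * (P.length * 96 + 7) < 2 ^ W) :
    Tri W blockSort s (j * (P.length * 96 + 7) + 6) fun s' =>
      (Grow s s' (j * (P.length * 96 + 7)) ∧
      ∃ o, Tree (joinV (2 ^ W)) 1 (P.map leaf) o ∧ Ents s'.mem (s'.reg 70) o ∧
        s'.reg 70 + 7 * P.length ≤ s'.reg 3) ∧ ∀ r < 70, r ≠ 3 → s'.reg r = s.reg r := by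
  have hjj : j * (7 * P.length) ≤ j * (P.length * 96 + 7) := Nat.mul_le_mul_left _ (by omega)
  have hW1 : 1 < 2 ^ W := by omega
  refine Tri.frame_lt ?_ (fun r h => ?_)
  swap
  · simp only [blockSort, Prog.writes] at h
    rcases h with h | h | h | h
    any_goals omega
    exact sortProg_writes (joinProg_computes hW1) r h
  refine (Tri.seq (Tri.run' (T := 1) (by simp [Prog.plain]) (by simp [Prog.ok]) (by simp [Prog.cost])
    (Tri.seq (Tri.run' (T := 1) (by simp [Prog.plain]) (by simp [Prog.ok]) (by simp [Prog.cost])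
    (Tri.seq (Tri.run' (T := 1) (by simp [Prog.plain]) (by simpa [Prog.ok] using hW1)
      (by simp [Prog.cost])
    ((sortProg_spec (joinProg_computes hW1) hW one_pos (m := P.length) (l := P.map leaf) j
      (by simp) (by simpa using hj) ?_ ?_ ?_ ?_ ?_ ?_).mono le_rfl ?_))))))).mono ?_ fun _ h => h
  · simp [Prog.run]
  · simpa [Prog.run] using hE
  · simpa [Prog.run] using h43
  · simpa [Prog.run] using hE3
  · simp [Prog.run]; omega
  · simp; omega
  · rintro s' ⟨⟨e1, e2, e3, o, e4, e5, e6⟩, -⟩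
    simp [Prog.run] at e1 e2 e3
    have e4 := e4.resolve_right (by simp [hP])
    have hl : o.length = P.length := by rw [e4.length_eq, List.length_map]
    exact ⟨⟨e1, by omega, e3⟩, o, e4, e5, hl ▸ e6⟩
  · simp; omega

/-- An empty `Y` turns the replacement into an insertion. The constant 96 is the `c + 80` of a merge
pass with `c = 16` for `joinProg`; copying a directory entry takes 6 steps for each of its 4 words.
One expression bounds both time and memory. -/
theorem setBlock_spec {W : ℕ} (hW : 7 < 2 ^ W) (j : ℕ) {s : NS} {X Y Z : List (List Piece)}
    {P : List Piece} (hD : Dir W s (X ++ Y ++ Z)) (hj : P.length ≤ 2 ^ j) (hP : P ≠ [])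
    (h40 : s.reg 40 = X.length) (h41 : s.reg 41 = X.length + Y.length)
    (hE : Ents s.mem (s.reg 42) (P.map leaf))
    (h43 : s.reg 43 = P.length) (hE3 : s.reg 42 + 7 * P.length ≤ s.reg 3) (hend : stopL P < 2 ^ W)
    (hb : s.reg 3 + (j * (P.length * 96 + 7) + 24 * (X ++ Y ++ Z).length + 60) < 2 ^ W) :
    Tri W setBlock s (j * (P.length * 96 + 7) + 24 * (X ++ Y ++ Z).length + 60) fun s' =>
      Grow s s' (j * (P.length * 96 + 7) + 24 * (X ++ Y ++ Z).length + 60) ∧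
      Dir W s' (X ++ P :: Z) ∧ ∀ r < 40, r ≠ 3 → r ≠ 4 → r ≠ 5 → s'.reg r = s.reg r := by
  have hW0 : W ≠ 0 := by rintro rfl; simp at hW
  have hlen : (X ++ Y ++ Z).length = X.length + Y.length + Z.length := by simp; omega
  have hPl := List.length_pos_of_ne_nil hP
  have hle := hD.le
  have hcount := hD.count
  generalize hA : j * (P.length * 96 + 7) = A at *
  rw [hlen] at *
  refine (Tri.seq (hA ▸ (blockSort_spec hW j hj hP hE h43 hE3 (by rw [hA]; omega)).mono le_rfl ?_)).mono
    (T := A + 6 + (14 + (24 * X.length + 3 + (13 + (24 * Z.length + 3 + 3))))) (by omega)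
    fun _ h => h
  rintro s1 ⟨⟨hg1, o, ho1, ho2, ho3⟩, f1⟩
  have hD1 := hD.grow hg1 (f1 _ (by omega) (by omega)) (f1 _ (by omega) (by omega))
  have hE1 : Ents s1.mem (s1.reg 42) (P.map leaf) := by
    rw [f1 _ (by omega) (by omega)]; exact hE.congr hg1.mem (by simpa using hE3)
  have hg1' := hg1.le'
  have hg1'' := hg1.le
  rw [hA] at hg1'
  obtain ⟨hend1, hend2⟩ := Ents_stopL hE1 hP
  rw [f1 _ (by omega) (by omega)] at hE1 hend1 hend2
  refine Tri.seq (Tri.run' (by simp [blockStop, Prog.plain]) ?_ (by simp [blockStop, Prog.cost]) ?_)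
  · simp [blockStop, Prog.ok, Prog.run, f1, h43, h40]
    rw [show P.length * 7 + s.reg 42 = s.reg 42 + 7 * P.length by ring]
    omega
  obtain ⟨s2, hs2⟩ : ∃ s2, s2 = blockStop.run s1 := ⟨_, rfl⟩
  have m2 : s2.mem = s1.mem := by rw [hs2]; simp [blockStop, Prog.run]
  have r44 : s2.reg 44 = stopL P := by
    rw [hs2]; simp [blockStop, Prog.run, f1, h43]
    rw [show P.length * 7 + s.reg 42 = s.reg 42 + 7 * P.length by ring]
    exact hend1
  have r45 : s2.reg 45 = 1 := by rw [hs2]; simp [blockStop, Prog.run]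
  have r49 : s2.reg 49 = s1.reg 3 := by rw [hs2]; simp [blockStop, Prog.run]
  have r50 : s2.reg 50 = 4 := by rw [hs2]; simp [blockStop, Prog.run]
  have r100 : s2.reg 100 = s.reg 4 := by rw [hs2]; simp [blockStop, Prog.run, f1]
  have r101 : s2.reg 101 = 4 * X.length := by rw [hs2]; simp [blockStop, Prog.run, f1, h40]
  have fr2 : ∀ r, r < 44 ∨ 52 ≤ r ∧ r < 100 → s2.reg r = s1.reg r := by
    intro r hr
    rw [hs2]
    simp [blockStop, Prog.run, show r ≠ 44 by omega, show r ≠ 45 by omega, show r ≠ 46 by omega,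
      show r ≠ 47 by omega, show r ≠ 48 by omega, show r ≠ 49 by omega, show r ≠ 50 by omega,
      show r ≠ 51 by omega, show r ≠ 100 by omega, show r ≠ 101 by omega]
  rw [← hs2]
  clear hs2
  refine Tri.seq ((copyProg_spec s2 (by omega) ?_ ?_).mono ?_ ?_)
  · rw [r100, r101, fr2 _ (by omega)]; omega
  · rw [r101, fr2 _ (by omega)]; omega
  · rw [r101]; omega
  rintro s3 ⟨⟨e1, e2, e3⟩, f3⟩
  rw [fr2 3 (by omega), r101] at e1
  rw [fr2 3 (by omega), m2] at e2
  rw [fr2 3 (by omega), m2, r100, r101] at e3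
  refine Tri.seq (Tri.run' (by simp [blockEmit, emitReg, Prog.plain]) ?_
    (by simp [blockEmit, emitReg, Prog.cost]) ?_)
  · simp [blockEmit, emitReg, Prog.ok, Prog.run, f3, fr2, f1, r50, h41, hcount]
    omega
  obtain ⟨s4, hs4⟩ : ∃ s4, s4 = blockEmit.run s3 := ⟨_, rfl⟩
  have m4 : ∀ a < s3.reg 3, s4.mem a = s3.mem a := by
    intro a ha
    rw [hs4]; simp [blockEmit, emitReg, Prog.run]
    repeat rw [if_neg (by omega)]
  have q0 : s4.mem (s3.reg 3) = stopL P := by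
    rw [hs4]; simp [blockEmit, emitReg, Prog.run, add_assoc, f3, r44]
  have q1 : s4.mem (s3.reg 3 + 1) = P.length := by
    rw [hs4]; simp [blockEmit, emitReg, Prog.run, add_assoc, f3, fr2, f1, h43]
  have q2 : s4.mem (s3.reg 3 + 2) = s.reg 42 := by
    rw [hs4]; simp [blockEmit, emitReg, Prog.run, add_assoc, f3, fr2, f1]
  have q3 : s4.mem (s3.reg 3 + 3) = s1.reg 70 := by
    rw [hs4]; simp [blockEmit, emitReg, Prog.run, add_assoc, f3, fr2]
  have u3 : s4.reg 3 = s3.reg 3 + 4 := by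
    rw [hs4]; simp [blockEmit, emitReg, Prog.run, add_assoc]
  have u100 : s4.reg 100 = s.reg 4 + 4 * (X.length + Y.length) := by
    rw [hs4]; simp [blockEmit, emitReg, Prog.run, add_assoc, f3, fr2, f1, h41, r50]
  have u51 : s4.reg 51 = Z.length := by
    rw [hs4]; simp [blockEmit, emitReg, Prog.run, f3, fr2, f1, h41, hcount]
  have u101 : s4.reg 101 = 4 * Z.length := by
    rw [hs4]; simp [blockEmit, emitReg, Prog.run, f3, fr2, f1, h41, hcount, r50]
  have fr4 : ∀ r, r ≠ 3 ∧ r < 51 → s4.reg r = s3.reg r := by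
    intro r hr
    rw [hs4]
    simp [blockEmit, emitReg, Prog.run, show r ≠ 3 by omega, show r ≠ 150 by omega,
      show r ≠ 51 by omega, show r ≠ 100 by omega, show r ≠ 101 by omega]
  rw [← hs4]
  clear hs4
  refine Tri.seq ((copyProg_spec s4 (by omega) ?_ ?_).mono ?_ ?_)
  · rw [u100, u101, u3]; omega
  · rw [u101, u3]; omega
  · rw [u101]; omega
  rintro s5 ⟨⟨g1, g2, g3⟩, f5⟩
  rw [u3, u101] at g1
  rw [u3] at g2
  rw [u3, u100, u101] at g3
  have m51 : ∀ a < s1.reg 3, s5.mem a = s1.mem a := fun a ha => by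
    rw [g2 a (by omega), m4 a (by omega), e2 a ha]
  have fr5 : ∀ r, r < 40 ∧ r ≠ 3 ∨ r = 40 → s5.reg r = s.reg r := fun r hr => by
    rw [f5 r (by omega) (by omega), fr4 r (by omega), f3 r (by omega) (by omega),
      fr2 r (by omega), f1 r (by omega) (by omega)]
  have v45 : s5.reg 45 = 1 := by
    rw [f5 _ (by omega) (by omega), fr4 _ (by omega), f3 _ (by omega) (by omega), r45]
  have v49 : s5.reg 49 = s1.reg 3 := by
    rw [f5 _ (by omega) (by omega), fr4 _ (by omega), f3 _ (by omega) (by omega), r49]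
  have v51 : s5.reg 51 = Z.length := by rw [f5 _ (by omega) (by omega), u51]
  refine Tri.run' (by simp [blockFinish, Prog.plain]) ?_ (by simp [blockFinish, Prog.cost]) ?_
  · simp [blockFinish, Prog.ok, Prog.run, fr5, v51, v45, h40]; omega
  have w : ∀ r, r ≠ 4 → r ≠ 5 → (blockFinish.run s5).reg r = s5.reg r := by
    intro r h4 h5
    simp [blockFinish, Prog.run, h4, h5]
  have w3 := w 3 (by omega) (by omega)
  have wm : (blockFinish.run s5).mem = s5.mem := rfl
  have w4 : (blockFinish.run s5).reg 4 = s1.reg 3 := by simp [blockFinish, Prog.run, v49]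
  have w5 : (blockFinish.run s5).reg 5 = X.length + Z.length + 1 := by
    simp [blockFinish, Prog.run, v51, v45, fr5, h40]
  refine ⟨⟨?_, ?_, fun a ha => ?_⟩, ⟨?_, ?_, ?_⟩, fun r h h3 h4 h5 => ?_⟩
  · rw [w3]; omega
  · rw [w3]; omega
  · rw [wm, m51 a (by omega), hg1.mem a ha]
  · rw [wm, w3, w4]
    have hD1' := hD1.dir
    rw [f1 4 (by omega) (by omega), DirAt_append, DirAt_append] at hD1'
    obtain ⟨⟨dX, -⟩, dZ⟩ := hD1'
    rw [DirAt_append]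
    refine ⟨dX.copy (fun t ht => ?_) m51 (by omega), ⟨?_, ?_, ?_, ?_, ⟨o, ho1, ?_⟩, ?_⟩,
      dZ.copy (fun t ht => ?_) m51 (by omega)⟩
    · rw [g2 _ (by omega), m4 _ (by omega), e3 t (by omega)]
    · rw [← e1, g2 _ (by omega), q0]
    · rw [← e1, g2 _ (by omega), q1]
    · rw [← e1, g2 _ (by omega), q2]; exact hE1.congr m51 (by simp; omega)
    · rw [← e1, g2 _ (by omega), q2]; omega
    · rw [← e1, g2 _ (by omega), q3]
      exact ho2.congr m51 (by rw [ho1.length_eq, List.length_map]; omega)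
    · rw [← e1, g2 _ (by omega), q3]; omega
    · rw [← e1, g3 t (by omega)]
      have hlt : s.reg 4 + 4 * (X.length + Y.length) + t < s1.reg 3 := by omega
      rw [m4 _ (by omega), e2 _ hlt]
      congr 2; simp
  · rw [w5]; simp; omega
  · rw [w4, w3]; simp; omega
  · rw [w r h4 h5, fr5 r (by omega)]

/-! ## Step functions -/

/-- Value at `k` of the step function with initial value `c`. -/
def ev : V → List Entry → ℕ → V
  | c, [], _ => c
  | c, e :: E, k => if e.1 ≤ k then ev e.2 E k else c

/-- No sortedness is needed: `ev` stops at the first key above `k`, and the merge emits the smaller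
of the two heads. So when the merged list stops, both lists stop, and until then each entry updates
the value in force on its own side. -/
theorem ev_mergeE (f : V → V → V) (c₁ c₂ : V) (A B : List Entry) (k : ℕ) :
    ev (f c₁ c₂) (mergeE f c₁ c₂ A B) k = f (ev c₁ A k) (ev c₂ B k) := by
  fun_induction mergeE f c₁ c₂ A B with
  | case1 => rfl
  | case2 c₁ c₂ a A ih => simp only [ev, ih]; split_ifs <;> rfl
  | case3 c₁ c₂ b B ih => simp only [ev, ih]; split_ifs <;> rfl
  | case4 c₁ c₂ a A b B h ih =>
    simp only [ev, ih]
    by_cases hb : b.1 ≤ k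
    · simp [hb]
    · rw [if_neg hb, if_neg hb, if_neg (by omega)]
  | case5 c₁ c₂ a A b B h ih =>
    simp only [ev, ih]
    by_cases ha : a.1 ≤ k
    · simp [ha]
    · rw [if_neg ha, if_neg ha, if_neg (by omega)]

theorem map_fst_mergeE_perm (f : V → V → V) (c₁ c₂ : V) (A B : List Entry) :
    ((mergeE f c₁ c₂ A B).map Prod.fst).Perm ((A ++ B).map Prod.fst) := by
  fun_induction mergeE f c₁ c₂ A B with
  | case1 => simp
  | case2 c₁ c₂ a A ih => simpa using ih
  | case3 c₁ c₂ b B ih => simpa using ih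
  | case4 c₁ c₂ a A b B h ih =>
    refine (List.Perm.cons _ ih).trans ?_
    rw [List.map_append, List.map_append]
    exact (List.perm_middle (a := b.1)).symm
  | case5 c₁ c₂ a A b B h ih => exact List.Perm.cons _ ih

def SortedE (E : List Entry) : Prop := E.Pairwise fun x y => x.1 ≤ y.1

theorem SortedE.mergeE {f : V → V → V} {c₁ c₂ : V} {A B : List Entry} (hA : SortedE A)
    (hB : SortedE B) : SortedE (mergeE f c₁ c₂ A B) := by
  have mem : ∀ (c₁ c₂ : V) (A B : List Entry), ∀ e ∈ RectDrop.mergeE f c₁ c₂ A B,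
      e.1 ∈ (A ++ B).map Prod.fst := fun c₁ c₂ A B e he =>
    (map_fst_mergeE_perm f c₁ c₂ A B).subset (List.mem_map_of_mem he)
  unfold SortedE at *
  fun_induction RectDrop.mergeE f c₁ c₂ A B with
  | case1 => simp
  | case2 c₁ c₂ a A ih =>
    rw [List.pairwise_cons] at hA ⊢
    refine ⟨fun e he => ?_, ih hA.2 hB⟩
    obtain ⟨x, hx, hx'⟩ := List.mem_map.1 (mem _ _ _ _ e he)
    rw [List.append_nil] at hx
    exact hx' ▸ hA.1 x hx
  | case3 c₁ c₂ b B ih =>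
    rw [List.pairwise_cons] at hB ⊢
    refine ⟨fun e he => ?_, ih hA hB.2⟩
    obtain ⟨x, hx, hx'⟩ := List.mem_map.1 (mem _ _ _ _ e he)
    exact hx' ▸ hB.1 x hx
  | case4 c₁ c₂ a A b B h ih =>
    have hB' := hB
    rw [List.pairwise_cons] at hB' ⊢
    refine ⟨fun e he => ?_, ih hA hB'.2⟩
    obtain ⟨x, hx, hx'⟩ := List.mem_map.1 (mem _ _ _ _ e he)
    rw [List.pairwise_cons] at hA
    rw [List.cons_append, List.mem_cons, List.mem_append] at hx
    show b.1 ≤ e.1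
    rcases hx with rfl | hx | hx
    · omega
    · have := hA.1 x hx; omega
    · have := hB'.1 x hx; omega
  | case5 c₁ c₂ a A b B h ih =>
    have hA' := hA
    rw [List.pairwise_cons] at hA' ⊢
    refine ⟨fun e he => ?_, ih hA'.2 hB⟩
    obtain ⟨x, hx, hx'⟩ := List.mem_map.1 (mem _ _ _ _ e he)
    rw [List.pairwise_cons] at hB
    rw [List.mem_append, List.mem_cons] at hx
    show a.1 ≤ e.1
    rcases hx with hx | rfl | hx
    · have := hA'.1 x hx; omega
    · omega
    · have := hB.1 x hx; omega

theorem Tree.perm {f : V → V → V} {k : ℕ} {l o : List Entry} (h : Tree f k l o) :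
    (o.map Prod.fst).Perm (l.map Prod.fst) := by
  induction h with
  | base => exact .refl _
  | node _ _ ih₁ ih₂ =>
    refine (map_fst_mergeE_perm _ _ _ _ _).trans ?_
    rw [List.map_append, List.map_append]
    exact ih₁.append ih₂

theorem Tree.sorted {f : V → V → V} {l o : List Entry} (h : Tree f 1 l o) : SortedE o := by
  induction h with
  | base h =>
    obtain ⟨a, rfl⟩ := List.length_eq_one_iff.1 h
    exact List.pairwise_singleton _ _
  | node _ _ ih₁ ih₂ => exact ih₁.mergeE ih₂

/-- `ev` in terms of the number of keys that are at most `k`. -/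
theorem ev_eq {E : List Entry} {k i : ℕ} (hi : i ≤ E.length)
    (h1 : ∀ (t : ℕ) (ht : t < E.length), t < i → (E[t]).1 ≤ k)
    (h2 : ∀ (t : ℕ) (ht : t < E.length), i ≤ t → k < (E[t]).1) (c : V) :
    ev c E k = if h : i = 0 then c else (E[i - 1]).2 := by
  induction E generalizing i c with
  | nil =>
    have : i = 0 := by simpa using hi
    simp [ev, this]
  | cons e E ih =>
    rcases i with _ | i
    · have := h2 0 (by simp) le_rfl
      rw [List.getElem_cons_zero] at this
      simp [ev, Nat.not_le.2 this]
    · have h0 := h1 0 (by simp) (by omega)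
      rw [List.getElem_cons_zero] at h0
      simp only [List.length_cons, Nat.add_le_add_iff_right] at hi
      have := ih (i := i) hi (fun t ht hti => by
        have := h1 (t + 1) (by simpa using ht) (by omega)
        rwa [List.getElem_cons_succ] at this) (fun t ht hti => by
        have := h2 (t + 1) (by simpa using ht) (by omega)
        rwa [List.getElem_cons_succ] at this) e.2
      simp only [ev, h0, if_true, this]
      rcases i with _ | i
      · simp
      · simp

/-! ## Values of segments -/

/-- `v` describes the free columns, those of height at most `h`, in the segment `[p, q)`. -/
structure Good (H : ℕ → ℕ) (h p q : ℕ) (v : V) : Prop where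
  le : p ≤ q
  full : v.f = 1 → v.p = q - p ∧ v.s = q - p
  not_full : v.f ≠ 1 → v.f = 0 ∧ p + v.p < q ∧ h < H (p + v.p) ∧ p + v.s < q ∧ h < H (q - 1 - v.s)
  pre : ∀ j, p ≤ j → j < p + v.p → H j ≤ h
  suf : ∀ j, q ≤ j + v.s → j < q → H j ≤ h
  start : 0 < v.s → v.sp + v.s = q
  run : 0 < v.b → p ≤ v.bp ∧ v.bp + v.b ≤ q ∧ ∀ j, v.bp ≤ j → j < v.bp + v.b → H j ≤ h
  max : ∀ x a, p ≤ x → x + a ≤ q → (∀ j, x ≤ j → j < x + a → H j ≤ h) → a ≤ v.b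

theorem Good.p_le {H : ℕ → ℕ} {h p q : ℕ} {v : V} (g : Good H h p q v) : p + v.p ≤ q := by
  have := g.le
  by_cases hf : v.f = 1
  · have := g.full hf; omega
  · have := g.not_full hf; omega

theorem Good.s_le {H : ℕ → ℕ} {h p q : ℕ} {v : V} (g : Good H h p q v) : p + v.s ≤ q := by
  have := g.le
  by_cases hf : v.f = 1
  · have := g.full hf; omega
  · have := g.not_full hf; omega

/-- A free run in `[p, r)` lies on one side of `q` or crosses it. In the second case its two parts
are no longer than the free suffix of `x` and the free prefix of `y`, because a longer part would
contain the blocking column that `not_full` puts next to them. A prefix extends beyond `q` only if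
the left segment is full, and symmetrically for a suffix. All sums are lengths of at most `r < M`,
so the reductions modulo `M` have no effect. -/
theorem Good.join {M : ℕ} {H : ℕ → ℕ} {h p q r : ℕ} {x y : V} (hx : Good H h p q x)
    (hy : Good H h q r y) (hr : r < M) : Good H h p r (joinV M x y) := by
  have hx1 := hx.p_le
  have hx2 := hx.s_le
  have hy1 := hy.p_le
  have hy2 := hy.s_le
  have hpq := hx.le
  have hqr := hy.le
  have m1 : (x.s + y.p) % M = x.s + y.p := Nat.mod_eq_of_lt (by omega)
  have m2 : (x.p + y.p) % M = x.p + y.p := Nat.mod_eq_of_lt (by omega)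
  have m3 : (y.s + x.s) % M = y.s + x.s := Nat.mod_eq_of_lt (by omega)
  have b1 : x.b ≤ (joinV M x y).b := by simp only [joinV, m1]; split_ifs <;> omega
  have b2 : y.b ≤ (joinV M x y).b := by simp only [joinV, m1]; split_ifs <;> omega
  have b3 : x.s + y.p ≤ (joinV M x y).b := by simp only [joinV, m1]; split_ifs <;> omega
  refine ⟨by omega, fun hf => ?_, fun hf => ?_, fun j h1 h2 => ?_, fun j h1 h2 => ?_, fun h0 => ?_,
    fun h0 => ?_, fun z a h1 h2 h3 => ?_⟩
  · simp only [joinV, m2, m3] at hf ⊢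
    by_cases fx : x.f = 1
    · rw [if_pos fx] at hf
      have := hx.full fx
      have := hy.full hf
      rw [if_pos fx, if_pos hf]; omega
    · rw [if_neg fx] at hf; omega
  · simp only [joinV, m2, m3] at hf ⊢
    by_cases fx : x.f = 1
    · rw [if_pos fx] at hf ⊢
      have ex := hx.full fx
      obtain ⟨e1, e2, e3, e4, e5⟩ := hy.not_full hf
      rw [if_pos fx, if_neg hf]
      exact ⟨e1, by omega, by rwa [show p + (x.p + y.p) = q + y.p by omega], by omega, e5⟩
    · obtain ⟨e1, e2, e3, e4, e5⟩ := hx.not_full fx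
      rw [if_neg fx, if_neg fx]
      by_cases fy : y.f = 1
      · have ey := hy.full fy
        rw [if_pos fy]
        exact ⟨rfl, by omega, e3, by omega, by rwa [show r - 1 - (y.s + x.s) = q - 1 - x.s by omega]⟩
      · obtain ⟨g1, g2, g3, g4, g5⟩ := hy.not_full fy
        rw [if_neg fy]
        exact ⟨rfl, by omega, e3, by omega, g5⟩
  · simp only [joinV, m2] at h2
    by_cases fx : x.f = 1
    · rw [if_pos fx] at h2
      have ex := hx.full fx
      by_cases hj : j < q
      · exact hx.pre j h1 (by omega)
      · exact hy.pre j (by omega) (by omega)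
    · rw [if_neg fx] at h2
      exact hx.pre j h1 h2
  · simp only [joinV, m3] at h1
    by_cases fy : y.f = 1
    · rw [if_pos fy] at h1
      have ey := hy.full fy
      by_cases hj : j < q
      · exact hx.suf j (by omega) hj
      · exact hy.suf j (by omega) (by omega)
    · rw [if_neg fy] at h1
      exact hy.suf j h1 h2
  · simp only [joinV, m3] at h0 ⊢
    by_cases fy : y.f = 1
    · rw [if_pos fy] at h0 ⊢
      have ey := hy.full fy
      by_cases hs : 0 < x.s
      · rw [if_pos ⟨fy, hs⟩]; have := hx.start hs; omega
      · rw [if_neg (fun e => hs e.2)]; have := hy.start (by omega); omega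
    · rw [if_neg fy] at h0 ⊢
      rw [if_neg (fun e => fy e.1)]; exact hy.start h0
  · simp only [joinV, m1] at h0 ⊢
    by_cases hb : Max.max x.b y.b < x.s + y.p
    · rw [if_pos hb, if_pos hb]
      -- The crossing run is longer than `y.b`, hence longer than `y.p`. So the suffix of `x` is
      -- nonempty, and only then is `x.sp` known to be its start.
      have hyp : y.p ≤ y.b := hy.max q y.p le_rfl (by omega) fun j a b => hy.pre j a b
      have := hx.start (by omega)
      refine ⟨by omega, by omega, fun j a b => ?_⟩
      by_cases hj : j < q
      · exact hx.suf j (by omega) hj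
      · exact hy.pre j (by omega) (by omega)
    · rw [if_neg hb] at h0
      rw [if_neg hb, if_neg hb]
      by_cases hxy : x.b < y.b
      · rw [if_pos hxy, max_eq_right hxy.le]
        obtain ⟨e1, e2, e3⟩ := hy.run (by omega)
        exact ⟨by omega, e2, e3⟩
      · rw [if_neg hxy, max_eq_left (by omega)]
        obtain ⟨e1, e2, e3⟩ := hx.run (by omega)
        exact ⟨e1, by omega, e3⟩
  · by_cases c1 : z + a ≤ q
    · exact (hx.max z a h1 c1 h3).trans b1
    by_cases c2 : q ≤ z
    · exact (hy.max z a c2 h2 h3).trans b2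
    have k1 : q - z ≤ x.s := by
      by_cases fx : x.f = 1
      · have := hx.full fx; omega
      · obtain ⟨e1, e2, e3, e4, e5⟩ := hx.not_full fx
        by_contra hc
        have := h3 (q - 1 - x.s) (by omega) (by omega)
        omega
    have k2 : z + a - q ≤ y.p := by
      by_cases fy : y.f = 1
      · have := hy.full fy; omega
      · obtain ⟨e1, e2, e3, e4, e5⟩ := hy.not_full fy
        by_contra hc
        have := h3 (q + y.p) (by omega) (by omega)
        omega
    omega

/-! ## Tilings -/

/-- The pieces of `P` tile `[p, q)`, and are at the heights given by `H`. -/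
def Tiles (H : ℕ → ℕ) : ℕ → List Piece → ℕ → Prop
  | p, [], q => p = q
  | p, c :: P, q => c.start = p ∧ (∀ j, p ≤ j → j < c.stopAt → H j = c.h) ∧ (c.len = 0 → c.h = 0) ∧
      Tiles H c.stopAt P q

theorem Tiles_append {H : ℕ → ℕ} {p r : ℕ} {P Q : List Piece} :
    Tiles H p (P ++ Q) r ↔ ∃ q, Tiles H p P q ∧ Tiles H q Q r := by
  induction P generalizing p with
  | nil => simp [Tiles]
  | cons c P ih =>
    simp only [List.cons_append, Tiles, ih]
    constructor
    · rintro ⟨h1, h2, h3, q, h4, h5⟩; exact ⟨q, ⟨h1, h2, h3, h4⟩, h5⟩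
    · rintro ⟨q, ⟨h1, h2, h3, h4⟩, h5⟩; exact ⟨h1, h2, h3, q, h4, h5⟩

theorem Tiles.le {H : ℕ → ℕ} {p q : ℕ} {P : List Piece} (h : Tiles H p P q) : p ≤ q := by
  induction P generalizing p with
  | nil => exact Nat.le_of_eq h
  | cons c P ih =>
    have := ih h.2.2.2
    have := h.1
    simp only [Piece.stopAt] at *
    omega

theorem Tiles.congr {H H' : ℕ → ℕ} {p q : ℕ} {P : List Piece} (h : Tiles H p P q)
    (hH : ∀ j, p ≤ j → j < q → H' j = H j) : Tiles H' p P q := by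
  induction P generalizing p with
  | nil => exact h
  | cons c P ih =>
    obtain ⟨h1, h2, h3, h4⟩ := h
    have := h4.le
    have h5 : p ≤ c.stopAt := by simp only [Piece.stopAt]; omega
    exact ⟨h1, fun j a b => by rw [hH j a (by omega), h2 j a b], h3,
      ih h4 fun j a b => hH j (by omega) b⟩

theorem Tiles.stopL_eq {H : ℕ → ℕ} {p q : ℕ} {P : List Piece} (h : Tiles H p P q) (hP : P ≠ []) :
    stopL P = q := by
  obtain ⟨P, c, rfl⟩ := (List.eq_nil_or_concat P).resolve_left hP
  rw [List.concat_eq_append] at h ⊢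
  obtain ⟨r, -, h2⟩ := Tiles_append.1 h
  rw [stopL_concat]
  exact h2.2.2.2

theorem Tiles.stop_le {H : ℕ → ℕ} {p q : ℕ} {P : List Piece} (h : Tiles H p P q) :
    ∀ c ∈ P, c.stopAt ≤ q := by
  induction P generalizing p with
  | nil => simp
  | cons c P ih =>
    intro d hd
    rcases List.mem_cons.1 hd with rfl | hd
    · exact h.2.2.2.le
    · exact ih h.2.2.2 d hd

/-- A tiling can be cut at `x`, inside the piece `c`. -/
theorem Tiles.cut {H : ℕ → ℕ} {p q x : ℕ} {P₁ P₂ : List Piece} {c : Piece}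
    (h : Tiles H p (P₁ ++ c :: P₂) q) (h1 : c.start ≤ x) (h2 : x ≤ c.stopAt) :
    Tiles H p (P₁ ++ [mkPiece c.start (x - c.start) c.h]) x ∧
      Tiles H x (mkPiece x (c.stopAt - x) c.h :: P₂) q := by
  obtain ⟨r, hr, e1, e2, e3, e4⟩ := Tiles_append.1 h
  subst e1
  refine ⟨Tiles_append.2 ⟨_, hr, rfl, fun j a b => ?_, ?_, ?_⟩, rfl, fun j a b => ?_, ?_, ?_⟩
  · simp only [mkPiece, Piece.stopAt] at b ⊢
    rw [if_neg (by omega)]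
    exact e2 j a (by omega)
  · simp +contextual [mkPiece]
  · simp only [mkPiece, Piece.stopAt, Tiles]; omega
  · simp only [mkPiece, Piece.stopAt] at b
    simp only [mkPiece]
    rw [if_neg (by simp only [Piece.stopAt]; omega)]
    exact e2 j (by omega) (by simp only [Piece.stopAt]; omega)
  · simp +contextual [mkPiece]
  · have : (mkPiece x (c.stopAt - x) c.h).stopAt = c.stopAt := by simp only [mkPiece, Piece.stopAt] at *; omega
    rw [this]; exact e4

/-- Below all keys nothing is free. As the zero value is fixed by the join, it can serve as initial
value on both sides of every merge. -/
theorem ev_zero_join (M : ℕ) : joinV M V.zero V.zero = V.zero := by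
  simp [joinV, V.zero]

/-- The summary of a block answers queries about the block. -/
theorem Tree.good {M : ℕ} {H : ℕ → ℕ} {p q h : ℕ} {P : List Piece} {o : List Entry}
    (ho : Tree (joinV M) 1 (P.map leaf) o) (hP : Tiles H p P q) (hq : q < M) :
    Good H h p q (ev V.zero o h) := by
  generalize hl : P.map leaf = l at ho
  induction ho generalizing P p q with
  | base h1 =>
    obtain ⟨e, rfl⟩ := List.length_eq_one_iff.1 h1
    obtain ⟨c, rfl, rfl⟩ : ∃ c, P = [c] ∧ leaf c = e := by
      match P, hl with
      | [c], hl => exact ⟨c, rfl, by simpa using hl⟩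
    obtain ⟨e1, e2, e3, e4⟩ := hP
    simp only [Piece.stopAt, Tiles] at e2 e4
    by_cases hc : c.h ≤ h
    · rw [show ev V.zero [leaf c] h = (leaf c).2 from if_pos hc]
      have hok : ∀ j, p ≤ j → j < q → H j ≤ h := fun j a b => by rw [e2 j a (by omega)]; exact hc
      refine ⟨by omega, fun _ => ?_, fun h => absurd rfl h, fun j a b => ?_, fun j a b => ?_,
        fun _ => ?_, fun _ => ?_, fun x a b c d => ?_⟩ <;> simp only [leaf] at *
      · omega
      · exact hok j a (by omega)
      · exact hok j (by omega) b
      · omega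
      · exact ⟨by omega, by omega, fun j a b => hok j (by omega) (by omega)⟩
      · omega
    · rw [show ev V.zero [leaf c] h = V.zero from if_neg hc]
      -- This is where empty pieces must have height `0`: a piece above the threshold has to contain
      -- a column that blocks, as `not_full` demands.
      have h0 : 0 < c.len := Nat.pos_of_ne_zero fun e => by have := e3 e; omega
      have hno : ∀ j, p ≤ j → j < q → h < H j := fun j a b => by rw [e2 j a (by omega)]; omega
      refine ⟨by omega, fun h => ?_, fun _ => ?_, fun j a b => ?_, fun j a b => ?_,
        fun _ => ?_, fun _ => ?_, fun x a b c d => ?_⟩ <;> simp only [V.zero] at *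
      · omega
      · exact ⟨trivial, by omega, hno _ (by omega) (by omega), by omega, hno _ (by omega) (by omega)⟩
      · omega
      · omega
      · omega
      · omega
      · by_contra ha
        have := hno x b (by omega)
        have := d x le_rfl (by omega)
        omega
  | node _ _ ih₁ ih₂ =>
    obtain ⟨P₁, P₂, rfl, h1, h2⟩ := List.map_eq_append_iff.1 hl
    obtain ⟨r, hr1, hr2⟩ := Tiles_append.1 hP
    have := ev_mergeE (joinV M) V.zero V.zero
    rw [ev_zero_join] at this
    rw [this]
    exact (ih₁ hr1 (lt_of_le_of_lt hr2.le hq) h1).join (ih₂ hr2 hq h2) hq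

/-! ### The largest height in a block -/

/-- Largest height of a list of pieces. -/
def maxL : List Piece → ℕ
  | [] => 0
  | c :: P => max c.h (maxL P)

theorem maxL_append (P Q : List Piece) : maxL (P ++ Q) = max (maxL P) (maxL Q) := by
  induction P with
  | nil => simp [maxL]
  | cons c P ih => simp [maxL, ih, max_assoc]

theorem le_maxL {P : List Piece} {c : Piece} (hc : c ∈ P) : c.h ≤ maxL P := by
  induction P with
  | nil => simp at hc
  | cons d P ih =>
    rcases List.mem_cons.1 hc with rfl | hc
    · exact le_max_left _ _
    · exact (ih hc).trans (le_max_right _ _)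

theorem maxL_le {P : List Piece} {m : ℕ} (h : ∀ c ∈ P, c.h ≤ m) : maxL P ≤ m := by
  induction P with
  | nil => exact Nat.zero_le _
  | cons d P ih =>
    exact max_le (h d (by simp)) (ih fun c hc => h c (by simp [hc]))

/-- The largest height in a block is the last key of its summary. -/
theorem Tree.maxL_eq {M : ℕ} {P : List Piece} {o : List Entry}
    (ho : Tree (joinV M) 1 (P.map leaf) o) {x : Entry} {o' : List Entry}
    (hx : o = o' ++ [x]) : maxL P = x.1 := by
  have hp := ho.perm
  apply le_antisymm
  · refine maxL_le fun c hc => ?_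
    have : c.h ∈ o.map Prod.fst := hp.symm.subset (by
      rw [List.map_map]; exact List.mem_map.2 ⟨c, hc, rfl⟩)
    obtain ⟨e, he, he'⟩ := List.mem_map.1 this
    rw [← he']
    have hs := ho.sorted
    rw [hx, SortedE, List.pairwise_append] at hs
    rw [hx, List.mem_append, List.mem_singleton] at he
    rcases he with he | rfl
    · exact hs.2.2 e he x (by simp)
    · exact le_rfl
  · have : x.1 ∈ (P.map leaf).map Prod.fst := hp.subset (by rw [hx]; simp)
    rw [List.map_map] at this
    obtain ⟨c, hc, hc'⟩ := List.mem_map.1 this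
    rw [← hc']; exact le_maxL hc

/-- An empty piece represents no column; its height `0` keeps it from influencing the maximum. -/
theorem Tiles.maxL_le_iff {H : ℕ → ℕ} {p q m : ℕ} {P : List Piece} (h : Tiles H p P q) :
    maxL P ≤ m ↔ ∀ j, p ≤ j → j < q → H j ≤ m := by
  induction P generalizing p with
  | nil => simp only [maxL, Nat.zero_le, true_iff]; intro j a b; simp only [Tiles] at h; omega
  | cons c P ih =>
    obtain ⟨h1, h2, h3, h4⟩ := h
    have := h4.le
    have h5 : c.stopAt = p + c.len := by simp only [Piece.stopAt]; omega
    simp only [maxL, max_le_iff, ih h4]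
    constructor
    · rintro ⟨a, b⟩ j hj hj'
      by_cases hc : j < c.stopAt
      · rw [h2 j hj hc]; exact a
      · exact b j (by omega) hj'
    · intro a
      refine ⟨?_, fun j hj hj' => a j (by omega) hj'⟩
      by_cases hc : c.len = 0
      · rw [h3 hc]; exact Nat.zero_le _
      · rw [← h2 p le_rfl (by omega)]; exact a p le_rfl (by omega)

/-! ## Splitting a block -/

def findLoop : Prog :=
  .loop (.lt 26 21) (.op .add 22 22 24 ;; .op .add 25 25 23 ;; .load 26 25)

def findBlockInit : Prog :=
  .move 22 20 ;; .const 23 4 ;; .const 24 1 ;; .op .mul 25 22 23 ;; .op .add 25 25 4 ;; .load 26 25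

/-- Find the first block with index at least `reg 20` that ends at or after `reg 21`; its index is
returned in `reg 22`, the address of its directory entry in `reg 25`. -/
def findBlock : Prog := findBlockInit ;; findLoop

theorem findLoop_spec {W M n : ℕ} (Y : List (List Piece)) {s : NS}
    (hY : ∃ Q ∈ Y, s.reg 21 ≤ stopL Q) (hD : DirAt M s.mem n (s.reg 25) Y)
    (h26 : s.reg 26 = s.mem (s.reg 25)) (h23 : s.reg 23 = 4) (h24 : s.reg 24 = 1)
    (hb : s.reg 25 + 4 * Y.length < 2 ^ W) (hb' : s.reg 22 + Y.length < 2 ^ W) :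
    Tri W findLoop s (4 * Y.length + 1) fun s' => ∃ X P Z, Y = X ++ P :: Z ∧
      (∀ Q ∈ X, stopL Q < s.reg 21) ∧ s.reg 21 ≤ stopL P ∧ s'.reg 22 = s.reg 22 + X.length ∧
      s'.reg 25 = s.reg 25 + 4 * X.length := by
  induction Y generalizing s with
  | nil => simp at hY
  | cons P Y ih =>
    simp only [List.length_cons] at hb hb' ⊢
    by_cases hx : stopL P < s.reg 21
    · refine (Tri.loop_true (T₁ := 3) (T₂ := 4 * Y.length + 1)
        (by simpa [Test.ev, h26, hD.1.stopAt] using hx)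
        (Tri.run' (by simp [Prog.plain]) ?_ (by simp [Prog.cost])
        ((ih ?_ ?_ ?_ ?_ ?_ ?_ ?_).mono le_rfl ?_))).mono (by omega) fun _ h => h
      · simp [Prog.ok, Prog.run, h23, h24]; omega
      · obtain ⟨Q, hQ, hQ'⟩ := hY
        rcases List.mem_cons.1 hQ with rfl | hQ
        · omega
        · exact ⟨Q, hQ, by simpa [Prog.run] using hQ'⟩
      · simpa [Prog.run, h23] using hD.2
      · simp [Prog.run]
      · simp [Prog.run, h23]
      · simp [Prog.run, h24]
      · simp [Prog.run, h23]; omega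
      · simp [Prog.run, h24]; omega
      · rintro s' ⟨X, Q, Z, rfl, e2, e3, e4, e5⟩
        simp [Prog.run, h23, h24] at e2 e3 e4 e5
        refine ⟨P :: X, Q, Z, rfl, ?_, e3, by simp; omega, by simp; omega⟩
        intro R hR
        rcases List.mem_cons.1 hR with rfl | hR
        · exact hx
        · exact e2 R hR
    · exact (Tri.loop_false (by simpa [Test.ev, h26, hD.1.stopAt] using hx)
        ⟨[], P, Y, rfl, by simp, by omega, rfl, rfl⟩).mono (by omega) fun _ h => h

theorem findBlock_spec {W : ℕ} (hW : 7 < 2 ^ W) {s : NS} {X₀ Y : List (List Piece)}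
    (hD : Dir W s (X₀ ++ Y)) (h20 : s.reg 20 = X₀.length) (hY : ∃ Q ∈ Y, s.reg 21 ≤ stopL Q)
    (hb : s.reg 3 < 2 ^ W) :
    Tri W findBlock s (4 * Y.length + 7) fun s' => (∃ X P Z, Y = X ++ P :: Z ∧
      (∀ Q ∈ X, stopL Q < s.reg 21) ∧ s.reg 21 ≤ stopL P ∧
      s'.reg 22 = X₀.length + X.length ∧
      s'.reg 25 = s.reg 4 + 4 * (X₀.length + X.length) ∧ s'.reg 24 = 1 ∧ s'.mem = s.mem) ∧
      ∀ r, ¬ findBlock.writes r → s'.reg r = s.reg r := by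
  have hle := hD.le
  rw [List.length_append] at hle
  refine Tri.frame ?_
  refine Tri.mono (Q := fun s' => ((∃ X P Z, Y = X ++ P :: Z ∧
      (∀ Q ∈ X, stopL Q < s.reg 21) ∧ s.reg 21 ≤ stopL P ∧ s'.reg 22 = X₀.length + X.length ∧
      s'.reg 25 = s.reg 4 + 4 * (X₀.length + X.length)) ∧ s'.reg 24 = 1) ∧ s'.mem = s.mem)
    (Tri.frame_mem ?_ (by simp [findBlock, findBlockInit, findLoop, Prog.readOnly])) le_rfl ?_
  · have hW0 : W ≠ 0 := by rintro rfl; simp at hW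
    refine (Tri.seq (Tri.run' (T := 6) (by simp [findBlockInit, Prog.plain]) ?_
      (by simp [findBlockInit, Prog.cost])
      ((findLoop_spec (M := 2 ^ W) (n := s.reg 3) Y ?_ ?_ ?_ ?_ ?_ ?_ ?_).frame.mono le_rfl
      ?_))).mono (by omega) fun _ h => h
    · simp [findBlockInit, Prog.ok, Prog.run, h20]; omega
    · simpa [findBlockInit, Prog.run] using hY
    · have := (DirAt_append.1 hD.dir).2
      simpa [findBlockInit, Prog.run, h20, mul_comm, add_comm] using this
    · simp [findBlockInit, Prog.run]
    · simp [findBlockInit, Prog.run]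
    · simp [findBlockInit, Prog.run]
    · simp [findBlockInit, Prog.run, h20]; omega
    · simp [findBlockInit, Prog.run, h20]; omega
    · rintro s' ⟨⟨X, P, Z, e1, e2, e3, e4, e5⟩, e6⟩
      simp [findBlockInit, Prog.run, h20] at e2 e3 e4 e5
      refine ⟨⟨X, P, Z, e1, e2, e3, e4, by omega⟩, ?_⟩
      rw [e6 24 (by simp [findLoop, Prog.writes])]
      simp [findBlockInit, Prog.run]
  · rintro s' ⟨⟨⟨X, P, Z, e1, e2, e3, e4, e5⟩, e6⟩, e7⟩
    exact ⟨X, P, Z, e1, e2, e3, e4, e5, e6, e7⟩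

/-- The words with offsets 5 and 6 of a piece are its length and its start. Registers 34, 36 and 35
receive length, start and right end. -/
def pieceEnd : Prog :=
  .op .add 33 29 31 ;; .load 34 33 ;; .op .add 33 33 24 ;; .load 36 33 ;; .op .add 35 34 36

def pieceLoop : Prog :=
  .loop (.lt 35 21) (.op .add 30 30 24 ;; .op .add 29 29 32 ;; pieceEnd)

def findPieceInit : Prog :=
  .op .add 29 25 24 ;; .load 27 29 ;; .op .add 29 29 24 ;; .load 28 29 ;;
    .move 29 28 ;; .const 30 0 ;; .const 31 5 ;; .const 32 7 ;; pieceEnd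

/-- In the block with directory entry at `reg 25`, find the first piece that ends at or after
`reg 21`. -/
def findPiece : Prog := findPieceInit ;; pieceLoop

theorem pieceLoop_spec {W : ℕ} (P : List Piece) {s : NS}
    (hP : ∃ c ∈ P, s.reg 21 ≤ c.stopAt) (hE : Ents s.mem (s.reg 29) (P.map leaf))
    (hlt : ∀ c ∈ P, c.stopAt < 2 ^ W)
    (hc : ∀ c ∈ P.head?, s.reg 34 = c.len ∧ s.reg 36 = c.start ∧ s.reg 35 = c.stopAt)
    (h24 : s.reg 24 = 1) (h31 : s.reg 31 = 5) (h32 : s.reg 32 = 7)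
    (hb : s.reg 29 + 7 * P.length < 2 ^ W) (hb' : s.reg 30 + P.length < 2 ^ W) :
    Tri W pieceLoop s (8 * P.length + 1) fun s' => ∃ P₁ c P₂, P = P₁ ++ c :: P₂ ∧
      (∀ d ∈ P₁, d.stopAt < s.reg 21) ∧ s.reg 21 ≤ c.stopAt ∧ s'.reg 30 = s.reg 30 + P₁.length ∧
      s'.reg 29 = s.reg 29 + 7 * P₁.length ∧ s'.reg 36 = c.start ∧ s'.reg 35 = c.stopAt := by
  induction P generalizing s with
  | nil => simp at hP
  | cons c P ih =>
    simp only [List.length_cons] at hb hb' ⊢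
    obtain ⟨c1, c2, c3⟩ := hc c (by simp)
    by_cases hx : c.stopAt < s.reg 21
    · have hP' : ∃ d ∈ P, s.reg 21 ≤ d.stopAt := by
        obtain ⟨Q, hQ, hQ'⟩ := hP
        rcases List.mem_cons.1 hQ with rfl | hQ
        · omega
        · exact ⟨Q, hQ, hQ'⟩
      obtain ⟨d, P', rfl⟩ : ∃ d P', P = d :: P' := by
        cases P with
        | nil => simp at hP'
        | cons d P' => exact ⟨d, P', rfl⟩
      obtain ⟨-, -, -, -, -, k5, k6⟩ := hE.2.1
      simp only [leaf] at k5 k6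
      have hd := hlt d (by simp)
      simp only [Piece.stopAt] at hd
      refine (Tri.loop_true (T₁ := 7) (T₂ := 8 * (d :: P').length + 1)
        (by simpa [Test.ev, c3] using hx)
        (Tri.run' (by simp [Prog.plain, pieceEnd]) ?_ (by simp [Prog.cost, pieceEnd])
        ((ih ?_ ?_ ?_ ?_ ?_ ?_ ?_ ?_ ?_).mono le_rfl ?_))).mono (by omega) fun _ h => h
      · simp [Prog.ok, Prog.run, pieceEnd, h24, h32, h31, k5, k6, add_assoc]
        simp only [add_assoc] at k5 k6
        norm_num at k5 k6
        simp only [List.length_cons] at hb hb'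
        omega
      · simpa [Prog.run, pieceEnd] using hP'
      · simpa [Prog.run, pieceEnd, h32] using hE.2
      · exact fun e he => hlt e (List.mem_cons_of_mem _ he)
      · simp [Prog.run, pieceEnd, h24, h32, h31, add_assoc, Piece.stopAt]
        simp only [add_assoc] at k5 k6
        norm_num at k5 k6
        omega
      · simp [Prog.run, pieceEnd, h24]
      · simp [Prog.run, pieceEnd, h31]
      · simp [Prog.run, pieceEnd, h32]
      · simp [Prog.run, pieceEnd, h32]; simp only [List.length_cons] at hb; omega
      · simp [Prog.run, pieceEnd, h24]; simp only [List.length_cons] at hb'; omega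
      · rintro s' ⟨X, Q, Z, e1, e2, e3, e4, e5, e6⟩
        simp [Prog.run, pieceEnd, h32, h24] at e2 e3 e4 e5
        refine ⟨c :: X, Q, Z, by rw [e1]; rfl, ?_, e3, by simp; omega, by simp; omega, e6⟩
        intro R hR
        rcases List.mem_cons.1 hR with rfl | hR
        · exact hx
        · exact e2 R hR
    · exact (Tri.loop_false (by simpa [Test.ev, c3] using hx)
        ⟨[], c, P, rfl, by simp, by omega, rfl, rfl, c2, c3⟩).mono (by omega) fun _ h => h

theorem findPiece_spec {W M n : ℕ} (hW : 7 < 2 ^ W) {s : NS} {P : List Piece}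
    (hB : BlockAt M s.mem n (s.reg 25) P) (hn : n < 2 ^ W) (h25 : s.reg 25 + 4 ≤ n)
    (hP : ∃ c ∈ P, s.reg 21 ≤ c.stopAt) (hlt : ∀ c ∈ P, c.stopAt < 2 ^ W) (h24 : s.reg 24 = 1) :
    Tri W findPiece s (8 * P.length + 14) fun s' => ((∃ P₁ c P₂, P = P₁ ++ c :: P₂ ∧
      (∀ d ∈ P₁, d.stopAt < s.reg 21) ∧ s.reg 21 ≤ c.stopAt ∧ s'.reg 30 = P₁.length ∧
      s'.reg 29 = s'.reg 28 + 7 * P₁.length ∧ s'.reg 36 = c.start ∧ s'.reg 35 = c.stopAt) ∧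
      s'.reg 27 = P.length ∧ s'.reg 28 = s.mem (s.reg 25 + 2) ∧ s'.reg 32 = 7 ∧
      s'.mem = s.mem) ∧ ∀ r, ¬ findPiece.writes r → s'.reg r = s.reg r := by
  obtain ⟨c, P', rfl⟩ : ∃ d P', P = d :: P' := by
    cases P with
    | nil => simp at hP
    | cons d P' => exact ⟨d, P', rfl⟩
  have hsz := hB.size
  have hpc := hB.pieces
  have hpl := hB.pieces_le
  obtain ⟨-, -, -, -, -, k5, k6⟩ := hpc.1
  simp only [leaf] at k5 k6
  have hc := hlt c (by simp)
  simp only [Piece.stopAt] at hc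
  simp only [List.length_cons] at hpl hsz ⊢
  have hW0 : W ≠ 0 := by rintro rfl; simp at hW
  refine Tri.frame ?_
  refine Tri.mono (Q := fun s' => ((∃ P₁ d P₂, c :: P' = P₁ ++ d :: P₂ ∧
      (∀ d ∈ P₁, d.stopAt < s.reg 21) ∧ s.reg 21 ≤ d.stopAt ∧ s'.reg 30 = P₁.length ∧
      s'.reg 29 = s'.reg 28 + 7 * P₁.length ∧ s'.reg 36 = d.start ∧ s'.reg 35 = d.stopAt) ∧
      s'.reg 27 = P'.length + 1 ∧ s'.reg 28 = s.mem (s.reg 25 + 2) ∧ s'.reg 32 = 7) ∧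
      s'.mem = s.mem)
    (Tri.frame_mem ?_ (by simp [findPiece, findPieceInit, pieceEnd, pieceLoop, Prog.readOnly])) le_rfl ?_
  · refine (Tri.seq (Tri.run' (T := 13) (by simp [findPieceInit, Prog.plain, pieceEnd]) ?_
      (by simp [findPieceInit, Prog.cost, pieceEnd])
      ((pieceLoop_spec (c :: P') ?_ ?_ hlt ?_ ?_ ?_ ?_ ?_ ?_).frame.mono le_rfl ?_))).mono
        (by simp; omega) fun _ h => h
    · simp [findPieceInit, Prog.ok, Prog.run, pieceEnd, h24, add_assoc, k5, k6]
      omega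
    · simpa [findPieceInit, Prog.run, pieceEnd, h24, add_assoc] using hP
    · simpa [findPieceInit, Prog.run, pieceEnd, h24, add_assoc] using hpc
    · simp [findPieceInit, Prog.run, pieceEnd, h24, add_assoc, k5, k6, Piece.stopAt]
      omega
    · simp [findPieceInit, Prog.run, pieceEnd, h24]
    · simp [findPieceInit, Prog.run, pieceEnd]
    · simp [findPieceInit, Prog.run, pieceEnd]
    · simp [findPieceInit, Prog.run, pieceEnd, h24, add_assoc]; omega
    · simp [findPieceInit, Prog.run, pieceEnd]; omega
    · rintro s' ⟨⟨P₁, d, P₂, e1, e2, e3, e4, e5, e6⟩, e7⟩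
      have r28 := e7 28 (by simp [pieceLoop, pieceEnd, Prog.writes])
      have r27 := e7 27 (by simp [pieceLoop, pieceEnd, Prog.writes])
      have r32 := e7 32 (by simp [pieceLoop, pieceEnd, Prog.writes])
      simp [findPieceInit, Prog.run, pieceEnd, h24, add_assoc, hsz] at e2 e3 e4 e5 e6 r28 r27 r32
      exact ⟨⟨P₁, d, P₂, e1, e2, e3, e4, by omega, e6⟩, r27, r28, r32⟩
  · rintro s' ⟨⟨e1, e2, e3, e4⟩, e5⟩
    exact ⟨e1, e2, e3, e4, e5⟩

/-- A bound in terms of the block size `N` and the number `L` of blocks alone, so that the costs of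
consecutive calls add up. -/
theorem setBlock_le {W : ℕ} (hW : 7 < 2 ^ W) (j : ℕ) {s : NS} {X Y Z : List (List Piece)}
    {P : List Piece} {N L : ℕ} (hD : Dir W s (X ++ Y ++ Z)) (hN : P.length ≤ N) (hj : N ≤ 2 ^ j)
    (hL : X.length + Y.length + Z.length ≤ L) (hP : P ≠ [])
    (h40 : s.reg 40 = X.length) (h41 : s.reg 41 = X.length + Y.length)
    (hE : Ents s.mem (s.reg 42) (P.map leaf))
    (h43 : s.reg 43 = P.length) (hE3 : s.reg 42 + 7 * P.length ≤ s.reg 3) (hend : stopL P < 2 ^ W)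
    (hb : s.reg 3 + (j * (N * 96 + 7) + 24 * L + 60) < 2 ^ W) :
    Tri W setBlock s (j * (N * 96 + 7) + 24 * L + 60) fun s' =>
      Grow s s' (j * (N * 96 + 7) + 24 * L + 60) ∧
      Dir W s' (X ++ P :: Z) ∧ ∀ r < 40, r ≠ 3 → r ≠ 4 → r ≠ 5 → s'.reg r = s.reg r := by
  have h1 : j * (P.length * 96 + 7) ≤ j * (N * 96 + 7) := Nat.mul_le_mul_left _ (by omega)
  have h2 : (X ++ Y ++ Z).length ≤ L := by simp; omega
  refine (setBlock_spec hW j hD (hN.trans hj) hP h40 h41 hE h43 hE3 hend (by omega)).mono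
    (by omega) ?_
  rintro s' ⟨g1, g2⟩
  exact ⟨g1.mono (by omega), g2⟩

def cutA : Prog := .move 37 3 ;; .op .mul 38 30 32 ;; .move 100 28 ;; .move 101 38
def cutB : Prog := .move 60 36 ;; .op .sub 61 21 36 ;; .load 62 29
def cutC : Prog := .move 60 21 ;; .op .sub 61 35 21 ;; .load 62 29
def cutD : Prog :=
  .op .add 100 29 32 ;; .op .sub 38 27 30 ;; .op .sub 38 38 24 ;; .op .mul 101 38 32

/-- Write the pieces of a block to fresh memory, with one piece cut in two at `reg 21`. -/
def cutPieces : Prog :=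
  cutA ;; copyProg ;; cutB ;; emitLeaf ;; cutC ;; emitLeaf ;; cutD ;; copyProg

theorem cutPieces_spec {W : ℕ} (hW : 7 < 2 ^ W) {s : NS} {P₁ P₂ : List Piece} {c : Piece}
    (hE : Ents s.mem (s.reg 28) ((P₁ ++ c :: P₂).map leaf))
    (hE3 : s.reg 28 + 7 * (P₁.length + P₂.length + 1) ≤ s.reg 3)
    (h24 : s.reg 24 = 1) (h27 : s.reg 27 = P₁.length + P₂.length + 1)
    (h29 : s.reg 29 = s.reg 28 + 7 * P₁.length) (h30 : s.reg 30 = P₁.length)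
    (h32 : s.reg 32 = 7) (h36 : s.reg 36 = c.start) (h35 : s.reg 35 = c.stopAt)
    (h1 : c.start ≤ s.reg 21) (h2 : s.reg 21 ≤ c.stopAt)
    (hb : s.reg 3 + 7 * (P₁.length + P₂.length + 2) < 2 ^ W) :
    Tri W cutPieces s (42 * (P₁.length + P₂.length) + 56) fun s' =>
      (s'.reg 3 = s.reg 3 + 7 * (P₁.length + P₂.length + 2) ∧ (∀ a < s.reg 3, s'.mem a = s.mem a) ∧
      s'.reg 37 = s.reg 3 ∧
      Ents s'.mem (s.reg 3) ((P₁ ++ [mkPiece c.start (s.reg 21 - c.start) c.h]).map leaf ++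
        (mkPiece (s.reg 21) (c.stopAt - s.reg 21) c.h :: P₂).map leaf)) ∧
      ∀ r < 40, r ≠ 3 → r ≠ 37 → r ≠ 38 → s'.reg r = s.reg r := by
  have hW0 : W ≠ 0 := by rintro rfl; simp at hW
  rw [List.map_append, Ents_append] at hE
  obtain ⟨hE1, hE2, hE4⟩ := hE
  rw [List.length_map] at hE2 hE4
  have hh := hE2.1
  refine (Tri.seq (Tri.run' (by simp [cutA, Prog.plain]) ?_ (by simp [cutA, Prog.cost]) ?_)).mono
    (T := 4 + (6 * (7 * P₁.length) + 3 + (3 + (18 + (3 + (18 + (4 + (6 * (7 * P₂.length) + 3))))))))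
    (by omega) fun _ h => h
  · simp [cutA, Prog.ok, Prog.run, h30, h32]; omega
  obtain ⟨s1, hs1⟩ : ∃ s1, s1 = cutA.run s := ⟨_, rfl⟩
  have r37 : s1.reg 37 = s.reg 3 := by simp [hs1, cutA, Prog.run]
  have r100 : s1.reg 100 = s.reg 28 := by simp [hs1, cutA, Prog.run]
  have r101 : s1.reg 101 = 7 * P₁.length := by simp [hs1, cutA, Prog.run, h30, h32, mul_comm]
  have m1 : s1.mem = s.mem := by simp [hs1, cutA, Prog.run]
  have fr1 : ∀ r < 100, r ≠ 37 → r ≠ 38 → s1.reg r = s.reg r := fun r h h' h'' => by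
    simp [hs1, cutA, Prog.run, h', h'', show r ≠ 100 by omega, show r ≠ 101 by omega]
  rw [← hs1]; clear hs1
  refine Tri.seq ((copyProg_spec s1 (by omega) ?_ ?_).mono (by omega) ?_)
  · rw [r100, r101, fr1 3 (by omega) (by omega) (by omega)]; omega
  · rw [r101, fr1 3 (by omega) (by omega) (by omega)]; omega
  rintro s2 ⟨⟨e1, e2, e3⟩, f2⟩
  rw [r101, fr1 3 (by omega) (by omega) (by omega)] at e1 e3
  rw [fr1 3 (by omega) (by omega) (by omega)] at e2
  rw [m1] at e2 e3
  rw [r100] at e3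
  have fr2 : ∀ r < 100, r ≠ 3 → r ≠ 37 → r ≠ 38 → s2.reg r = s.reg r := fun r a b c d => by
    rw [f2 r a b, fr1 r a c d]
  refine Tri.seq (Tri.run' (by simp [cutB, Prog.plain]) ?_ (by simp [cutB, Prog.cost]) ?_)
  · simp [cutB, Prog.ok, Prog.run, fr2, h36]; exact h1
  obtain ⟨s3, hs3⟩ : ∃ s3, s3 = cutB.run s2 := ⟨_, rfl⟩
  have m3 : s3.mem = s2.mem := by simp [hs3, cutB, Prog.run]
  have q60 : s3.reg 60 = c.start := by simp [hs3, cutB, Prog.run, fr2, h36]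
  have q61 : s3.reg 61 = s.reg 21 - c.start := by simp [hs3, cutB, Prog.run, fr2, h36]
  have q62 : s3.reg 62 = c.h := by
    simp [hs3, cutB, Prog.run, fr2, h29]
    rw [e2 _ (by omega)]; exact hh
  have fr3 : ∀ r < 60, s3.reg r = s2.reg r := fun r h => by
    simp [hs3, cutB, Prog.run, show r ≠ 60 by omega, show r ≠ 61 by omega, show r ≠ 62 by omega]
  rw [← hs3]; clear hs3
  refine Tri.seq ((emitLeaf_spec (by omega) ?_).mono le_rfl ?_)
  · rw [fr3 3 (by omega)]; omega
  rintro s4 ⟨⟨g1, g2, g3⟩, f4⟩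
  rw [fr3 3 (by omega)] at g1 g2 g3
  rw [m3] at g2
  rw [q60, q61, q62] at g3
  have fr4 : ∀ r < 60, r ≠ 3 → s4.reg r = s2.reg r := fun r h h' => by
    rw [f4 r (by simp [emitLeaf, emitReg, Prog.writes]; omega), fr3 r h]
  refine Tri.seq (Tri.run' (by simp [cutC, Prog.plain]) ?_ (by simp [cutC, Prog.cost]) ?_)
  · simp [cutC, Prog.ok, Prog.run, fr4, fr2, h35]; exact h2
  obtain ⟨s5, hs5⟩ : ∃ s5, s5 = cutC.run s4 := ⟨_, rfl⟩
  have m5 : s5.mem = s4.mem := by simp [hs5, cutC, Prog.run]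
  have p60 : s5.reg 60 = s.reg 21 := by simp [hs5, cutC, Prog.run, fr2, fr4]
  have p61 : s5.reg 61 = c.stopAt - s.reg 21 := by simp [hs5, cutC, Prog.run, fr2, fr4, h35]
  have p62 : s5.reg 62 = c.h := by
    simp [hs5, cutC, Prog.run, fr2, fr4, h29]
    rw [g2 _ (by omega), e2 _ (by omega)]; exact hh
  have fr5 : ∀ r < 60, s5.reg r = s4.reg r := fun r h => by
    simp [hs5, cutC, Prog.run, show r ≠ 60 by omega, show r ≠ 61 by omega, show r ≠ 62 by omega]
  rw [← hs5]; clear hs5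
  refine Tri.seq ((emitLeaf_spec (by omega) ?_).mono le_rfl ?_)
  · rw [fr5 3 (by omega)]; omega
  rintro s6 ⟨⟨k1, k2, k3⟩, f6⟩
  rw [fr5 3 (by omega)] at k1 k2 k3
  rw [m5] at k2
  rw [p60, p61, p62] at k3
  have fr6 : ∀ r < 60, r ≠ 3 → s6.reg r = s2.reg r := fun r h h' => by
    rw [f6 r (by simp [emitLeaf, emitReg, Prog.writes]; omega), fr5 r h, fr4 r h h']
  refine Tri.seq (Tri.run' (by simp [cutD, Prog.plain]) ?_ (by simp [cutD, Prog.cost]) ?_)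
  · simp [cutD, Prog.ok, Prog.run, fr6, fr2, h27, h29, h30, h32, h24]; omega
  obtain ⟨s7, hs7⟩ : ∃ s7, s7 = cutD.run s6 := ⟨_, rfl⟩
  have m7 : s7.mem = s6.mem := by simp [hs7, cutD, Prog.run]
  have u100 : s7.reg 100 = s.reg 28 + 7 * P₁.length + 7 := by
    simp [hs7, cutD, Prog.run, fr2, fr6, h29, h32]
  have u101 : s7.reg 101 = 7 * P₂.length := by
    simp [hs7, cutD, Prog.run, fr2, fr6, h27, h30, h24, h32]
    rw [show P₁.length + P₂.length + 1 - P₁.length - 1 = P₂.length by omega, mul_comm]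
  have fr7 : ∀ r < 100, r ≠ 38 → s7.reg r = s6.reg r := fun r h h' => by
    simp [hs7, cutD, Prog.run, h', show r ≠ 100 by omega, show r ≠ 101 by omega]
  rw [← hs7]; clear hs7
  have v3 := fr7 3 (by omega) (by omega)
  refine (copyProg_spec s7 (by omega) ?_ ?_).mono (by omega) ?_
  · rw [u100, u101, v3]; omega
  · rw [u101, v3]; omega
  rintro s8 ⟨⟨w1, w2, w3⟩, f8⟩
  rw [u101, v3] at w1
  rw [v3, m7] at w2 w3
  rw [u100, u101] at w3
  refine ⟨⟨by omega, fun a ha => ?_, ?_, ?_⟩, fun r h h3 h4 h5 => ?_⟩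
  · rw [w2 a (by omega), k2 a (by omega), g2 a (by omega), e2 a (by omega)]
  · rw [f8 37 (by omega) (by omega), fr7 37 (by omega) (by omega), fr6 37 (by omega) (by omega),
      f2 37 (by omega) (by omega), r37]
  · rw [List.map_append, List.append_assoc, Ents_append, List.length_map]
    refine ⟨hE1.copy fun t ht => ?_, ?_, ?_, ?_⟩
    · rw [List.length_map] at ht
      rw [w2 _ (by omega), k2 _ (by omega), g2 _ (by omega), e3 t (by omega)]
    · rw [e1] at g3 g1
      refine g3.copy fun t ht => ?_
      rw [w2 _ (by omega), k2 _ (by omega)]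
    · rw [g1, e1] at k3
      refine k3.copy fun t ht => ?_
      rw [w2 _ (by omega)]
    · refine hE4.copy fun t ht => ?_
      rw [List.length_map] at ht
      rw [show s.reg 3 + 7 * P₁.length + 7 + 7 + t = s6.reg 3 + t by omega, w3 t (by omega),
        k2 _ (by omega), g2 _ (by omega), e2 _ (by omega)]
  · rw [f8 r (by omega) h3, fr7 r (by omega) h5, fr6 r (by omega) h3, fr2 r (by omega) h3 h4 h5]

def setA : Prog := .move 40 22 ;; .op .add 41 22 24 ;; .move 42 37 ;; .op .add 43 30 24

def setB : Prog :=
  .op .add 40 22 24 ;; .move 41 40 ;; .op .add 43 30 24 ;; .op .mul 42 43 32 ;;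
    .op .add 42 42 37 ;; .op .sub 43 27 30

def setTwo : Prog := setA ;; setBlock ;; setB ;; setBlock ;; .op .add 22 22 24

theorem setTwo_spec {W : ℕ} (hW : 7 < 2 ^ W) (j : ℕ) {s : NS} {X Z : List (List Piece)}
    {P A B : List Piece} {N L : ℕ} (hD : Dir W s (X ++ P :: Z)) (hA : A.length ≤ N)
    (hB : B.length ≤ N) (hj : N ≤ 2 ^ j) (hL : X.length + Z.length + 2 ≤ L) (hA0 : A ≠ [])
    (hB0 : B ≠ []) (hE : Ents s.mem (s.reg 37) (A.map leaf ++ B.map leaf))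
    (hE3 : s.reg 37 + 7 * (A.length + B.length) ≤ s.reg 3)
    (h22 : s.reg 22 = X.length) (h24 : s.reg 24 = 1) (h30 : s.reg 30 + 1 = A.length)
    (h27 : s.reg 27 = s.reg 30 + B.length) (h32 : s.reg 32 = 7)
    (hsA : stopL A < 2 ^ W) (hsB : stopL B < 2 ^ W)
    (hb : s.reg 3 + 2 * (j * (N * 96 + 7) + 24 * L + 60) < 2 ^ W) :
    Tri W setTwo s (2 * (j * (N * 96 + 7) + 24 * L + 60) + 11) fun s' =>
      Grow s s' (2 * (j * (N * 96 + 7) + 24 * L + 60)) ∧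
      Dir W s' (X ++ A :: B :: Z) ∧ s'.reg 22 = X.length + 1 ∧
      ∀ r < 22, r ≠ 3 → r ≠ 4 → r ≠ 5 → s'.reg r = s.reg r := by
  have hA1 := List.length_pos_of_ne_nil hA0
  have hcnt := hD.count
  have hle := hD.le
  simp only [List.length_append, List.length_cons] at hcnt hle
  generalize hU : j * (N * 96 + 7) + 24 * L + 60 = U at *
  refine Tri.mono (T := 4 + (U + (6 + (U + 1)))) (Tri.seq (Tri.run' (by simp [setA, Prog.plain]) ?_
    (by simp [setA, Prog.cost]) ?_)) (by omega) fun _ h => h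
  · simp [setA, Prog.ok, Prog.run, h22, h24]; omega
  refine Tri.seq ((setBlock_le hW j (X := X) (Y := [P]) (Z := Z) (P := A) (N := N) (L := L) ?_ hA hj
      (by simp; omega) hA0 ?_ ?_ ?_ ?_ ?_ hsA ?_).mono (by rw [hU]) ?_)
  · have : X ++ [P] ++ Z = X ++ P :: Z := by simp
    rw [this]
    exact ⟨by simpa [setA, Prog.run] using hD.dir, by simpa [setA, Prog.run] using hD.count,
      by simpa [setA, Prog.run] using hD.le⟩
  · simp [setA, Prog.run, h22]
  · simp [setA, Prog.run, h22, h24]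
  · simpa [setA, Prog.run] using (Ents_append.1 hE).1
  · simpa [setA, Prog.run, h24] using h30
  · simp [setA, Prog.run]; omega
  · simp [setA, Prog.run, hU]; omega
  rw [hU]
  rintro s2 ⟨g2, d2, f2⟩
  have hg2 : Grow s s2 U := ⟨by simpa [setA, Prog.run] using g2.le,
    by simpa [setA, Prog.run] using g2.le', by simpa [setA, Prog.run] using g2.mem⟩
  have g2a := hg2.le
  have g2b := hg2.le'
  have fr2 : ∀ r < 40, r ≠ 3 → r ≠ 4 → r ≠ 5 → s2.reg r = s.reg r := fun r a b c d => by
    rw [f2 r a b c d]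
    simp [setA, Prog.run, show r ≠ 40 by omega, show r ≠ 41 by omega, show r ≠ 42 by omega,
      show r ≠ 43 by omega]
  refine Tri.seq (Tri.run' (by simp [setB, Prog.plain]) ?_ (by simp [setB, Prog.cost]) ?_)
  · simp [setB, Prog.ok, Prog.run, fr2, h22, h24, h30, h27, h32]; omega
  -- The left part has taken the place of the old block; the right part is inserted behind it, as
  -- the replacement of an empty range.
  refine Tri.seq ((setBlock_le hW j (X := X ++ [A]) (Y := []) (Z := Z) (P := B) (N := N) (L := L) ?_
    hB hj (by simp; omega) hB0 ?_ ?_ ?_ ?_ ?_ hsB ?_).mono (by rw [hU]) ?_)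
  · have : X ++ [A] ++ [] ++ Z = X ++ A :: Z := by simp
    rw [this]
    exact ⟨by simpa [setB, Prog.run] using d2.dir, by simpa [setB, Prog.run] using d2.count,
      by simpa [setB, Prog.run] using d2.le⟩
  · simp [setB, Prog.run, fr2, h22, h24]
  · simp [setB, Prog.run, fr2, h22, h24]
  · have := (Ents_append.1 hE).2.congr (hg2.mem) (by simp; omega)
    simp [setB, Prog.run, fr2, h24, h30, h32]
    simpa [mul_comm, add_comm] using this
  · simp [setB, Prog.run, fr2, h27]
  · simp [setB, Prog.run, fr2, h24, h30, h32]; omega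
  · simp [setB, Prog.run, hU]; omega
  rw [hU]
  rintro s4 ⟨g4, d4, f4⟩
  have hg4 : Grow s2 s4 U := ⟨by simpa [setB, Prog.run] using g4.le,
    by simpa [setB, Prog.run] using g4.le', by simpa [setB, Prog.run] using g4.mem⟩
  have fr4 : ∀ r < 40, r ≠ 3 → r ≠ 4 → r ≠ 5 → s4.reg r = s.reg r := fun r a b c d => by
    rw [f4 r a b c d, ← fr2 r a b c d]
    simp [setB, Prog.run, show r ≠ 40 by omega, show r ≠ 41 by omega, show r ≠ 42 by omega,
      show r ≠ 43 by omega]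
  refine Tri.run' (by simp [Prog.plain]) ?_ (by simp [Prog.cost]) ?_
  · simp [Prog.ok, fr4, h22, h24]; omega
  · have := hg2.trans hg4
    have hg : Grow s (Prog.run (.op .add 22 22 24) s4) (U + U) :=
      ⟨by simpa [Prog.run] using this.le, by simpa [Prog.run] using this.le', this.mem⟩
    refine ⟨by rw [two_mul]; exact hg, ?_, by simp [Prog.run, fr4, h22, h24], fun r a b c d => ?_⟩
    · rw [List.append_assoc] at d4
      exact ⟨d4.dir, d4.count, d4.le⟩
    · simp [Prog.run, show r ≠ 22 by omega, fr4 r (by omega) b c d]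

/-- Split the block that contains `x = reg 21`, searched from the block with index `reg 20` on, at
`x`; the index of the block that now starts at `x` is returned in `reg 22`. -/
def splitProg : Prog := findBlock ;; findPiece ;; cutPieces ;; setTwo

/-- Two block constructions, a scan (`8 * N`) and a copy (`42 * N`, six steps for each of seven
words) of the pieces of one block, and a scan of the directory (`4 * L`). -/
def splitCost (j N L : ℕ) : ℕ := 2 * (j * (N * 96 + 7) + 24 * L + 60) + 50 * N + 4 * L + 100

/-! ### Partitions of the board into blocks, and cutting them -/

/-- What is maintained for a part of the board: blocks that tile `[p, q)`, of at most `N` pieces. -/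
structure Part (H : ℕ → ℕ) (N p q : ℕ) (Bs : List (List Piece)) : Prop where
  tiles : Tiles H p Bs.flatten q
  size : ∀ P ∈ Bs, P ≠ [] ∧ P.length ≤ N

theorem Part.append {H : ℕ → ℕ} {N p q r : ℕ} {X Y : List (List Piece)} (hX : Part H N p q X)
    (hY : Part H N q r Y) : Part H N p r (X ++ Y) :=
  ⟨by rw [List.flatten_append]; exact Tiles_append.2 ⟨q, hX.tiles, hY.tiles⟩, fun P hP =>
    (List.mem_append.1 hP).elim (hX.size P) (hY.size P)⟩

/-- A piece is cut in two even if `x` is one of its borders, and one half is then empty. So both new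
blocks are nonempty without any case distinction, and neither has more pieces than the old block. -/
theorem Part.split {H : ℕ → ℕ} {N p q x : ℕ} {X Z : List (List Piece)} {P₁ P₂ : List Piece}
    {c : Piece} (h : Part H N p q (X ++ (P₁ ++ c :: P₂) :: Z)) (h1 : c.start ≤ x)
    (h2 : x ≤ c.stopAt) :
    Part H N p x (X ++ [P₁ ++ [mkPiece c.start (x - c.start) c.h]]) ∧
      Part H N x q ((mkPiece x (c.stopAt - x) c.h :: P₂) :: Z) := by
  have ht := h.tiles
  rw [show (X ++ (P₁ ++ c :: P₂) :: Z).flatten = (X.flatten ++ P₁) ++ c :: (P₂ ++ Z.flatten) by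
    simp] at ht
  obtain ⟨t1, t2⟩ := ht.cut h1 h2
  have hs := (h.size (P₁ ++ c :: P₂) (by simp)).2
  simp only [List.length_append, List.length_cons] at hs
  refine ⟨⟨by simpa using t1, fun P hP => ?_⟩, ⟨by simpa using t2, fun P hP => ?_⟩⟩
  · rcases List.mem_append.1 hP with hP | hP
    · exact h.size P (by simp [hP])
    · rw [List.mem_singleton.1 hP]; exact ⟨by simp, by simp; omega⟩
  · rcases List.mem_cons.1 hP with rfl | hP
    · exact ⟨by simp, by simp; omega⟩
    · exact h.size P (by simp [hP])

theorem Part.stop_lt {H : ℕ → ℕ} {N p q : ℕ} {Bs : List (List Piece)} (h : Part H N p q Bs) :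
    ∀ P ∈ Bs, ∀ c ∈ P, c.stopAt ≤ q := fun P hP c hc =>
  h.tiles.stop_le c (List.mem_flatten.2 ⟨P, hP, hc⟩)

/-- The search stops at the first block that reaches `x`, and in it at the first piece that does.
Whatever precedes this piece ends before `x`, and the piece starts at that end; if nothing precedes
it, it starts at `p`. -/
theorem Part.start_le {H : ℕ → ℕ} {N p q x : ℕ} {X Z : List (List Piece)} {P₁ P₂ : List Piece}
    {c : Piece} (h : Part H N p q (X ++ (P₁ ++ c :: P₂) :: Z)) (hx : p ≤ x)
    (hX : ∀ Q ∈ X, stopL Q < x) (hP : ∀ d ∈ P₁, d.stopAt < x) : c.start ≤ x := by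
  have ht := h.tiles
  rw [show (X ++ (P₁ ++ c :: P₂) :: Z).flatten = (X.flatten ++ P₁) ++ c :: (P₂ ++ Z.flatten) by
    simp] at ht
  obtain ⟨r, hr, e, -⟩ := Tiles_append.1 ht
  rw [e]
  obtain ⟨r', hr', hr''⟩ := Tiles_append.1 hr
  rcases List.eq_nil_or_concat P₁ with rfl | ⟨P, d, rfl⟩
  · cases hr''
    rcases List.eq_nil_or_concat X with rfl | ⟨Y, Q, rfl⟩
    · cases hr'; exact hx
    · rw [List.concat_eq_append] at hr' h hX
      rw [List.flatten_append, List.flatten_singleton] at hr'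
      have hQ := (h.size Q (by simp)).1
      rw [← hr'.stopL_eq (by simp [hQ]), stopL_append _ _ hQ]
      exact (hX Q (by simp)).le
  · rw [List.concat_eq_append] at hr'' hP
    rw [← hr''.stopL_eq (by simp), stopL_concat]
    exact (hP d (by simp)).le

theorem Part.flatten_pos {H : ℕ → ℕ} {N p q : ℕ} {Bs : List (List Piece)} (h : Part H N p q Bs)
    (h0 : Bs ≠ []) : 0 < Bs.flatten.length := by
  obtain ⟨P, Y, rfl⟩ := List.exists_cons_of_ne_nil h0
  have := List.length_pos_of_ne_nil (h.size P (by simp)).1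
  simp; omega

theorem setBlock_writes (r : ℕ) (h : setBlock.writes r) : r = 3 ∨ r = 4 ∨ r = 5 ∨ 40 ≤ r := by
  by_cases h1 : (sortProg joinProg).writes r
  · have := sortProg_writes (joinProg_computes (W := 1) (by norm_num)) r h1; omega
  by_cases h2 : copyProg.writes r
  · have := copyProg_writes r h2; omega
  simp [setBlock, blockSort, blockStop, blockEmit, blockFinish, emitReg, Prog.writes, h1, h2] at h
  omega

theorem splitProg_writes (r : ℕ) (h : splitProg.writes r) : r = 3 ∨ r = 4 ∨ r = 5 ∨ 22 ≤ r := by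
  by_cases h1 : setBlock.writes r
  · have := setBlock_writes r h1; omega
  by_cases h2 : copyProg.writes r
  · have := copyProg_writes r h2; omega
  simp [splitProg, findBlock, findBlockInit, findLoop, findPiece, findPieceInit, pieceEnd,
    pieceLoop, cutPieces, cutA, cutB, cutC, cutD, setTwo, setA, setB, emitLeaf, emitReg,
    Prog.writes, h1, h2] at h
  omega

/-- The number of blocks and the number of pieces grow by exactly one, wherever the cut is made. The
blocks `X₀` are skipped in the search, which lets the second cut of a drop start from the first one.
-/
theorem splitProg_spec {W : ℕ} (hW : 7 < 2 ^ W) (j : ℕ) {s : NS} {H : ℕ → ℕ} {N L p q : ℕ}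
    {X₀ Y : List (List Piece)} (hD : Dir W s (X₀ ++ Y)) (hY : Part H N p q Y) (hY0 : Y ≠ [])
    (hq : q < 2 ^ W) (hj : N ≤ 2 ^ j) (hL : X₀.length + Y.length + 1 ≤ L)
    (h20 : s.reg 20 = X₀.length) (hx : p ≤ s.reg 21) (hx' : s.reg 21 ≤ q)
    (hb : s.reg 3 + splitCost j N L < 2 ^ W) :
    Tri W splitProg s (splitCost j N L) fun s' => (Grow s s' (splitCost j N L) ∧
      ∃ Y₁ Y₂, Dir W s' (X₀ ++ Y₁ ++ Y₂) ∧ Part H N p (s.reg 21) Y₁ ∧ Part H N (s.reg 21) q Y₂ ∧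
        Y₁ ≠ [] ∧ Y₂ ≠ [] ∧ Y₁.length + Y₂.length = Y.length + 1 ∧
        Y₁.flatten.length + Y₂.flatten.length = Y.flatten.length + 1 ∧
        s'.reg 22 = X₀.length + Y₁.length) ∧ ∀ r, ¬ splitProg.writes r → s'.reg r = s.reg r := by
  refine Tri.frame ?_
  have hle := hD.le
  rw [List.length_append] at hle
  unfold splitCost at *
  generalize hU : j * (N * 96 + 7) + 24 * L + 60 = U at *
  have hlast : ∃ Q ∈ Y, s.reg 21 ≤ stopL Q := by
    obtain ⟨Y', Q, rfl⟩ := (List.eq_nil_or_concat Y).resolve_left hY0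
    refine ⟨Q, by simp, ?_⟩
    have hQ := (hY.size Q (by simp)).1
    have := hY.tiles.stopL_eq (by simp [hQ])
    rw [List.concat_eq_append, List.flatten_append, List.flatten_singleton, stopL_append _ _ hQ]
      at this
    omega
  refine Tri.mono (T := 4 * L + 7 + (8 * N + 14 + (42 * N + 56 + (2 * U + 11))))
    (Tri.seq ((findBlock_spec hW hD h20 hlast (by omega)).mono (by omega) ?_)) (by omega)
    fun _ h => h
  rintro s1 ⟨⟨X, P, Z, rfl, e1, e2, e3, e4, e5, e6⟩, f1⟩
  have fr1 : ∀ r, r < 22 ∨ 27 ≤ r → s1.reg r = s.reg r := fun r hr =>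
    f1 r (by simp [findBlock, findBlockInit, findLoop, Prog.writes]; omega)
  simp only [List.length_append, List.length_cons] at hle hL
  have hBA : BlockAt (2 ^ W) s1.mem (s.reg 3) (s1.reg 25) P := by
    have := hD.dir
    rw [← List.append_assoc, DirAt_append] at this
    rw [e6, e4, ← List.length_append]
    exact this.2.1
  have hPsize := hY.size P (by simp)
  have hPlt : ∀ c ∈ P, c.stopAt < 2 ^ W := fun c hc =>
    lt_of_le_of_lt (hY.stop_lt P (by simp) c hc) hq
  refine Tri.seq ((findPiece_spec hW hBA (by omega) (by omega) ?_ hPlt e5).mono (by omega) ?_)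
  · obtain ⟨P', d, rfl⟩ := (List.eq_nil_or_concat P).resolve_left hPsize.1
    rw [List.concat_eq_append, stopL_concat] at e2
    exact ⟨d, by simp, by rw [fr1 _ (by omega)]; exact e2⟩
  rintro s2 ⟨⟨⟨P₁, c, P₂, rfl, g1, g2, g3, g4, g5, g6⟩, g7, g8, g9, g10⟩, f2⟩
  have fr2 : ∀ r, r < 27 ∨ 37 ≤ r → s2.reg r = s1.reg r := fun r hr =>
    f2 r (by simp [findPiece, findPieceInit, pieceEnd, pieceLoop, Prog.writes]; omega)
  rw [fr1 21 (by omega)] at g1 g2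
  have hcs : c.start ≤ s.reg 21 := hY.start_le hx e1 g1
  have hpl := hBA.pieces_le
  simp only [List.length_append, List.length_cons] at hPsize g7 hpl
  have r21 : s2.reg 21 = s.reg 21 := by rw [fr2 _ (by omega), fr1 _ (by omega)]
  have r3 : s2.reg 3 = s.reg 3 := by rw [fr2 _ (by omega), fr1 _ (by omega)]
  refine Tri.seq ((cutPieces_spec hW (P₁ := P₁) (P₂ := P₂) (c := c) ?_ ?_ ?_ (by omega) g4 g3 g9 g5 g6
    ?_ ?_ ?_).mono (by omega) ?_)
  · rw [g10, g8]; exact hBA.pieces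
  · rw [r3, g8]; omega
  · rw [fr2 _ (by omega), e5]
  · rw [r21]; exact hcs
  · rw [r21]; exact g2
  · rw [r3]; omega
  rintro s3 ⟨⟨k1, k2, k3, k4⟩, f3⟩
  rw [r3] at k1 k2 k3 k4
  rw [r21] at k4
  have fr3 : ∀ r < 27, r ≠ 3 → s3.reg r = s1.reg r := fun r h h' => by
    rw [f3 r (by omega) h' (by omega) (by omega), fr2 r (by omega)]
  have hg3 : Grow s s3 (7 * (P₁.length + P₂.length + 2)) :=
    ⟨by omega, by omega, fun a ha => by rw [k2 a ha, g10, e6]⟩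
  have hD3 := hD.grow hg3 (by rw [fr3 _ (by omega) (by omega), fr1 _ (by omega)])
    (by rw [fr3 _ (by omega) (by omega), fr1 _ (by omega)])
  obtain ⟨pt1, pt2⟩ := hY.split hcs g2
  rw [← List.append_assoc] at hD3
  set A := P₁ ++ [mkPiece c.start (s.reg 21 - c.start) c.h] with hA
  set B := mkPiece (s.reg 21) (c.stopAt - s.reg 21) c.h :: P₂ with hB
  have hAl : A.length = P₁.length + 1 := by simp [hA]
  have hBl : B.length = P₂.length + 1 := by simp [hB]
  have sA : stopL A ≤ q := by
    have := pt1.tiles.stopL_eq (by simp [hA])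
    rw [List.flatten_append, List.flatten_singleton, stopL_append _ _ (by simp [hA])] at this
    omega
  have sB : stopL B ≤ q := by
    obtain ⟨B', d, hB'⟩ := (List.eq_nil_or_concat B).resolve_left (by simp [hB])
    rw [hB', List.concat_eq_append, stopL_concat]
    exact pt2.stop_lt B (by simp) d (by rw [hB']; simp)
  refine (setTwo_spec hW j (X := X₀ ++ X) (A := A) (B := B) (N := N) (L := L) hD3 (by omega)
    (by omega) hj (by simp; omega) (by simp [hA]) (by simp [hB]) (by rw [k3]; exact k4) (by omega)
    (by rw [fr3 _ (by omega) (by omega), e3]; simp) (by rw [fr3 _ (by omega) (by omega), e5])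
    ?_ ?_ ?_ (by omega) (by omega) (by rw [hU]; omega)).mono (by rw [hU]) ?_
  · rw [f3 _ (by omega) (by omega) (by omega) (by omega)]; omega
  · rw [f3 _ (by omega) (by omega) (by omega) (by omega),
      f3 _ (by omega) (by omega) (by omega) (by omega)]; omega
  · rw [f3 _ (by omega) (by omega) (by omega) (by omega)]; exact g9
  rintro s4 ⟨q1, q2, q3, -⟩
  rw [hU] at q1
  refine ⟨(hg3.trans q1).mono (by omega), X ++ [A], B :: Z, by simpa using q2, pt1, pt2, by simp,
    by simp, by simp; omega, by simp [hAl, hBl]; omega, by rw [q3]; simp; omega⟩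

/-! ## The largest height in a range of blocks -/

def maxInit : Prog :=
  .const 12 0 ;; .const 16 4 ;; .const 17 1 ;; .const 18 7 ;; .const 19 0 ;;
    .op .mul 14 10 16 ;; .op .add 14 14 4 ;; .op .sub 15 11 10

def maxBody : Prog :=
  .op .add 20 14 17 ;; .load 21 20 ;; .op .add 20 20 17 ;; .op .add 20 20 17 ;; .load 22 20 ;;
    .op .mul 21 21 18 ;; .op .add 22 22 21 ;; .op .sub 22 22 18 ;; .load 22 22 ;;
    .branch (.lt 12 22) (.move 12 22) .skip ;; .op .add 14 14 16 ;; .op .sub 15 15 17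

def maxLoop : Prog := .loop (.lt 19 15) maxBody

/-- The largest height in the blocks with indices `i`, `reg 10 ≤ i < reg 11`. -/
def maxProg : Prog := maxInit ;; maxLoop

/-- The summary has one entry of seven words for each piece, so its last key is found seven words
before its end, without a search. -/
theorem BlockAt.last_key {M n a : ℕ} {mem : ℕ → ℕ} {P : List Piece} (h : BlockAt M mem n a P)
    (hP : P ≠ []) : mem (mem (a + 3) + P.length * 7 - 7) = maxL P := by
  obtain ⟨o, ho, ho'⟩ := h.summary
  have hl : o.length = P.length := by rw [ho.length_eq, List.length_map]
  have hP' := List.length_pos_of_ne_nil hP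
  obtain ⟨o', x, rfl⟩ := (List.eq_nil_or_concat o).resolve_left (by rintro rfl; simp at hl; omega)
  rw [List.concat_eq_append] at *
  rw [ho.maxL_eq rfl]
  have := (Ents_append.1 ho').2.1.1
  rw [← this, ← hl]
  congr 1; simp; omega

theorem maxLoop_spec {W M n : ℕ} (Y : List (List Piece)) {s : NS} (hY : ∀ P ∈ Y, P ≠ [])
    (hD : DirAt M s.mem n (s.reg 14) Y) (h15 : s.reg 15 = Y.length) (h16 : s.reg 16 = 4)
    (h17 : s.reg 17 = 1) (h18 : s.reg 18 = 7) (h19 : s.reg 19 = 0) (hn : n < 2 ^ W)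
    (hb : s.reg 14 + 4 * Y.length < 2 ^ W) :
    Tri W maxLoop s (14 * Y.length + 1) fun s' =>
      s'.reg 12 = max (s.reg 12) (maxL Y.flatten) := by
  induction Y generalizing s with
  | nil =>
    exact (Tri.loop_false (by simp [Test.ev, h15, h19]) (by simp [maxL])).mono (by simp) fun _ h => h
  | cons P Y ih =>
    simp only [List.length_cons] at h15 hb ⊢
    have hP := hY P (by simp)
    have hPl := List.length_pos_of_ne_nil hP
    have hk := hD.1.last_key hP
    have hsz := hD.1.size
    have hsl := hD.1.summary_le
    refine (Tri.loop_true (T₁ := 13) (T₂ := 14 * Y.length + 1)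
      (by simp [Test.ev, h15, h19])
      (Tri.run' (by simp [maxBody, Prog.plain]) ?_ (by simp [maxBody, Prog.cost])
      ((ih (fun Q hQ => hY Q (by simp [hQ])) ?_ ?_ ?_ ?_ ?_ ?_ ?_).mono le_rfl ?_))).mono (by omega)
        fun _ h => h
    · by_cases hx : s.reg 12 < maxL P
      · simp [maxBody, Prog.ok, Prog.run, Test.ev, h16, h17, h18, h15, hsz, add_assoc, hk, hx]
        omega
      · simp [maxBody, Prog.ok, Prog.run, Test.ev, h16, h17, h18, h15, hsz, add_assoc, hk, hx]
        omega
    all_goals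
      by_cases hx : s.reg 12 < maxL P
      all_goals simp [maxBody, Prog.run, Test.ev, h16, h17, h18, h15, h19, hsz, add_assoc, hk, hx]
    any_goals omega
    any_goals exact hD.2
    · rintro s' hs'
      rw [hs', maxL_append]; omega
    · rintro s' hs'
      rw [hs', maxL_append]; omega

theorem maxProg_spec {W : ℕ} (hW : 7 < 2 ^ W) {s : NS} {X Y Z : List (List Piece)}
    (hD : Dir W s (X ++ Y ++ Z)) (hY : ∀ P ∈ Y, P ≠ []) (h10 : s.reg 10 = X.length)
    (h11 : s.reg 11 = X.length + Y.length) (hb : s.reg 3 < 2 ^ W) :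
    Tri W maxProg s (14 * Y.length + 9) fun s' => (s'.reg 12 = maxL Y.flatten ∧ s'.mem = s.mem) ∧
      ∀ r, ¬ maxProg.writes r → s'.reg r = s.reg r := by
  refine Tri.frame (Tri.frame_mem ?_ (by simp [maxProg, maxInit, maxLoop, maxBody, Prog.readOnly]))
  have hle := hD.le
  simp only [List.length_append] at hle
  have hW0 : W ≠ 0 := by rintro rfl; simp at hW
  have hDY := (DirAt_append.1 (DirAt_append.1 hD.dir).1).2
  refine Tri.mono (T := 8 + (14 * Y.length + 1)) (Tri.seq (Tri.run' (by simp [maxInit, Prog.plain]) ?_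
    (by simp [maxInit, Prog.cost]) ((maxLoop_spec (M := 2 ^ W) (n := s.reg 3) Y hY ?_ ?_ ?_ ?_ ?_ ?_
    hb ?_).mono le_rfl ?_))) (by omega) fun _ h => h
  · simp [maxInit, Prog.ok, Prog.run, h10, h11]; omega
  · simpa [maxInit, Prog.run, h10, mul_comm, add_comm] using hDY
  · simp [maxInit, Prog.run, h10, h11]
  · simp [maxInit, Prog.run]
  · simp [maxInit, Prog.run]
  · simp [maxInit, Prog.run]
  · simp [maxInit, Prog.run]
  · simp [maxInit, Prog.run, h10]; omega
  · rintro s' hs'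
    rw [hs']; simp [maxInit, Prog.run]

/-! ## Dropping a rectangle -/

def dropA : Prog := .move 7 0 ;; .move 8 1 ;; .move 9 2 ;; .const 20 0 ;; .move 21 0
def dropB : Prog := .move 10 22 ;; .move 20 22 ;; .op .add 21 7 8
def dropC : Prog := .move 11 22 ;; maxProg
def dropD : Prog := .op .add 62 12 9 ;; .move 60 7 ;; .move 61 8 ;; .move 42 3
def dropE : Prog := .move 40 10 ;; .move 41 11 ;; .const 43 1

/-- Drop the rectangle with left border, width and height in registers `0`, `1`, `2`. -/
def dropProg : Prog :=
  dropA ;; splitProg ;; dropB ;; splitProg ;; dropC ;; dropD ;; emitLeaf ;; dropE ;; setBlock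

def raise (H : ℕ → ℕ) (x a v : ℕ) (j : ℕ) : ℕ := if x ≤ j ∧ j < x + a then v else H j

def dropCost (j N L : ℕ) : ℕ :=
  2 * splitCost j N L + (j * (N * 96 + 7) + 24 * L + 60) + 14 * L + 60

/-- After cuts at `x` and `x + a` the columns of the rectangle are a union of whole blocks. The cuts
add two blocks and two pieces; the replacement adds nothing, because the range that gives way to a
one-piece block is nonempty. The resting height `m` is characterised by its upper bounds, in the
form in which `restHeight_le_iff` describes it in terms of rectangles. -/
theorem dropProg_spec {W : ℕ} (hW : 7 < 2 ^ W) (j : ℕ) {s : NS} {H : ℕ → ℕ}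
    {N L w x a b hm : ℕ} {Bs : List (List Piece)} (hD : Dir W s Bs) (hP : Part H N 0 w Bs)
    (hB0 : Bs ≠ []) (hw : w < 2 ^ W) (hN : 0 < N) (hj : N ≤ 2 ^ j) (hL : Bs.length + 2 ≤ L)
    (h0 : s.reg 0 = x) (h1 : s.reg 1 = a) (h2 : s.reg 2 = b) (ha : 0 < a) (hxa : x + a ≤ w)
    (hH : ∀ j < w, H j ≤ hm) (hhm : hm + b < 2 ^ W)
    (hb : s.reg 3 + dropCost j N L < 2 ^ W) :
    Tri W dropProg s (dropCost j N L) fun s' => Grow s s' (dropCost j N L) ∧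
      s'.reg 6 = s.reg 6 ∧ ∃ Bs' m, Dir W s' Bs' ∧ Part (raise H x a (m + b)) N 0 w Bs' ∧ Bs' ≠ [] ∧
        Bs'.length ≤ Bs.length + 2 ∧ Bs'.flatten.length ≤ Bs.flatten.length + 2 ∧
        ∀ t, m ≤ t ↔ ∀ j, x ≤ j → j < x + a → H j ≤ t := by
  have hW0 : W ≠ 0 := by rintro rfl; simp at hW
  have hle := hD.le
  unfold dropCost at *
  generalize hS : splitCost j N L = S at *
  have hS' : 100 ≤ S := by rw [← hS]; unfold splitCost; omega
  generalize hU : j * (N * 96 + 7) + 24 * L + 60 = U at *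
  refine Tri.mono (T := 5 + (S + (3 + (S + (1 + (14 * L + 9) + (4 + (18 + (3 + U))))))))
    (Tri.seq (Tri.run' (by simp [dropA, Prog.plain]) (by simp [dropA, Prog.ok])
    (by simp [dropA, Prog.cost]) ?_)) (by omega) fun _ h => h
  obtain ⟨s0, hs0⟩ : ∃ s0, s0 = dropA.run s := ⟨_, rfl⟩
  have m0 : s0.mem = s.mem := by simp [hs0, dropA, Prog.run]
  have fr0 : ∀ r, 3 ≤ r ∧ r < 7 → s0.reg r = s.reg r := fun r hr => by
    simp [hs0, dropA, Prog.run, show r ≠ 7 by omega, show r ≠ 8 by omega, show r ≠ 9 by omega,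
      show r ≠ 20 by omega, show r ≠ 21 by omega]
  have a7 : s0.reg 7 = x := by simp [hs0, dropA, Prog.run, h0]
  have a8 : s0.reg 8 = a := by simp [hs0, dropA, Prog.run, h1]
  have a9 : s0.reg 9 = b := by simp [hs0, dropA, Prog.run, h2]
  have a20 : s0.reg 20 = 0 := by simp [hs0, dropA, Prog.run]
  have a21 : s0.reg 21 = x := by simp [hs0, dropA, Prog.run, h0]
  rw [← hs0]; clear hs0
  have hg0 : Grow s s0 0 := ⟨(fr0 3 (by omega)).ge, by rw [fr0 3 (by omega)]; omega, by simp [m0]⟩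
  have hD0 : Dir W s0 ([] ++ Bs) := hD.grow hg0 (fr0 _ (by omega)) (fr0 _ (by omega))
  refine Tri.seq ((splitProg_spec hW j (L := L) hD0 hP hB0 hw hj (by simp; omega) (by simp [a20])
    (by omega) (by omega) (by rw [hS, fr0 _ (by omega)]; omega)).mono (by rw [hS]) ?_)
  rintro s1 ⟨⟨g1, Y₁, Y₂, d1, p1, p2, n1, n2, l1, l2, r22⟩, f1⟩
  rw [hS] at g1
  rw [a21] at p1 p2
  have hg1 := hg0.trans g1
  have fr1 : ∀ r, 6 ≤ r ∧ r < 22 → s1.reg r = s0.reg r := fun r hr =>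
    f1 r fun hw => by have := splitProg_writes r hw; omega
  refine Tri.seq (Tri.run' (by simp [dropB, Prog.plain])
    (by simp [dropB, Prog.ok, Prog.run, fr1, a7, a8]; omega) (by simp [dropB, Prog.cost]) ?_)
  obtain ⟨s2, hs2⟩ : ∃ s2, s2 = dropB.run s1 := ⟨_, rfl⟩
  have m2 : s2.mem = s1.mem := by simp [hs2, dropB, Prog.run]
  have fr2 : ∀ r < 10, s2.reg r = s1.reg r := fun r hr => by
    simp [hs2, dropB, Prog.run, show r ≠ 10 by omega, show r ≠ 20 by omega, show r ≠ 21 by omega]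
  have b10 : s2.reg 10 = Y₁.length := by simp [hs2, dropB, Prog.run, r22]
  have b20 : s2.reg 20 = Y₁.length := by simp [hs2, dropB, Prog.run, r22]
  have b21 : s2.reg 21 = x + a := by simp [hs2, dropB, Prog.run, fr1, a7, a8]
  rw [← hs2]; clear hs2
  have g2 : Grow s1 s2 0 := ⟨(fr2 3 (by omega)).ge, by rw [fr2 3 (by omega)]; omega, by simp [m2]⟩
  have hg2 := hg1.trans g2
  have d2 : Dir W s2 (Y₁ ++ Y₂) := by
    simpa using d1.grow g2 (fr2 _ (by omega)) (fr2 _ (by omega))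
  have := hg2.le'
  refine Tri.seq ((splitProg_spec hW j (L := L) d2 p2 n2 hw hj (by omega) b20
    (by omega) (by omega) (by rw [hS]; omega)).mono (by rw [hS]) ?_)
  rintro s3 ⟨⟨g3, Y₃, Y₄, d3, p3, p4, n3, n4, l3, l4, q22⟩, f3⟩
  rw [hS] at g3
  rw [b21] at p3 p4
  have hg3 := hg2.trans g3
  have fr3 : ∀ r, 6 ≤ r ∧ r < 22 → s3.reg r = s2.reg r := fun r hr =>
    f3 r fun hw => by have := splitProg_writes r hw; omega
  have := hg3.le'
  have := hg3.le
  -- the maximum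
  have hmax : Tri W dropC s3 (1 + (14 * L + 9)) fun s' => (s'.reg 12 = maxL Y₃.flatten ∧
      s'.mem = s3.mem) ∧ s'.reg 11 = Y₁.length + Y₃.length ∧
      ∀ r < 11, s'.reg r = s3.reg r := by
    refine Tri.seq (Tri.run' (by simp [Prog.plain]) (by simp [Prog.ok]) (by simp [Prog.cost]) ?_)
    refine (maxProg_spec hW (X := Y₁) (Y := Y₃) (Z := Y₄) (s := Prog.run (.move 11 22) s3)
      ⟨by simpa [Prog.run] using d3.dir, by simpa [Prog.run] using d3.count,
        by simpa [Prog.run] using d3.le⟩ (fun P hP => (p3.size P hP).1)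
      (by simp [Prog.run, fr3, b10]) (by simp [Prog.run, q22]) (by simp [Prog.run]; omega)).mono
      (by omega) ?_
    rintro s' ⟨⟨e1, e2⟩, e3⟩
    refine ⟨⟨e1, e2⟩, ?_, fun r hr => ?_⟩
    · rw [e3 11 (by simp [maxProg, maxInit, maxLoop, maxBody, Prog.writes])]
      simp [Prog.run, q22]
    · rw [e3 r (by simp [maxProg, maxInit, maxLoop, maxBody, Prog.writes]; omega)]
      simp [Prog.run, show r ≠ 11 by omega]
  refine Tri.seq (hmax.mono le_rfl ?_)
  rintro s4 ⟨⟨e1, e2⟩, e11, f4⟩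
  have hmm := p3.tiles.maxL_le_iff (m := hm)
  have hmx : maxL Y₃.flatten ≤ hm := hmm.2 fun j _ hj' => hH j (by omega)
  have c7 : s4.reg 7 = x := by
    rw [f4 _ (by omega), fr3 _ (by omega), fr2 _ (by omega), fr1 _ (by omega), a7]
  have c8 : s4.reg 8 = a := by
    rw [f4 _ (by omega), fr3 _ (by omega), fr2 _ (by omega), fr1 _ (by omega), a8]
  have c9 : s4.reg 9 = b := by
    rw [f4 _ (by omega), fr3 _ (by omega), fr2 _ (by omega), fr1 _ (by omega), a9]
  refine Tri.seq (Tri.run' (by simp [dropD, Prog.plain])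
    (by simp [dropD, Prog.ok, e1, c9]; omega) (by simp [dropD, Prog.cost]) ?_)
  obtain ⟨s5, hs5⟩ : ∃ s5, s5 = dropD.run s4 := ⟨_, rfl⟩
  have m5 : s5.mem = s4.mem := by simp [hs5, dropD, Prog.run]
  have fr5 : ∀ r < 42, s5.reg r = s4.reg r := fun r hr => by
    simp [hs5, dropD, Prog.run, show r ≠ 42 by omega, show r ≠ 60 by omega, show r ≠ 61 by omega,
      show r ≠ 62 by omega]
  have q42 : s5.reg 42 = s3.reg 3 := by simp [hs5, dropD, Prog.run, f4]
  have q60 : s5.reg 60 = x := by simp [hs5, dropD, Prog.run, c7]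
  have q61 : s5.reg 61 = a := by simp [hs5, dropD, Prog.run, c8]
  have q62 : s5.reg 62 = maxL Y₃.flatten + b := by simp [hs5, dropD, Prog.run, c9, e1]
  rw [← hs5]; clear hs5
  have r53 : s5.reg 3 = s3.reg 3 := by rw [fr5 _ (by omega), f4 _ (by omega)]
  refine Tri.seq ((emitLeaf_spec (by omega) (by rw [r53]; omega)).mono le_rfl ?_)
  rintro s6 ⟨⟨k1, k2, k3⟩, f6⟩
  rw [r53] at k1 k2 k3
  rw [q60, q61, q62] at k3
  rw [m5, e2] at k2
  have fr6 : ∀ r < 60, r ≠ 3 → s6.reg r = s5.reg r := fun r h h' =>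
    f6 r (by simp [emitLeaf, emitReg, Prog.writes]; omega)
  refine Tri.seq (Tri.run' (by simp [dropE, Prog.plain])
    (by simp [dropE, Prog.ok]; omega) (by simp [dropE, Prog.cost]) ?_)
  obtain ⟨s7, hs7⟩ : ∃ s7, s7 = dropE.run s6 := ⟨_, rfl⟩
  have m7 : s7.mem = s6.mem := by simp [hs7, dropE, Prog.run]
  have fr7 : ∀ r, r < 40 ∨ r = 42 → s7.reg r = s6.reg r := fun r hr => by
    simp [hs7, dropE, Prog.run, show r ≠ 40 by omega, show r ≠ 41 by omega, show r ≠ 43 by omega]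
  have u40 : s7.reg 40 = Y₁.length := by
    simp [hs7, dropE, Prog.run, fr6, fr5, f4, fr3, b10]
  have u41 : s7.reg 41 = Y₁.length + Y₃.length := by
    simp [hs7, dropE, Prog.run, fr6, fr5, e11]
  have u43 : s7.reg 43 = 1 := by simp [hs7, dropE, Prog.run]
  rw [← hs7]; clear hs7
  have r73 : s7.reg 3 = s3.reg 3 + 7 := by rw [fr7 _ (by omega), k1]
  have fr73 : ∀ r < 11, r ≠ 3 → s7.reg r = s3.reg r := fun r h h' => by
    rw [fr7 r (by omega), fr6 r (by omega) h', fr5 r (by omega), f4 r h]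
  have g7 : Grow s3 s7 7 := ⟨by omega, by omega, fun t ht => by rw [m7, k2 t ht]⟩
  have hg7 := hg3.trans g7
  have d7 := d3.grow g7 (fr73 _ (by omega) (by omega)) (fr73 _ (by omega) (by omega))
  have c42 : s7.reg 42 = s3.reg 3 := by
    rw [fr7 _ (by omega), fr6 _ (by omega) (by omega), q42]
  set c : Piece := mkPiece x a (maxL Y₃.flatten + b) with hc
  have hend : stopL [c] = x + a := by simp [stopL, hc, mkPiece, Piece.stopAt]
  refine (setBlock_le hW j (X := Y₁) (Y := Y₃) (Z := Y₄) (P := [c]) (N := N) (L := L) d7 (by simp; omega)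
    hj (by omega) (by simp) u40 u41 ?_ (by simp [u43]) ?_ (by omega) (by rw [hU]; omega)).mono
    (by rw [hU]) ?_
  · rw [c42, m7]; exact ⟨k3, trivial⟩
  · rw [c42, r73]; simp
  rw [hU]
  rintro s8 ⟨g8, d8, f8⟩
  refine ⟨(hg7.trans g8).mono (by omega), ?_, Y₁ ++ [c] :: Y₄, maxL Y₃.flatten, d8, ?_, by simp, ?_,
    ?_, fun t => p3.tiles.maxL_le_iff⟩
  · rw [f8 6 (by omega) (by omega) (by omega) (by omega), fr73 _ (by omega) (by omega),
      fr3 _ (by omega), fr2 _ (by omega), fr1 _ (by omega), fr0 _ (by omega)]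
  · have P1 : Part (raise H x a (maxL Y₃.flatten + b)) N 0 x Y₁ :=
      ⟨p1.tiles.congr fun j _ hj => by rw [raise, if_neg (by omega)], p1.size⟩
    have P4 : Part (raise H x a (maxL Y₃.flatten + b)) N (x + a) w Y₄ :=
      ⟨p4.tiles.congr fun j hj _ => by rw [raise, if_neg (by omega)], p4.size⟩
    have Pc : Part (raise H x a (maxL Y₃.flatten + b)) N x (x + a) [[c]] := by
      refine ⟨⟨rfl, fun j hj hj' => ?_, ?_, rfl⟩, by simp; omega⟩
      · simp only [hc, mkPiece, Piece.stopAt] at hj' ⊢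
        rw [raise, if_pos ⟨hj, hj'⟩, if_neg (by omega)]
      · simp +contextual [hc, mkPiece]
    exact P1.append (Pc.append P4)
  · have := List.length_pos_of_ne_nil n3
    simp; omega
  · have := p3.flatten_pos n3
    rw [List.flatten_append, List.flatten_cons, List.length_append, List.length_append]
    simp only [List.length_singleton]
    omega

/-! ## Joining small neighbouring blocks -/

def pairInit : Prog :=
  .const 10 0 ;; .const 11 0 ;; .const 12 1 ;; .const 13 4 ;; .move 14 4 ;; .op .sub 15 5 12 ;;
    .op .add 16 14 12 ;; .load 17 16 ;; .const 9 0 ;; .const 8 7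

def pairBody : Prog :=
  .op .add 14 14 13 ;; .op .add 16 14 12 ;; .load 18 16 ;; .op .add 19 17 18 ;;
    .op .add 10 10 12 ;; .branch (.lt 6 19) .skip (.move 11 10) ;; .move 17 18

def pairLoop : Prog := .loop (.lt 10 15) pairBody

def pairA : Prog :=
  .op .sub 40 11 12 ;; .op .add 41 11 12 ;; .op .mul 20 40 13 ;; .op .add 20 20 4 ;;
    .op .add 21 20 12 ;; .load 22 21 ;; .op .add 21 21 12 ;; .load 23 21 ;; .op .mul 25 22 8 ;;
    .move 26 3 ;; .move 100 23 ;; .move 101 25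

def pairB : Prog :=
  .op .add 21 21 13 ;; .load 23 21 ;; .op .sub 21 21 12 ;; .load 27 21 ;;
    .op .mul 25 27 8 ;; .move 100 23 ;; .move 101 25

def pairC : Prog := .move 42 26 ;; .op .add 43 22 27

def pairJoin : Prog := pairA ;; copyProg ;; pairB ;; copyProg ;; pairC ;; setBlock

/-- Join two neighbouring blocks with at most `reg 6` pieces together, if there are such. -/
def joinPair : Prog := pairInit ;; pairLoop ;; .branch (.lt 9 11) pairJoin .skip

/-- Any two neighbouring blocks have more than `N` pieces together. -/
def Sparse (N : ℕ) (Bs : List (List Piece)) : Prop :=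
  ∀ X P Q Z, Bs = X ++ P :: Q :: Z → N < P.length + Q.length

/-- Summation of the inequality over all pairs of neighbours counts every block at most twice. The
first block belongs to one pair only, and the spare summand `P.length` is what carries the
induction. -/
theorem Sparse.length_le {N : ℕ} {Bs : List (List Piece)} (h : Sparse N Bs) :
    (Bs.length - 1) * N ≤ 2 * Bs.flatten.length := by
  have key : ∀ (P : List Piece) (Z : List (List Piece)), Sparse N (P :: Z) →
      Z.length * N + P.length ≤ 2 * (P :: Z).flatten.length := by
    intro P Z
    induction Z generalizing P with
    | nil => intro _; simp; omega
    | cons Q Z ih =>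
      intro h
      have h1 := h [] P Q Z rfl
      have h2 := ih Q fun X P' Q' Z' e => h (P :: X) P' Q' Z' (by rw [e]; rfl)
      simp only [List.flatten_cons, List.length_append, List.length_cons, add_mul] at h2 ⊢
      omega
  match Bs, h with
  | [], _ => simp
  | P :: Z, h => have := key P Z h; simp only [List.length_cons, Nat.add_sub_cancel]; omega

/-- Register 11 records the index of the right-hand block of the last suitable pair. Such an index
is never `0`, so the initial value `0` signals that there is no pair. -/
theorem pairLoop_spec {W M n N : ℕ} (Z : List (List Piece)) (P : List Piece) {s : NS}
    (hD : DirAt M s.mem n (s.reg 14) (P :: Z)) (h17 : s.reg 17 = P.length) (h6 : s.reg 6 = N)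
    (h12 : s.reg 12 = 1) (h13 : s.reg 13 = 4) (h15 : s.reg 15 = s.reg 10 + Z.length)
    (hN : N + N < 2 ^ W) (hs : ∀ Q ∈ P :: Z, Q.length ≤ N)
    (hb : s.reg 14 + 4 * (Z.length + 1) < 2 ^ W) (hb' : s.reg 10 + Z.length < 2 ^ W) :
    Tri W pairLoop s (9 * Z.length + 1) fun s' => (s'.reg 11 = s.reg 11 ∧ Sparse N (P :: Z)) ∨
      ∃ X P' Q' Z', P :: Z = X ++ P' :: Q' :: Z' ∧ s'.reg 11 = s.reg 10 + X.length + 1 ∧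
        P'.length + Q'.length ≤ N := by
  induction Z generalizing P s with
  | nil =>
    refine (Tri.loop_false (by simp [Test.ev, h15]) (.inl ⟨rfl, fun X P' Q' Z' e => ?_⟩)).mono
      (by simp) fun _ h => h
    have := congrArg List.length e
    simp at this; omega
  | cons Q Z ih =>
    simp only [List.length_cons] at h15 hb hb' ⊢
    have hP := hs P (by simp)
    have hQ := hs Q (by simp)
    have hsz := hD.2.1.size
    refine (Tri.loop_true (T₁ := 8) (T₂ := 9 * Z.length + 1)
      (by simp [Test.ev, h15])
      (Tri.run' (by simp [pairBody, Prog.plain]) ?_ (by simp [pairBody, Prog.cost])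
      ((ih Q ?_ ?_ ?_ ?_ ?_ ?_ (fun R hR => hs R (by simp at hR ⊢; tauto)) ?_ ?_).mono le_rfl
      ?_))).mono (by omega) fun _ h => h
    · by_cases hx : N < P.length + Q.length
      · simp [pairBody, Prog.ok, Prog.run, Test.ev, h6, h12, h13, h17, hsz, hx]
        omega
      · simp [pairBody, Prog.ok, Prog.run, Test.ev, h6, h12, h13, h17, hsz, hx]
        omega
    all_goals
      by_cases hx : N < P.length + Q.length
      all_goals simp [pairBody, Prog.run, Test.ev, h6, h12, h13, h15, h17, hsz, hx]
    any_goals omega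
    any_goals exact hD.2
    · rintro s' (⟨e1, e2⟩ | ⟨X, P', Q', ⟨Z', e1⟩, e2, e3⟩)
      · refine .inl ⟨e1, fun X P' Q' Z' e => ?_⟩
        rcases X with _ | ⟨R, X⟩
        · simp only [List.nil_append, List.cons.injEq] at e
          obtain ⟨rfl, rfl, -⟩ := e; exact hx
        · simp only [List.cons_append, List.cons.injEq] at e
          exact e2 X P' Q' Z' e.2
      · exact .inr ⟨P :: X, P', Q', ⟨Z', by rw [e1]; rfl⟩, by rw [e2]; simp; omega, e3⟩
    · rintro s' (⟨e1, e2⟩ | ⟨X, P', Q', ⟨Z', e1⟩, e2, e3⟩)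
      · exact .inr ⟨[], P, Q, ⟨Z, rfl⟩, by rw [e1]; simp, by omega⟩
      · exact .inr ⟨P :: X, P', Q', ⟨Z', by rw [e1]; rfl⟩, by rw [e2]; simp; omega, e3⟩

/-- The pieces of both blocks are copied to consecutive fresh cells, and the table is built again
from the pieces; the `7 * N` words and `42 * N` steps are due to the copies. -/
theorem pairJoin_spec {W : ℕ} (hW : 7 < 2 ^ W) (j : ℕ) {s : NS} {X Z : List (List Piece)}
    {P Q : List Piece} {N L : ℕ} (hD : Dir W s (X ++ P :: Q :: Z)) (hN : P.length + Q.length ≤ N)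
    (hj : N ≤ 2 ^ j) (hL : X.length + Z.length + 2 ≤ L) (hP0 : P ≠ []) (hQ0 : Q ≠ [])
    (h8 : s.reg 8 = 7) (h11 : s.reg 11 = X.length + 1) (h12 : s.reg 12 = 1) (h13 : s.reg 13 = 4)
    (hs : stopL Q < 2 ^ W)
    (hb : s.reg 3 + (j * (N * 96 + 7) + 24 * L + 60 + 7 * N) < 2 ^ W) :
    Tri W pairJoin s (j * (N * 96 + 7) + 24 * L + 90 + 42 * N) fun s' =>
      Grow s s' (j * (N * 96 + 7) + 24 * L + 60 + 7 * N) ∧ s'.reg 6 = s.reg 6 ∧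
      Dir W s' (X ++ (P ++ Q) :: Z) := by
  have hle := hD.le
  simp only [List.length_append, List.length_cons] at hle
  have hW0 : W ≠ 0 := by rintro rfl; simp at hW
  have hPl := List.length_pos_of_ne_nil hP0
  generalize hU : j * (N * 96 + 7) + 24 * L + 60 = U at *
  obtain ⟨-, bP, bQ, -⟩ := DirAt_append.1 hD.dir
  have p1 := bP.size
  have p2 := bP.pieces
  have p3 := bP.pieces_le
  have q1 := bQ.size
  have q2 := bQ.pieces
  have q3 := bQ.pieces_le
  simp only [add_assoc, Nat.reduceAdd] at p1 p2 p3 q1 q2 q3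
  have eX : X.length * 4 + s.reg 4 = s.reg 4 + 4 * X.length := by ring
  refine Tri.mono (T := 12 + (6 * (7 * P.length) + 3 + (7 + (6 * (7 * Q.length) + 3 + (2 + U)))))
    (Tri.seq (Tri.run' (by simp [pairA, Prog.plain]) ?_ (by simp [pairA, Prog.cost]) ?_))
    (by omega) fun _ h => h
  · simp [pairA, Prog.ok, Prog.run, h8, h11, h12, h13, eX, p1, add_assoc]; omega
  obtain ⟨s1, hs1⟩ : ∃ s1, s1 = pairA.run s := ⟨_, rfl⟩
  have m1 : s1.mem = s.mem := by simp [hs1, pairA, Prog.run]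
  have fr1 : ∀ r < 20, s1.reg r = s.reg r := fun r hr => by
    simp [hs1, pairA, Prog.run, show r ≠ 20 by omega, show r ≠ 21 by omega, show r ≠ 22 by omega,
      show r ≠ 23 by omega, show r ≠ 25 by omega, show r ≠ 26 by omega, show r ≠ 40 by omega,
      show r ≠ 41 by omega, show r ≠ 100 by omega, show r ≠ 101 by omega]
  have a40 : s1.reg 40 = X.length := by simp [hs1, pairA, Prog.run, h11, h12]
  have a41 : s1.reg 41 = X.length + 2 := by simp [hs1, pairA, Prog.run, h11, h12]
  have a21 : s1.reg 21 = s.reg 4 + (4 * X.length + 2) := by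
    simp [hs1, pairA, Prog.run, h11, h12, h13]; omega
  have a22 : s1.reg 22 = P.length := by
    simp [hs1, pairA, Prog.run, h11, h12, h13, eX, add_assoc, p1]
  have a26 : s1.reg 26 = s.reg 3 := by simp [hs1, pairA, Prog.run]
  have a100 : s1.reg 100 = s.mem (s.reg 4 + (4 * X.length + 2)) := by
    simp [hs1, pairA, Prog.run, h11, h12, h13, eX, add_assoc]
  have a101 : s1.reg 101 = 7 * P.length := by
    simp [hs1, pairA, Prog.run, h11, h12, h13, h8, eX, add_assoc, p1]; omega
  rw [← hs1]; clear hs1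
  refine Tri.seq ((copyProg_spec s1 (by omega) (by rw [a100, a101, fr1 _ (by omega)]; exact p3)
    (by rw [a101, fr1 _ (by omega)]; omega)).mono (by omega) ?_)
  rintro s2 ⟨⟨e1, e2, e3⟩, f2⟩
  rw [fr1 3 (by omega), a101] at e1 e3
  rw [fr1 3 (by omega), m1] at e2
  rw [m1, a100] at e3
  have fr2 : ∀ r < 20, r ≠ 3 → s2.reg r = s.reg r := fun r h h' => by
    rw [f2 r (by omega) h', fr1 r h]
  have x1 : s2.mem (s.reg 4 + (4 * X.length + 6)) = s.mem (s.reg 4 + (4 * X.length + 6)) :=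
    e2 _ (by omega)
  have x2 : s2.mem (s.reg 4 + (4 * X.length + 5)) = Q.length := by
    rw [e2 _ (by omega), q1]
  have v12 : s2.reg 12 = 1 := by rw [fr2 _ (by omega) (by omega), h12]
  have v13 : s2.reg 13 = 4 := by rw [fr2 _ (by omega) (by omega), h13]
  have v8 : s2.reg 8 = 7 := by rw [fr2 _ (by omega) (by omega), h8]
  have v21 : s2.reg 21 + 4 = s.reg 4 + (4 * X.length + 6) := by
    rw [f2 _ (by omega) (by omega), a21]; omega
  have v21' : s.reg 4 + (4 * X.length + 6) - 1 = s.reg 4 + (4 * X.length + 5) := by omega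
  refine Tri.seq (Tri.run' (by simp [pairB, Prog.plain]) ?_ (by simp [pairB, Prog.cost]) ?_)
  · simp [pairB, Prog.ok, Prog.run, v8, v12, v13, v21, v21', x2]; omega
  obtain ⟨s3, hs3⟩ : ∃ s3, s3 = pairB.run s2 := ⟨_, rfl⟩
  have m3 : s3.mem = s2.mem := by simp [hs3, pairB, Prog.run]
  have fr3 : ∀ r < 60, r ≠ 21 → r ≠ 23 → r ≠ 25 → r ≠ 27 → s3.reg r = s2.reg r :=
    fun r hr h h' h'' h''' => by
      simp [hs3, pairB, Prog.run, h, h', h'', h''', show r ≠ 100 by omega, show r ≠ 101 by omega]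
  have b27 : s3.reg 27 = Q.length := by
    simp [hs3, pairB, Prog.run, v12, v13, v21, v21', x2]
  have b100 : s3.reg 100 = s.mem (s.reg 4 + (4 * X.length + 6)) := by
    simp [hs3, pairB, Prog.run, v12, v13, v21, v21', x1]
  have b101 : s3.reg 101 = 7 * Q.length := by
    simp [hs3, pairB, Prog.run, v8, v12, v13, v21, v21', x2]; omega
  rw [← hs3]; clear hs3
  have r33 : s3.reg 3 = s.reg 3 + 7 * P.length := by
    rw [fr3 3 (by omega) (by omega) (by omega) (by omega) (by omega), e1]
  refine Tri.seq ((copyProg_spec s3 (by omega) (by rw [b100, b101, r33]; omega)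
    (by rw [b101, r33]; omega)).mono (by omega) ?_)
  rintro s4 ⟨⟨g1, g2, g3⟩, f4⟩
  rw [r33, b101] at g1
  rw [r33, m3] at g2
  rw [r33, b101, b100, m3] at g3
  have fr4 : ∀ r < 60, r ≠ 3 → r ≠ 21 → r ≠ 23 → r ≠ 25 → r ≠ 27 → s4.reg r = s1.reg r :=
    fun r hr h0 h h' h'' h''' => by
      rw [f4 r (by omega) h0, fr3 r hr h h' h'' h''', f2 r (by omega) h0]
  have c27 : s4.reg 27 = Q.length := by rw [f4 _ (by omega) (by omega), b27]
  refine Tri.seq (Tri.run' (by simp [pairC, Prog.plain])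
    (by simp [pairC, Prog.ok, Prog.run, fr4, c27, a22]; omega) (by simp [pairC, Prog.cost]) ?_)
  obtain ⟨s5, hs5⟩ : ∃ s5, s5 = pairC.run s4 := ⟨_, rfl⟩
  have m5 : s5.mem = s4.mem := by simp [hs5, pairC, Prog.run]
  have fr5 : ∀ r < 42, s5.reg r = s4.reg r := fun r hr => by
    simp [hs5, pairC, Prog.run, show r ≠ 42 by omega, show r ≠ 43 by omega]
  have d42 : s5.reg 42 = s.reg 3 := by simp [hs5, pairC, Prog.run, fr4, a26]
  have d43 : s5.reg 43 = P.length + Q.length := by simp [hs5, pairC, Prog.run, fr4, a22, c27]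
  rw [← hs5]; clear hs5
  have r53 : s5.reg 3 = s.reg 3 + 7 * P.length + 7 * Q.length := by rw [fr5 _ (by omega), g1]
  have fr53 : ∀ r < 20, r ≠ 3 → s5.reg r = s.reg r := fun r h h' => by
    rw [fr5 r (by omega), fr4 r (by omega) h' (by omega) (by omega) (by omega) (by omega), fr1 r h]
  have g5 : Grow s s5 (7 * N) :=
    ⟨by omega, by omega, fun a ha => by rw [m5, g2 a (by omega), e2 a ha]⟩
  have d5 := hD.grow g5 (fr53 _ (by omega) (by omega)) (fr53 _ (by omega) (by omega))
  refine (setBlock_le hW j (X := X) (Y := [P, Q]) (Z := Z) (P := P ++ Q) (N := N) (L := L)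
    (by simpa using d5) (by simpa using hN) hj (by simp; omega) (by simp [hP0])
    ?_ ?_ ?_ (by simp [d43]) ?_ (by rw [stopL_append _ _ hQ0]; exact hs)
    (by rw [hU]; omega)).mono (by rw [hU]) ?_
  · rw [fr5 _ (by omega), fr4 _ (by omega) (by omega) (by omega) (by omega) (by omega) (by omega), a40]
  · rw [fr5 _ (by omega), fr4 _ (by omega) (by omega) (by omega) (by omega) (by omega) (by omega), a41]
    rfl
  · rw [d42, m5, List.map_append, Ents_append, List.length_map]
    refine ⟨p2.copy fun t ht => ?_, q2.copy fun t ht => ?_⟩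
    · rw [List.length_map] at ht
      rw [g2 _ (by omega), e3 t (by omega)]
    · rw [List.length_map] at ht
      rw [g3 t (by omega), e2 _ (by omega)]
  · rw [d42, r53]; simp; omega
  rw [hU]
  rintro s6 ⟨g6, d6, f6⟩
  exact ⟨(g5.trans g6).mono (by omega), by
    rw [f6 _ (by omega) (by omega) (by omega) (by omega), fr53 _ (by omega) (by omega)], d6⟩

def pairCost (j N L : ℕ) : ℕ := j * (N * 96 + 7) + 33 * L + 42 * N + 110

theorem joinPair_spec {W : ℕ} (hW : 7 < 2 ^ W) (j : ℕ) {s : NS} {H : ℕ → ℕ}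
    {N L w : ℕ} {Bs : List (List Piece)} (hD : Dir W s Bs) (hP : Part H N 0 w Bs)
    (hB0 : Bs ≠ []) (hw : w < 2 ^ W) (hj : N ≤ 2 ^ j) (hL : Bs.length ≤ L)
    (h6 : s.reg 6 = N) (hb : s.reg 3 + pairCost j N L < 2 ^ W) :
    Tri W joinPair s (pairCost j N L) fun s' => Grow s s' (pairCost j N L) ∧
      s'.reg 6 = N ∧ ∃ Bs', Dir W s' Bs' ∧ Part H N 0 w Bs' ∧ Bs' ≠ [] ∧
        Bs'.flatten.length = Bs.flatten.length ∧
        (Bs'.length + 1 = Bs.length ∨ Bs'.length = Bs.length ∧ Sparse N Bs') := by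
  have hW0 : W ≠ 0 := by rintro rfl; simp at hW
  have hle := hD.le
  have hcnt := hD.count
  unfold pairCost at *
  generalize hU : j * (N * 96 + 7) = U at *
  obtain ⟨P, Z, rfl⟩ := List.exists_cons_of_ne_nil hB0
  simp only [List.length_cons] at hle hL hcnt
  have p1 := hD.dir.1.size
  refine Tri.mono (T := 10 + (9 * L + 1 + (U + 24 * L + 90 + 42 * N + 1)))
    (Tri.seq (Tri.run' (by simp [pairInit, Prog.plain]) ?_ (by simp [pairInit, Prog.cost]) ?_))
    (by omega) fun _ h => h
  · simp [pairInit, Prog.ok, Prog.run, hcnt]; omega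
  obtain ⟨s1, hs1⟩ : ∃ s1, s1 = pairInit.run s := ⟨_, rfl⟩
  have m1 : s1.mem = s.mem := by simp [hs1, pairInit, Prog.run]
  have fr1 : ∀ r < 8, s1.reg r = s.reg r := fun r hr => by
    simp [hs1, pairInit, Prog.run, show r ≠ 8 by omega, show r ≠ 9 by omega, show r ≠ 10 by omega,
      show r ≠ 11 by omega, show r ≠ 12 by omega, show r ≠ 13 by omega, show r ≠ 14 by omega,
      show r ≠ 15 by omega, show r ≠ 16 by omega, show r ≠ 17 by omega]
  have a8 : s1.reg 8 = 7 := by simp [hs1, pairInit, Prog.run]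
  have a9 : s1.reg 9 = 0 := by simp [hs1, pairInit, Prog.run]
  have a10 : s1.reg 10 = 0 := by simp [hs1, pairInit, Prog.run]
  have a11 : s1.reg 11 = 0 := by simp [hs1, pairInit, Prog.run]
  have a12 : s1.reg 12 = 1 := by simp [hs1, pairInit, Prog.run]
  have a13 : s1.reg 13 = 4 := by simp [hs1, pairInit, Prog.run]
  have a14 : s1.reg 14 = s.reg 4 := by simp [hs1, pairInit, Prog.run]
  have a15 : s1.reg 15 = Z.length := by simp [hs1, pairInit, Prog.run, hcnt]
  have a17 : s1.reg 17 = P.length := by simp [hs1, pairInit, Prog.run, p1]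
  rw [← hs1]; clear hs1
  refine Tri.seq (((((pairLoop_spec (M := 2 ^ W) (n := s.reg 3) (N := N) Z P (s := s1)
    (by rw [m1, a14]; exact hD.dir) a17 (by rw [fr1 _ (by omega), h6]) a12 a13
    (by rw [a15, a10]; omega) (by omega) (fun Q hQ => (hP.size Q hQ).2) (by rw [a14]; omega)
    (by rw [a10]; omega)).frame_mem (by simp [pairLoop, pairBody, Prog.readOnly]))).frame).mono
    (by omega) ?_)
  rintro s2 ⟨⟨hres, m2⟩, f2⟩
  rw [a11, a10] at hres
  rw [m1] at m2
  have fr2 : ∀ r < 10, s2.reg r = s1.reg r := fun r hr =>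
    f2 r (by simp [pairLoop, pairBody, Prog.writes]; omega)
  have fr2' : ∀ r, r = 12 ∨ r = 13 → s2.reg r = s1.reg r := fun r hr =>
    f2 r (by simp [pairLoop, pairBody, Prog.writes]; omega)
  have g2 : Grow s s2 0 :=
    ⟨by rw [fr2 _ (by omega), fr1 _ (by omega)], by rw [fr2 _ (by omega), fr1 _ (by omega)]; omega,
      by simp [m2]⟩
  have d2 := hD.grow g2 (by rw [fr2 _ (by omega), fr1 _ (by omega)])
    (by rw [fr2 _ (by omega), fr1 _ (by omega)])
  rcases hres with ⟨e1, e2⟩ | ⟨X, P', Q', Z', e1, e2, e3⟩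
  · refine Tri.branch (fun h => ?_) fun _ => ?_
    · simp [Test.ev, e1] at h
    · refine (Tri.run (p := .skip) (by simp [Prog.plain]) (by simp [Prog.ok])
        (Q := fun s' => s' = s2) rfl).mono (by simp [Prog.cost]; omega) ?_
      rintro s' rfl
      exact ⟨g2.mono (by omega), by rw [fr2 _ (by omega), fr1 _ (by omega), h6], P :: Z, d2, hP,
        by simp, rfl, .inr ⟨rfl, e2⟩⟩
  · rw [e1] at d2 hP ⊢
    have hlen := congrArg List.length e1
    simp only [List.length_append, List.length_cons] at hlen
    have := g2.le'
    refine Tri.branch (fun _ => ?_) fun h => ?_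
    swap
    · simp [Test.ev, e2, fr2, a9] at h
    have hQ0 := (hP.size Q' (by simp)).1
    have hsQ : stopL Q' ≤ w := by
      obtain ⟨R, d, hR⟩ := (List.eq_nil_or_concat Q').resolve_left hQ0
      rw [hR, List.concat_eq_append, stopL_concat]
      exact hP.stop_lt Q' (by simp) d (by rw [hR]; simp)
    refine (pairJoin_spec hW j (L := L) d2 e3 hj (by omega) (hP.size P' (by simp)).1 hQ0
      (by rw [fr2 _ (by omega), a8]) (by rw [e2]; omega) (by rw [fr2' _ (by omega), a12])
      (by rw [fr2' _ (by omega), a13]) (by omega) (by rw [hU]; omega)).mono (by rw [hU]) ?_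
    rw [hU]
    rintro s3 ⟨g3, k6, d3⟩
    refine ⟨(g2.trans g3).mono (by omega), by rw [k6, fr2 _ (by omega), fr1 _ (by omega), h6], _, d3,
      ⟨by simpa using hP.tiles, fun R hR => ?_⟩, by simp, by simp, .inl (by simp; omega)⟩
    simp only [List.mem_append, List.mem_cons] at hR
    rcases hR with hR | rfl | hR
    · exact hP.size R (by simp [hR])
    · exact ⟨by simp [hQ0], by simpa using e3⟩
    · exact hP.size R (by simp [hR])

/-! ## Updates -/

def updateProg : Prog := dropProg ;; joinPair ;; joinPair

def updateCost (j N L : ℕ) : ℕ := dropCost j N L + 2 * pairCost j N L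

/-- The data structure represents the heights `H` on a board of width `w` by at most `K` pieces, in
blocks of at most `N` pieces, of which there are `O(K / N + 1)`. -/
structure Rep (W : ℕ) (s : NS) (H : ℕ → ℕ) (w N K : ℕ) (Bs : List (List Piece)) : Prop where
  dir : Dir W s Bs
  part : Part H N 0 w Bs
  ne_nil : Bs ≠ []
  size : s.reg 6 = N
  pieces : Bs.flatten.length ≤ K
  blocks : (Bs.length - 2) * N ≤ 2 * K

/-- A drop adds at most two blocks, and each call of `joinPair` removes one unless it finds no
suitable pair. If both calls remove one, the number of blocks has not grown and the old bound
persists. Otherwise one of the calls has met a sparse partition, for which `Sparse.length_le` yields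
the bound afresh from the current number of pieces. -/
theorem Rep.update {W : ℕ} (hW : 7 < 2 ^ W) (j : ℕ) {s : NS} {H : ℕ → ℕ}
    {N K L w x a b hm : ℕ} {Bs : List (List Piece)} (hR : Rep W s H w N K Bs)
    (hw : w < 2 ^ W) (hN : 0 < N) (hj : N ≤ 2 ^ j) (hL : Bs.length + 2 ≤ L)
    (h0 : s.reg 0 = x) (h1 : s.reg 1 = a) (h2 : s.reg 2 = b) (ha : 0 < a) (hxa : x + a ≤ w)
    (hH : ∀ j < w, H j ≤ hm) (hhm : hm + b < 2 ^ W)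
    (hb : s.reg 3 + updateCost j N L < 2 ^ W) :
    Tri W updateProg s (updateCost j N L) fun s' => Grow s s' (updateCost j N L) ∧
      ∃ Bs' m, Rep W s' (raise H x a (m + b)) w N (K + 2) Bs' ∧
        ∀ t, m ≤ t ↔ ∀ j, x ≤ j → j < x + a → H j ≤ t := by
  unfold updateCost at *
  have hbl := hR.blocks
  have hpc := hR.pieces
  refine Tri.mono (T := dropCost j N L + (pairCost j N L + pairCost j N L))
    (Tri.seq ((dropProg_spec hW j (L := L) hR.dir hR.part hR.ne_nil hw hN hj hL h0 h1 h2 ha hxa hH hhm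
      (by omega)).mono le_rfl ?_)) (by omega) fun _ h => h
  rintro s1 ⟨g1, r1, B1, m, d1, p1, n1, l1, l1', hm'⟩
  have := g1.le'
  refine Tri.seq ((joinPair_spec hW j (L := L) d1 p1 n1 hw hj (by omega) (by rw [r1, hR.size])
      (by omega)).mono le_rfl ?_)
  rintro s2 ⟨g2, r2, B2, d2, p2, n2, l2, l2'⟩
  have := g2.le'
  refine (joinPair_spec hW j (L := L) d2 p2 n2 hw hj (by omega) r2 (by omega)).mono le_rfl ?_
  rintro s3 ⟨g3, r3, B3, d3, p3, n3, l3, l3'⟩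
  refine ⟨((g1.trans g2).trans g3).mono (by omega), B3, m, ⟨d3, p3, n3, r3, by omega, ?_⟩, hm'⟩
  have key : ∀ B : List (List Piece), Sparse N B → B.flatten.length ≤ K + 2 → B3.length ≤ B.length + 1 →
      (B3.length - 2) * N ≤ 2 * (K + 2) := fun B hB hBl hl => by
    have h1 := hB.length_le
    have h2 : (B3.length - 2) * N ≤ (B.length - 1) * N := Nat.mul_le_mul_right _ (by omega)
    omega
  rcases l3' with l3' | ⟨l3', hS⟩
  · rcases l2' with l2' | ⟨l2', hS⟩
    · have : (B3.length - 2) * N ≤ (Bs.length - 2) * N := Nat.mul_le_mul_right _ (by omega)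
      omega
    · exact key B2 hS (by omega) (by omega)
  · exact key B3 hS (by omega) (by omega)

/-! ## Queries -/

def searchBody : Prog :=
  .op .add 24 22 23 ;; .op .div 25 24 15 ;; .op .mul 26 25 14 ;; .op .add 26 26 21 ;; .load 27 26 ;;
    .branch (.lt 10 27) (.move 23 25) (.op .add 22 25 13)

/-- Binary search for the number of entries at `reg 21` with key at most `reg 10`. -/
def searchLoop : Prog := .loop (.lt 22 23) searchBody

theorem Ents.entryAt {mem : ℕ → ℕ} {a : ℕ} {l : List Entry} (h : Ents mem a l) {t : ℕ}
    (ht : t < l.length) : EntryAt mem (a + 7 * t) l[t] := by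
  have e : l = l.take t ++ l[t] :: l.drop (t + 1) := by simp
  rw [e, Ents_append] at h
  have := h.2.1
  rwa [List.length_take, Nat.min_eq_left ht.le] at this

/-- Entries before `reg 22` have keys at most the threshold, those from `reg 23` on have larger
ones. Each round at least halves the number of undecided entries, so `k` rounds suffice for fewer
than `2 ^ k`. -/
theorem searchLoop_spec {W : ℕ} (k : ℕ) {s : NS} {o : List Entry} (ho : SortedE o)
    (hE : Ents s.mem (s.reg 21) o) (h13 : s.reg 13 = 1) (h14 : s.reg 14 = 7) (h15 : s.reg 15 = 2)
    (h23 : s.reg 23 ≤ o.length) (hle : s.reg 22 ≤ s.reg 23) (hk : s.reg 23 - s.reg 22 < 2 ^ k)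
    (h1 : ∀ (t : ℕ) (ht : t < o.length), t < s.reg 22 → (o[t]).1 ≤ s.reg 10)
    (h2 : ∀ (t : ℕ) (ht : t < o.length), s.reg 23 ≤ t → s.reg 10 < (o[t]).1)
    (hb : s.reg 21 + 7 * o.length < 2 ^ W) :
    Tri W searchLoop s (8 * k + 1) fun s' => s'.reg 22 ≤ o.length ∧
      (∀ (t : ℕ) (ht : t < o.length), t < s'.reg 22 → (o[t]).1 ≤ s.reg 10) ∧
      ∀ (t : ℕ) (ht : t < o.length), s'.reg 22 ≤ t → s.reg 10 < (o[t]).1 := by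
  induction k generalizing s with
  | zero =>
    have : s.reg 22 = s.reg 23 := by simp at hk; omega
    exact (Tri.loop_false (by simp [Test.ev]; omega) ⟨by omega, h1, by rwa [this]⟩).mono (by omega)
      fun _ h => h
  | succ k ih =>
    by_cases hlt : s.reg 22 < s.reg 23
    swap
    · have : s.reg 22 = s.reg 23 := by omega
      exact (Tri.loop_false (b := .lt 22 23) (s := s) hlt ⟨by omega, h1, by rwa [this]⟩).mono (by omega) fun _ h => h
    obtain ⟨m, hm⟩ : ∃ m, m = (s.reg 22 + s.reg 23) / 2 := ⟨_, rfl⟩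
    have hml : m < o.length := by omega
    have hent := (hE.entryAt hml).1
    rw [show s.reg 21 + 7 * m = m * 7 + s.reg 21 by ring] at hent
    have hmono : ∀ (t u : ℕ) (ht : t < o.length) (hu : u < o.length), t ≤ u →
        (o[t]).1 ≤ (o[u]).1 := fun t u ht hu htu => by
      rcases htu.eq_or_lt with rfl | h
      · exact le_rfl
      · exact List.pairwise_iff_getElem.1 ho t u ht hu h
    rw [pow_succ] at hk
    refine (Tri.loop_true (b := .lt 22 23) (s := s) (T₁ := 7) (T₂ := 8 * k + 1) hlt
      (Tri.run' (by simp [searchBody, Prog.plain]) ?_ (by simp [searchBody, Prog.cost]) ?_)).mono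
      (by omega) fun _ h => h
    · simp [searchBody, Prog.ok, Prog.run, h13, h14, h15, ← hm]; omega
    obtain ⟨s1, hs1⟩ : ∃ s1, s1 = searchBody.run s := ⟨_, rfl⟩
    have m1 : s1.mem = s.mem := by simp [hs1, searchBody, Prog.run]; split_ifs <;> rfl
    have fr : ∀ r < 22, s1.reg r = s.reg r := fun r hr => by
      simp [hs1, searchBody, Prog.run]; split_ifs <;>
      simp [show r ≠ 22 by omega, show r ≠ 23 by omega, show r ≠ 24 by omega, show r ≠ 25 by omega,
        show r ≠ 26 by omega, show r ≠ 27 by omega]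
    have hr : (s1.reg 22 = s.reg 22 ∧ s1.reg 23 = m ∧ s.reg 10 < (o[m]).1) ∨
        (s1.reg 22 = m + 1 ∧ s1.reg 23 = s.reg 23 ∧ (o[m]).1 ≤ s.reg 10) := by
      by_cases hx : s.reg 10 < (o[m]).1
      · simp [hs1, searchBody, Prog.run, Test.ev, h14, h15, ← hm, hent, hx]
      · simp [hs1, searchBody, Prog.run, Test.ev, h13, h14, h15, ← hm, hent, hx]; omega
    rw [← hs1]; clear hs1
    have f10 := fr 10 (by omega)
    refine (ih (s := s1) (by rw [m1, fr _ (by omega)]; exact hE) (by rw [fr _ (by omega), h13])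
      (by rw [fr _ (by omega), h14]) (by rw [fr _ (by omega), h15]) (by omega) (by omega) (by omega)
      (fun t ht h => ?_) (fun t ht h => ?_) (by rw [fr _ (by omega)]; exact hb)).mono le_rfl
      fun s' h => by rwa [f10] at h
    · rw [f10]
      rcases hr with ⟨e1, e2, e3⟩ | ⟨e1, e2, e3⟩
      · exact h1 t ht (by omega)
      · exact (hmono t m ht hml (by omega)).trans e3
    · rw [f10]
      rcases hr with ⟨e1, e2, e3⟩ | ⟨e1, e2, e3⟩
      · exact e3.trans_le (hmono m t hml ht (by omega))
      · exact h2 t ht (by omega)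

/-- The value in force is that of the last entry whose key is at most the threshold, and `V.zero` if
there is no such entry. -/
def fetch : Prog :=
  .branch (.eq 22 9)
    (.const 130 0 ;; .const 131 0 ;; .const 132 0 ;; .const 133 0 ;; .const 134 0 ;; .const 135 0)
    (.op .sub 24 22 13 ;; .op .mul 26 24 14 ;; .op .add 26 26 21 ;; .op .add 26 26 13 ;;
      .load 130 26 ;; .op .add 26 26 13 ;; .load 131 26 ;; .op .add 26 26 13 ;; .load 132 26 ;;
      .op .add 26 26 13 ;; .load 133 26 ;; .op .add 26 26 13 ;; .load 134 26 ;;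
      .op .add 26 26 13 ;; .load 135 26)

theorem fetch_spec {W : ℕ} {s : NS} {o : List Entry} {h : ℕ} (hE : Ents s.mem (s.reg 21) o)
    (h9 : s.reg 9 = 0) (h13 : s.reg 13 = 1) (h14 : s.reg 14 = 7) (h22 : s.reg 22 ≤ o.length)
    (h1 : ∀ (t : ℕ) (ht : t < o.length), t < s.reg 22 → (o[t]).1 ≤ h)
    (h2 : ∀ (t : ℕ) (ht : t < o.length), s.reg 22 ≤ t → h < (o[t]).1)
    (hb : s.reg 21 + 7 * o.length < 2 ^ W) :
    Tri W fetch s 16 fun s' => vreg s' 130 = ev V.zero o h := by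
  refine Tri.run' (by simp [fetch, Prog.plain]) ?_ (by simp [fetch, Prog.cost]) ?_
  · by_cases h0 : s.reg 22 = 0
    · simp [fetch, Prog.ok, Prog.run, Test.ev, h9, h0]
    · simp [fetch, Prog.ok, Prog.run, Test.ev, h9, h0, h13, h14]; omega
  · rw [ev_eq h22 h1 h2]
    by_cases h0 : s.reg 22 = 0
    · simp [fetch, Prog.run, Test.ev, h9, h0, vreg, V.zero]
    · have := hE.entryAt (t := s.reg 22 - 1) (by omega)
      rw [show s.reg 21 + 7 * (s.reg 22 - 1) = (s.reg 22 - 1) * 7 + s.reg 21 by ring] at this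
      obtain ⟨-, e1, e2, e3, e4, e5, e6⟩ := this
      simp [fetch, Prog.run, Test.ev, h9, h0, h13, h14, vreg, add_assoc] at e1 e2 e3 e4 e5 e6 ⊢
      ext <;> simp [*]

def queryStep : Prog :=
  (.op .add 28 11 13 ;; .load 23 28 ;; .op .add 28 28 15 ;; .load 21 28 ;; .const 22 0) ;;
    searchLoop ;; fetch ;; joinProg ;;
    (.move 120 140 ;; .move 121 141 ;; .move 122 142 ;; .move 123 143 ;; .move 124 144 ;;
      .move 125 145 ;; .op .add 11 11 16)

def queryLoop : Prog := .loop (.lt 11 12) queryStep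

def queryInit : Prog :=
  .move 10 0 ;; .move 11 4 ;; .const 16 4 ;; .op .mul 12 5 16 ;; .op .add 12 12 4 ;;
    .const 13 1 ;; .const 14 7 ;; .const 15 2 ;; .const 9 0 ;;
    .const 120 1 ;; .const 121 0 ;; .const 122 0 ;; .const 123 0 ;; .const 124 0 ;; .const 125 0

def queryProg : Prog := queryInit ;; queryLoop ;; .move 0 124 ;; .move 1 125

theorem queryProg_readOnly : queryProg.readOnly := by
  simp [queryProg, queryInit, queryLoop, queryStep, searchLoop, searchBody, fetch, joinProg,
    Prog.readOnly]

theorem queryProg_writes {r : ℕ} (hr : 2 ≤ r) (hr' : r < 9) : ¬ queryProg.writes r := by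
  simp [queryProg, queryInit, queryLoop, queryStep, searchLoop, searchBody, fetch, joinProg,
    Prog.writes]
  omega

theorem queryStep_spec {W : ℕ} (hW : 7 < 2 ^ W) (k : ℕ) {s : NS} {H : ℕ → ℕ} {P : List Piece}
    {n p q : ℕ} (hB : BlockAt (2 ^ W) s.mem n (s.reg 11) P) (hT : Tiles H p P q) (hq : q < 2 ^ W)
    (hk : P.length < 2 ^ k) (hn : n < 2 ^ W) (hG : Good H (s.reg 10) 0 p (vreg s 120))
    (h9 : s.reg 9 = 0) (h13 : s.reg 13 = 1) (h14 : s.reg 14 = 7) (h15 : s.reg 15 = 2)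
    (h16 : s.reg 16 = 4) (hb : s.reg 11 + 4 < 2 ^ W) :
    Tri W queryStep s (8 * k + 45) fun s' => Good H (s.reg 10) 0 q (vreg s' 120) ∧
      s'.reg 11 = s.reg 11 + 4 ∧ s'.mem = s.mem ∧
      ∀ r, r = 9 ∨ r = 10 ∨ 12 ≤ r ∧ r ≤ 16 → s'.reg r = s.reg r := by
  have key : Tri W queryStep s (8 * k + 45) fun s' => Good H (s.reg 10) 0 q (vreg s' 120) ∧
      s'.reg 11 = s.reg 11 + 4 := by
    obtain ⟨o, ho1, ho2⟩ := hB.summary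
    have hl : o.length = P.length := by rw [ho1.length_eq, List.length_map]
    have hsl := hB.summary_le
    have hsz := hB.size
    refine Tri.mono (T := 5 + (8 * k + 1 + (16 + (16 + 7)))) (Tri.seq (Tri.run'
      (by simp [Prog.plain]) ?_ (by simp [Prog.cost]) ?_)) (by omega) fun _ h => h
    · simp [Prog.ok, Prog.run, h13, h15]; omega
    generalize hs1 : Prog.run (.op .add 28 11 13 ;; .load 23 28 ;; .op .add 28 28 15 ;; .load 21 28 ;;
      .const 22 0) s = s1
    have m1 : s1.mem = s.mem := by simp [← hs1, Prog.run]
    have fr : ∀ r, (r < 20 ∨ 100 ≤ r) → s1.reg r = s.reg r := fun r hr => by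
      simp [← hs1, Prog.run, show r ≠ 21 by omega, show r ≠ 22 by omega, show r ≠ 23 by omega,
        show r ≠ 28 by omega]
    have a21 : s1.reg 21 = s.mem (s.reg 11 + 3) := by simp [← hs1, Prog.run, h13, h15]
    have a22 : s1.reg 22 = 0 := by simp [← hs1, Prog.run]
    have a23 : s1.reg 23 = P.length := by simp [← hs1, Prog.run, h13, hsz]
    clear hs1
    have hE1 : Ents s1.mem (s1.reg 21) o := by rw [m1, a21]; exact ho2
    refine Tri.seq ((((searchLoop_spec k ho1.sorted hE1 (by rw [fr _ (by omega), h13])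
      (by rw [fr _ (by omega), h14]) (by rw [fr _ (by omega), h15]) (by omega) (by omega) (by omega)
      (by omega) (by omega) (by omega)).frame_mem
      (by simp [searchLoop, searchBody, Prog.readOnly])).frame).mono le_rfl ?_)
    rintro s2 ⟨⟨⟨e1, e2, e3⟩, m2⟩, f2⟩
    have fr2 : ∀ r, (r < 22 ∨ 100 ≤ r) → s2.reg r = s1.reg r := fun r hr =>
      f2 r (by simp [searchLoop, searchBody, Prog.writes]; omega)
    rw [fr _ (by omega)] at e2 e3
    refine Tri.seq (((fetch_spec (o := o) (h := s.reg 10) (by rw [m2, fr2 _ (by omega)]; exact hE1)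
      (by rw [fr2 _ (by omega), fr _ (by omega), h9]) (by rw [fr2 _ (by omega), fr _ (by omega), h13])
      (by rw [fr2 _ (by omega), fr _ (by omega), h14]) e1 e2 e3
      (by rw [fr2 _ (by omega)]; omega)).frame).mono le_rfl ?_)
    rintro s3 ⟨e4, f3⟩
    have fr3 : ∀ r, (r < 20 ∨ 100 ≤ r ∧ r < 130) → s3.reg r = s.reg r := fun r hr => by
      rw [f3 r (by simp [fetch, Prog.writes]; omega), fr2 r (by omega), fr r (by omega)]
    have v3 : vreg s3 120 = vreg s 120 := by
      simp only [vreg]; ext <;> exact fr3 _ (by omega)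
    refine Tri.seq ((((joinProg_computes (by omega)).spec s3).frame).mono le_rfl ?_)
    rintro s4 ⟨e5, f4⟩
    have fr4 : ∀ r < 20, s4.reg r = s.reg r := fun r hr => by
      rw [f4 r fun h => by have := (joinProg_computes (W := W) (by omega)).writes r h; omega,
        fr3 r (by omega)]
    refine Tri.run' (by simp [Prog.plain]) ?_ (by simp [Prog.cost]) ?_
    · simp [Prog.ok, Prog.run, fr4, h16]; omega
    · rw [v3, e4] at e5
      have := hG.join (ho1.good (h := s.reg 10) hT hq) hq
      rw [← e5] at this
      exact ⟨by simpa [vreg, Prog.run] using this, by simp [Prog.run, fr4, h16]⟩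
  refine ((key.frame_mem ?_).frame).mono le_rfl fun s' ⟨⟨⟨e1, e2⟩, e3⟩, e4⟩ =>
    ⟨e1, e2, e3, fun r hr => e4 r ?_⟩
  · simp [queryStep, searchLoop, searchBody, fetch, joinProg, Prog.readOnly]
  · simp [queryStep, searchLoop, searchBody, fetch, joinProg, Prog.writes]
    omega

/-- Registers 120 to 125 describe the columns to the left of the current block. Each block is joined
to them on the right, so that runs across borders of blocks are found as well. -/
theorem queryLoop_spec {W : ℕ} (hW : 7 < 2 ^ W) (k : ℕ) {s : NS} {H : ℕ → ℕ}
    {Bs : List (List Piece)} {n p q : ℕ} (hD : DirAt (2 ^ W) s.mem n (s.reg 11) Bs)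
    (hT : Tiles H p Bs.flatten q) (hq : q < 2 ^ W) (hk : ∀ P ∈ Bs, P.length < 2 ^ k)
    (hn : n < 2 ^ W) (hG : Good H (s.reg 10) 0 p (vreg s 120)) (h9 : s.reg 9 = 0)
    (h12 : s.reg 12 = s.reg 11 + 4 * Bs.length) (h13 : s.reg 13 = 1) (h14 : s.reg 14 = 7)
    (h15 : s.reg 15 = 2) (h16 : s.reg 16 = 4) (hb : s.reg 11 + 4 * Bs.length < 2 ^ W) :
    Tri W queryLoop s (Bs.length * (8 * k + 46) + 1) fun s' =>
      Good H (s.reg 10) 0 q (vreg s' 120) := by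
  induction Bs generalizing s p with
  | nil =>
    simp only [List.flatten_nil, Tiles] at hT
    subst hT
    exact (Tri.loop_false (by simp [Test.ev, h12]) hG).mono (by simp) fun _ h => h
  | cons P Bs ih =>
    rw [List.flatten_cons, Tiles_append] at hT
    obtain ⟨r, hT1, hT2⟩ := hT
    have := hT2.le
    simp only [List.length_cons] at h12 hb ⊢
    refine (Tri.loop_true (T₁ := 8 * k + 45) (T₂ := Bs.length * (8 * k + 46) + 1)
      (by simp [Test.ev, h12]) ((queryStep_spec hW k hD.1 hT1 (by omega) (hk P (by simp)) hn hG
      h9 h13 h14 h15 h16 (by omega)).mono le_rfl ?_)).mono (by linarith) fun _ h => h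
    rintro s1 ⟨e1, e2, e3, e4⟩
    rw [← e4 10 (by omega)] at e1 ⊢
    exact ih (by rw [e2, e3]; exact hD.2) hT2 (fun P hP => hk P (by simp [hP])) e1
      (by rw [e4 _ (by omega), h9]) (by rw [e4 _ (by omega), h12, e2]; omega)
      (by rw [e4 _ (by omega), h13]) (by rw [e4 _ (by omega), h14]) (by rw [e4 _ (by omega), h15])
      (by rw [e4 _ (by omega), h16]) (by omega)

theorem Rep.query {W : ℕ} (hW : 7 < 2 ^ W) (k : ℕ) {s : NS} {H : ℕ → ℕ} {N K w : ℕ}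
    {Bs : List (List Piece)} (hR : Rep W s H w N K Bs) (hw : w < 2 ^ W) (hk : N < 2 ^ k)
    (hb : s.reg 3 < 2 ^ W) :
    Tri W queryProg s (Bs.length * (8 * k + 46) + 18) fun s' =>
      ∃ v, Good H (s.reg 0) 0 w v ∧ s'.reg 0 = v.b ∧ s'.reg 1 = v.bp := by
  have hle := hR.dir.le
  have hcnt := hR.dir.count
  have hW0 : W ≠ 0 := by rintro rfl; simp at hW
  refine Tri.mono (T := 15 + (Bs.length * (8 * k + 46) + 1 + 2)) (Tri.seq (Tri.run'
    (by simp [queryInit, Prog.plain]) ?_ (by simp [queryInit, Prog.cost]) ?_)) (by omega) fun _ h => h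
  · simp [queryInit, Prog.ok, Prog.run, hcnt]; omega
  -- The empty segment counts as full, with all lengths `0`.
  have hG : Good H (s.reg 0) 0 0 ⟨1, 0, 0, 0, 0, 0⟩ := by
    constructor <;> simp
  have h10 : (queryInit.run s).reg 10 = s.reg 0 := by simp [queryInit, Prog.run]
  refine Tri.seq ((queryLoop_spec hW k (H := H) (Bs := Bs) (n := s.reg 3) (p := 0) (q := w) ?_
    hR.part.tiles hw (fun P hP => (hR.part.size P hP).2.trans_lt hk) hb
    (by rw [h10]; simpa [queryInit, Prog.run, vreg] using hG) ?_ ?_ ?_ ?_ ?_ ?_ ?_).mono le_rfl ?_)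
  · simpa [queryInit, Prog.run] using hR.dir.dir
  any_goals simp [queryInit, Prog.run, hcnt]
  any_goals omega
  intro s1 h1
  exact Tri.run' (by simp [Prog.plain]) (by simp [Prog.ok]) (by simp [Prog.cost])
    ⟨_, h1, by simp [Prog.run, vreg], by simp [Prog.run, vreg]⟩

/-! ## The block size -/

/-- The least `B` with `n * log n ≤ B ^ 2`. -/
def blockSize (n : ℕ) : ℕ := Nat.sqrt (n * (Nat.log 2 n + 1) - 1) + 1

def logLoop : Prog := .loop (.lt 9 10) (.op .div 10 10 15 ;; .op .add 11 11 13)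

def sizeLoop : Prog := .loop (.lt 14 12) (.op .add 6 6 13 ;; .op .mul 14 6 6)

def sizeInit : Prog := .const 13 1 ;; .const 15 2 ;; .const 9 0 ;; .move 10 0 ;; .const 11 0

/-- Put the block size for the number in register `0` into register `6`. -/
def sizeProg : Prog :=
  sizeInit ;; logLoop ;; (.op .mul 12 0 11 ;; .const 6 1 ;; .const 14 1) ;; sizeLoop

/-- The number of halvings that lead to `0` is the number of binary digits, which is `k + 1` for
numbers from `2 ^ k` on and below `2 ^ (k + 1)`. -/
theorem logLoop_spec {W : ℕ} (k : ℕ) {s : NS} (h1 : 2 ^ k ≤ s.reg 10) (h2 : s.reg 10 < 2 ^ (k + 1))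
    (h9 : s.reg 9 = 0) (h13 : s.reg 13 = 1) (h15 : s.reg 15 = 2) (hb : s.reg 11 + (k + 1) < 2 ^ W) :
    Tri W logLoop s (3 * (k + 1) + 1) fun s' => s'.reg 11 = s.reg 11 + (k + 1) := by
  have hpos : 0 < s.reg 10 := (Nat.two_pow_pos k).trans_le h1
  induction k generalizing s with
  | zero =>
    have h10 : s.reg 10 = 1 := by omega
    refine (Tri.loop_true (b := .lt 9 10) (s := s) (T₁ := 2) (T₂ := 1) (by simp [Test.ev, h9, hpos])
      (Tri.run' (by simp [Prog.plain]) ?_ (by simp [Prog.cost])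
      (Tri.loop_false ?_ ?_))).mono (by omega) fun _ h => h
    · simp [Prog.ok, Prog.run, h13]; omega
    · simp [Prog.run, Test.ev, h9, h10, h15]
    · simp [Prog.run, h13]
  | succ k ih =>
    have e1 := pow_succ 2 k
    have e2 := pow_succ 2 (k + 1)
    refine (Tri.loop_true (b := .lt 9 10) (s := s) (T₁ := 2) (T₂ := 3 * (k + 1) + 1)
      (by simp [Test.ev, h9, hpos]) (Tri.run' (by simp [Prog.plain]) ?_ (by simp [Prog.cost])
      ((ih ?_ ?_ ?_ ?_ ?_ ?_ ?_).mono le_rfl ?_))).mono (by omega) fun _ h => h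
    · simp [Prog.ok, Prog.run, h13]; omega
    all_goals simp [Prog.run, h9, h13, h15]
    any_goals omega

/-- Counting upwards, the loop stops at the first number whose square reaches `X = s.reg 12`, which
is `Nat.sqrt (X - 1) + 1`. This takes `O(√(n log n))` steps, negligible within the construction. -/
theorem sizeLoop_spec {W : ℕ} (i : ℕ) {s : NS} (hX : 0 < s.reg 12)
    (h6 : s.reg 6 + i = Nat.sqrt (s.reg 12 - 1) + 1) (h14 : s.reg 14 = s.reg 6 * s.reg 6)
    (h13 : s.reg 13 = 1)
    (hb : (Nat.sqrt (s.reg 12 - 1) + 1) * (Nat.sqrt (s.reg 12 - 1) + 1) < 2 ^ W) :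
    Tri W sizeLoop s (3 * i + 1) fun s' => s'.reg 6 = Nat.sqrt (s.reg 12 - 1) + 1 := by
  induction i generalizing s with
  | zero =>
    refine Tri.loop_false ?_ h6
    simp only [Test.ev, h14]
    have := Nat.lt_succ_sqrt (s.reg 12 - 1)
    rw [Nat.succ_eq_add_one, ← h6, add_zero] at this
    omega
  | succ i ih =>
    have h1 : s.reg 6 * s.reg 6 ≤ s.reg 12 - 1 := Nat.le_sqrt.1 (by omega)
    have h2 : (s.reg 6 + 1) * (s.reg 6 + 1) ≤
      (Nat.sqrt (s.reg 12 - 1) + 1) * (Nat.sqrt (s.reg 12 - 1) + 1) :=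
      Nat.mul_le_mul (by omega) (by omega)
    have h3 := Nat.le_mul_self (s.reg 6 + 1)
    refine (Tri.loop_true (b := .lt 14 12) (s := s) (T₁ := 2) (T₂ := 3 * i + 1)
      (by simp only [Test.ev, h14]; omega) (Tri.run' (by simp [Prog.plain]) ?_ (by simp [Prog.cost])
      ((ih ?_ ?_ ?_ ?_ ?_).mono le_rfl ?_))).mono (by omega) fun _ h => h
    · simp [Prog.ok, Prog.run, h13]; omega
    all_goals simp [Prog.run, h13]
    any_goals omega

theorem sizeProg_spec {W : ℕ} (hW : 7 < 2 ^ W) {s : NS} {n : ℕ} (hn : 2 ≤ n) (h0 : s.reg 0 = n)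
    (hb : blockSize n * blockSize n < 2 ^ W) (hb' : n * (Nat.log 2 n + 1) < 2 ^ W) :
    Tri W sizeProg s (3 * (Nat.log 2 n + 1) + 3 * blockSize n + 10) fun s' =>
      (s'.reg 6 = blockSize n ∧ s'.mem = s.mem) ∧ ∀ r < 3, s'.reg r = s.reg r := by
  have hW0 : W ≠ 0 := by rintro rfl; simp at hW
  have key : Tri W sizeProg s (3 * (Nat.log 2 n + 1) + 3 * blockSize n + 10)
      fun s' => s'.reg 6 = blockSize n := by
    have hl := Nat.log_lt_self 2 (show n ≠ 0 by omega)
    have hl1 : Nat.log 2 n + 1 ≤ n * (Nat.log 2 n + 1) := Nat.le_mul_of_pos_left _ (by omega)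
    refine Tri.mono (T := 5 + (3 * (Nat.log 2 n + 1) + 1 + (3 + (3 * blockSize n + 1))))
      (Tri.seq (Tri.run' (by simp [sizeInit, Prog.plain]) ?_ (by simp [sizeInit, Prog.cost])
      (Tri.seq (((logLoop_spec (Nat.log 2 n) ?_ ?_ ?_ ?_ ?_ ?_).frame).mono le_rfl ?_))))
      (by omega) fun _ h => h
    · simp [sizeInit, Prog.ok, hW0]; omega
    · simpa [sizeInit, Prog.run, h0] using Nat.pow_log_le_self 2 (show n ≠ 0 by omega)
    · simpa [sizeInit, Prog.run, h0] using Nat.lt_pow_succ_log_self one_lt_two n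
    · simp [sizeInit, Prog.run]
    · simp [sizeInit, Prog.run]
    · simp [sizeInit, Prog.run]
    · simp [sizeInit, Prog.run]; omega
    rintro s1 ⟨e1, f1⟩
    have g0 : s1.reg 0 = n := by rw [f1 _ (by simp [logLoop, Prog.writes])]; simpa [sizeInit, Prog.run]
    have g13 : s1.reg 13 = 1 := by
      rw [f1 _ (by simp [logLoop, Prog.writes])]; simp [sizeInit, Prog.run]
    have g11 : s1.reg 11 = Nat.log 2 n + 1 := by simpa [sizeInit, Prog.run] using e1
    refine Tri.seq (Tri.run' (by simp [Prog.plain]) ?_ (by simp [Prog.cost])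
      ((sizeLoop_spec (blockSize n - 1) ?_ ?_ ?_ ?_ ?_).mono (by omega) ?_))
    · simp [Prog.ok, g0, g11, hW0]; omega
    all_goals simp [Prog.run, g0, g11, g13]
    · omega
    · simp [blockSize]; omega
    · exact hb
    · rintro s2 h; exact h
  refine ((key.frame_mem ?_).frame).mono le_rfl fun s' ⟨⟨h1, h2⟩, h3⟩ => ⟨⟨h1, h2⟩, fun r hr => h3 r ?_⟩
  · simp [sizeProg, sizeInit, logLoop, sizeLoop, Prog.readOnly]
  · simp [sizeProg, sizeInit, logLoop, sizeLoop, Prog.writes]; omega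

/-! ## The skyline of a list of rectangles -/

def RectsAt (mem : ℕ → ℕ) : ℕ → List Rect → Prop
  | _, [] => True
  | a, R :: L => (mem a = R.left ∧ mem (a + 1) = R.bottom ∧ mem (a + 2) = R.width ∧
      mem (a + 3) = R.height) ∧ RectsAt mem (a + 4) L

theorem RectsAt.congr {mem mem' : ℕ → ℕ} {a n : ℕ} {L : List Rect} (h : RectsAt mem a L)
    (hm : ∀ x < n, mem' x = mem x) (hn : a + 4 * L.length ≤ n) : RectsAt mem' a L := by
  induction L generalizing a with
  | nil => trivial
  | cons R L ih =>
    simp only [List.length_cons] at hn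
    obtain ⟨⟨h0, h1, h2, h3⟩, h4⟩ := h
    exact ⟨⟨(hm _ (by omega)).trans h0, (hm _ (by omega)).trans h1, (hm _ (by omega)).trans h2,
      (hm _ (by omega)).trans h3⟩, ih h4 (by omega)⟩

/-- The height of a rectangle as a step function. -/
def events : List Rect → List Entry
  | [] => []
  | R :: L => (R.left, ⟨0, R.top, 0, 0, 0, 0⟩) :: (R.right, V.zero) :: events L

theorem length_events (L : List Rect) : (events L).length = 2 * L.length := by
  induction L with
  | nil => rfl
  | cons R L ih => simp only [events, List.length_cons, ih]; omega

def eventBody : Prog :=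
  (.load 146 17 ;; .op .add 19 17 13 ;; .load 20 19 ;; .op .add 19 19 13 ;; .load 21 19 ;;
    .op .add 19 19 13 ;; .load 22 19 ;; .op .add 141 20 22) ;; emitEntry ;;
    (.op .add 146 146 21 ;; .const 141 0) ;; emitEntry ;; .op .add 17 17 16

def eventLoop : Prog := .loop (.lt 17 18) eventBody

def eventInit : Prog :=
  .const 13 1 ;; .const 16 4 ;; .const 150 1 ;; .const 140 0 ;; .const 142 0 ;; .const 143 0 ;;
    .const 144 0 ;; .const 145 0 ;; .const 17 0 ;; .op .mul 18 2 16 ;; .move 3 18 ;; .move 70 3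

def eventProg : Prog := eventInit ;; eventLoop

theorem eventBody_spec {W : ℕ} {s : NS} {R : Rect} {L : List Rect}
    (hR : RectsAt s.mem (s.reg 17) (R :: L)) (h3 : s.reg 17 + 4 ≤ s.reg 3)
    (h13 : s.reg 13 = 1) (h16 : s.reg 16 = 4) (h150 : s.reg 150 = 1)
    (hz : vreg s 140 = ⟨0, s.reg 141, 0, 0, 0, 0⟩) (h1 : R.right < 2 ^ W) (h2 : R.top < 2 ^ W)
    (hb : s.reg 3 + 14 < 2 ^ W) :
    Tri W eventBody s 39 fun s' => (Ents s'.mem (s.reg 3) (events [R]) ∧ s'.reg 3 = s.reg 3 + 14 ∧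
      s'.reg 17 = s.reg 17 + 4 ∧ (∀ a < s.reg 3, s'.mem a = s.mem a) ∧
      vreg s' 140 = ⟨0, s'.reg 141, 0, 0, 0, 0⟩) ∧
      ∀ r, ¬ eventBody.writes r → s'.reg r = s.reg r := by
  refine Tri.frame ?_
  obtain ⟨⟨r0, r1, r2, r3⟩, -⟩ := hR
  have hW0 : W ≠ 0 := by rintro rfl; simp at hb
  simp only [vreg, V.mk.injEq] at hz
  obtain ⟨z0, -, z2, z3, z4, z5⟩ := hz
  unfold Rect.right at h1
  unfold Rect.top at h2
  refine Tri.mono (T := 8 + (14 + (2 + (14 + 1)))) (Tri.seq (Tri.run' (by simp [Prog.plain]) ?_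
    (by simp [Prog.cost]) (Tri.seq ((emitEntry_spec ?_ ?_).mono le_rfl ?_)))) (by omega) fun _ h => h
  · simp [Prog.ok, Prog.run, h13, add_assoc, r1, r2, r3]; omega
  · simpa [Prog.run] using h150
  · simp [Prog.run]; omega
  rintro s1 ⟨⟨e1, e2, e3⟩, f1⟩
  simp [Prog.run, h13, add_assoc, r0, r1, r2, r3, z0, z2, z3, z4, z5, vreg] at e1 e2 e3
  have w1 : ∀ r, r = 21 ∨ r = 13 ∨ r = 16 ∨ r = 17 ∨ r = 150 ∨ r = 140 ∨ 142 ≤ r ∧ r ≤ 146 →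
      ¬ emitEntry.writes r := fun r hr => by
    simp [emitEntry, emitReg, Prog.writes]; omega
  have g := fun r hr => f1 r (w1 r hr)
  have g21 := g 21 (by omega)
  have g146 := g 146 (by omega)
  have g17 := g 17 (by omega)
  have g16 := g 16 (by omega)
  have g150 := g 150 (by omega)
  have g140 := g 140 (by omega)
  have g142 := g 142 (by omega)
  have g143 := g 143 (by omega)
  have g144 := g 144 (by omega)
  have g145 := g 145 (by omega)
  simp [Prog.run, h13, add_assoc, r0, r2, z0, z2, z3, z4, z5, h16, h150] at g21 g146 g17 g16 g150 g140 g142 g143 g144 g145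
  refine Tri.seq (Tri.run' (by simp [Prog.plain]) ?_ (by simp [Prog.cost])
    (Tri.seq ((emitEntry_spec ?_ ?_).mono le_rfl ?_)))
  · simp [Prog.ok, g146, g21]; omega
  · simpa [Prog.run] using g150
  · simp [Prog.run, e1]; omega
  rintro s2 ⟨⟨e4, e5, e6⟩, f2⟩
  simp [Prog.run, e1, g146, g21, vreg, g140, g142, g143, g144, g145] at e4 e5 e6
  have f := fun r hr => f2 r (w1 r hr)
  have k141 := f2 141 (by simp [emitEntry, emitReg, Prog.writes])
  have k17 := f 17 (by omega)
  have k16 := f 16 (by omega)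
  have k140 := f 140 (by omega)
  have k142 := f 142 (by omega)
  have k143 := f 143 (by omega)
  have k144 := f 144 (by omega)
  have k145 := f 145 (by omega)
  simp [Prog.run, g16, g17, g140, g142, g143, g144, g145] at k141 k17 k16 k140 k142 k143 k144 k145
  refine Tri.run' (by simp [Prog.plain]) ?_ (by simp [Prog.cost]) ?_
  · simp [Prog.ok, k16, k17]; omega
  refine ⟨⟨e3.copy fun t ht => ?_, ?_, trivial⟩, ?_, ?_, fun a ha => ?_, ?_⟩
  · simp only [Prog.run, NS.set_mem]
    exact e5 _ (by omega)
  · simpa [Prog.run, V.zero, Rect.right] using e6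
  · simp [Prog.run, e4]
  · simp [Prog.run, k16, k17]
  · simp only [Prog.run, NS.set_mem]
    rw [e5 _ (by omega), e2 _ ha]
  · simp [Prog.run, vreg, k140, k142, k143, k144, k145]

theorem eventLoop_spec {W : ℕ} (L : List Rect) {s : NS} (hR : RectsAt s.mem (s.reg 17) L)
    (h3 : s.reg 17 + 4 * L.length ≤ s.reg 3) (h18 : s.reg 18 = s.reg 17 + 4 * L.length)
    (h13 : s.reg 13 = 1) (h16 : s.reg 16 = 4) (h150 : s.reg 150 = 1)
    (hz : vreg s 140 = ⟨0, s.reg 141, 0, 0, 0, 0⟩) (h1 : ∀ R ∈ L, R.right < 2 ^ W)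
    (h2 : ∀ R ∈ L, R.top < 2 ^ W) (hb : s.reg 3 + 14 * L.length < 2 ^ W) :
    Tri W eventLoop s (40 * L.length + 1) fun s' => Ents s'.mem (s.reg 3) (events L) ∧
      s'.reg 3 = s.reg 3 + 14 * L.length ∧ ∀ a < s.reg 3, s'.mem a = s.mem a := by
  induction L generalizing s with
  | nil => exact Tri.loop_false (by simp [Test.ev, h18]) ⟨trivial, rfl, fun _ _ => rfl⟩
  | cons R L ih =>
    simp only [List.length_cons] at h3 h18 hb ⊢
    refine (Tri.loop_true (b := .lt 17 18) (T₁ := 39) (T₂ := 40 * L.length + 1)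
      (by simp [Test.ev, h18]) ((eventBody_spec hR (by omega) h13 h16 h150 hz (h1 R (by simp))
      (h2 R (by simp)) (by omega)).mono le_rfl ?_)).mono (by omega) fun _ h => h
    rintro s1 ⟨⟨e1, e2, e3, e4, e5⟩, f⟩
    have f' : ∀ r, r = 18 ∨ r = 13 ∨ r = 16 ∨ r = 150 → s1.reg r = s.reg r := fun r hr => f r (by
      simp [eventBody, emitEntry, emitReg, Prog.writes]; omega)
    refine (ih (by rw [e3]; exact hR.2.congr e4 (by omega)) (by omega)
      (by rw [f' _ (by omega)]; omega) (by rw [f' _ (by omega), h13]) (by rw [f' _ (by omega), h16])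
      (by rw [f' _ (by omega), h150]) e5 (fun R hR => h1 R (by simp [hR]))
      (fun R hR => h2 R (by simp [hR])) (by omega)).mono le_rfl ?_
    rintro s2 ⟨k1, k2, k3⟩
    rw [e2] at k1 k3
    refine ⟨(Ents_append (l := events [R])).2 ⟨e1.congr (n := s.reg 3 + 14) k3 (by simp [events]), ?_⟩,
      by omega, fun a ha => by rw [k3 a (by omega), e4 a ha]⟩
    simpa [events] using k1

/-- With `r = L.length`, the input occupies the first `4 * r` cells, free memory begins behind it,
and the `2 * r` entries for left and right borders take another `14 * r` words. -/
theorem eventProg_spec {W : ℕ} (hW : 7 < 2 ^ W) {L : List Rect} {s : NS} (hR : RectsAt s.mem 0 L)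
    (hr2 : s.reg 2 = L.length) (h1 : ∀ R ∈ L, R.right < 2 ^ W)
    (h2 : ∀ R ∈ L, R.top < 2 ^ W) (hb : 18 * L.length < 2 ^ W) :
    Tri W eventProg s (40 * L.length + 13) fun s' => (Ents s'.mem (s'.reg 70) (events L) ∧
      s'.reg 70 + 14 * L.length = s'.reg 3 ∧ s'.reg 3 = 18 * L.length) ∧
      ∀ r < 13, r ≠ 3 → s'.reg r = s.reg r := by
  have hW0 : W ≠ 0 := by rintro rfl; simp at hW
  have w : ∀ r, ¬ (eventLoop).writes r ∨ r = 3 ∨ 17 ≤ r := fun r => by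
    simp [eventLoop, eventBody, emitEntry, emitReg, Prog.writes]; omega
  refine (Tri.seq (T₁ := 12) (Tri.run' (by simp [eventInit, Prog.plain]) ?_ (by simp [eventInit, Prog.cost])
    (((eventLoop_spec L ?_ ?_ ?_ ?_ ?_ ?_ ?_ h1 h2 ?_).frame).mono le_rfl ?_))).mono (by omega)
    fun _ h => h
  · simp [eventInit, Prog.ok, Prog.run, hr2, hW0]; omega
  · simpa [eventInit, Prog.run] using hR
  any_goals simp [eventInit, Prog.run, hr2, vreg]
  any_goals omega
  intro s' e1 e2 e3 f
  have e70 := f 70 (by simp [eventLoop, eventBody, emitEntry, emitReg, Prog.writes])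
  simp at e70
  refine ⟨⟨by rwa [e70], by omega, by omega⟩, fun r hr h3 => ?_⟩
  rw [f r ((w r).resolve_right (by omega))]
  simp [h3, show r ≠ 70 by omega, show r ≠ 18 by omega, show r ≠ 17 by omega,
    show r ≠ 145 by omega, show r ≠ 144 by omega, show r ≠ 143 by omega, show r ≠ 142 by omega,
    show r ≠ 140 by omega, show r ≠ 150 by omega, show r ≠ 16 by omega, show r ≠ 13 by omega]

/-! ### Pieces of the skyline -/

/-- Only the slot `p` of a value is in use, for the height of the skyline. In this disguise skylines
can be merged by the program that builds the tables of blocks. -/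
def maxV (x y : V) : V := ⟨0, max x.p y.p, 0, 0, 0, 0⟩

def maxComb : Prog :=
  .const 140 0 ;; .const 142 0 ;; .const 143 0 ;; .const 144 0 ;; .const 145 0 ;;
    .branch (.lt 121 131) (.move 141 131) (.move 141 121)

theorem maxComb_computes (W : ℕ) : Computes W maxComb maxV 7 where
  spec s := by
    refine (Tri.runMod (by simp [maxComb, Prog.plain]) s).mono (by simp [maxComb, Prog.cost]) ?_
    rintro s' rfl
    by_cases h : s.reg 121 < s.reg 131
    · simp [maxComb, Prog.runMod, Test.ev, h, vreg, maxV, h.le]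
    · simp [maxComb, Prog.runMod, Test.ev, h, vreg, maxV, not_lt.1 h]
  readOnly := by simp [maxComb, Prog.readOnly]
  writes r h := by
    simp [maxComb, Prog.writes] at h
    omega

/-- A list of step functions with a single step of positive width, like `events`. -/
def Paired : List Entry → Prop
  | [] => True
  | [_] => False
  | a :: b :: l => (a.1 ≤ b.1 ∧ b.2 = V.zero) ∧ Paired l

def pairedMax (k : ℕ) : List Entry → ℕ
  | [] => 0
  | [_] => 0
  | a :: b :: l => max (if a.1 ≤ k ∧ k < b.1 then a.2.p else 0) (pairedMax k l)

/-- A prefix of even length does not separate the two entries of a rectangle. -/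
theorem Paired.of_append {l l' : List Entry} (h : Paired (l ++ l')) (hl : 2 ∣ l.length) :
    Paired l ∧ Paired l' ∧ ∀ k, pairedMax k (l ++ l') = max (pairedMax k l) (pairedMax k l') := by
  induction l using Paired.induct with
  | case1 => exact ⟨trivial, h, by simp [pairedMax]⟩
  | case2 => simp at hl
  | case3 a b l ih =>
    obtain ⟨h1, h2⟩ := h
    obtain ⟨i1, i2, i3⟩ := ih h2 (by simp only [List.length_cons] at hl; omega)
    exact ⟨⟨h1, i1⟩, i2, fun k => by simp [pairedMax, i3, max_assoc]⟩

theorem Tree.dvd_length {f : V → V → V} {k : ℕ} {l o : List Entry} (h : Tree f k l o) :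
    k ∣ l.length := by
  induction h with
  | base h => exact h ▸ dvd_rfl
  | node _ _ ih₁ ih₂ => rw [List.length_append]; exact dvd_add ih₁ ih₂

/-- A chunk of two entries is the step function of a single rectangle. It is already sorted, since a
left border does not lie beyond the right one, so the sort may start with chunks of length 2. By
`ev_mergeE` each merge is a pointwise maximum. -/
theorem Tree.skyline {l o : List Entry} (h : Tree maxV 2 l o) (hl : Paired l) :
    SortedE o ∧ ∀ k, (ev V.zero o k).p = pairedMax k l := by
  induction h with
  | @base l h =>
    match l, h, hl with
    | [a, b], _, hl =>
      obtain ⟨⟨h1, h2⟩, -⟩ := hl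
      refine ⟨by simpa [SortedE] using h1, fun k => ?_⟩
      by_cases ha : a.1 ≤ k <;> by_cases hb : b.1 ≤ k <;>
        simp [ev, pairedMax, ha, hb, h2, V.zero]
  | node t₁ t₂ ih₁ ih₂ =>
    obtain ⟨i1, i2, i3⟩ := hl.of_append t₁.dvd_length
    obtain ⟨a1, a2⟩ := ih₁ i1
    obtain ⟨b1, b2⟩ := ih₂ i2
    refine ⟨a1.mergeE b1, fun k => ?_⟩
    have hz : V.zero = maxV V.zero V.zero := by simp [maxV, V.zero]
    rw [i3, ← a2, ← b2]
    conv_lhs => rw [show ev V.zero = ev (maxV V.zero V.zero) by rw [← hz], ev_mergeE]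
    rfl

theorem paired_events (L : List Rect) : Paired (events L) := by
  induction L with
  | nil => trivial
  | cons R L ih => exact ⟨⟨Nat.le_add_right _ _, rfl⟩, ih⟩

/-- The height of the skyline above the column between `j` and `j + 1`. -/
def sky (S : Finset Rect) (j : ℕ) : ℕ := (S.filter fun R => R.left ≤ j ∧ j < R.right).sup Rect.top

theorem pairedMax_events (L : List Rect) (k : ℕ) : pairedMax k (events L) = sky L.toFinset k := by
  induction L with
  | nil => rfl
  | cons R L ih =>
    rw [events, pairedMax, ih, sky, sky, List.toFinset_cons, Finset.filter_insert]
    split_ifs with h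
    · rw [Finset.sup_insert]
    · simp

/-- The pieces, from `x` to `w`, of a step function with current value `h`. -/
def skyPieces (w : ℕ) : ℕ → ℕ → List Entry → List Piece
  | x, h, [] => [mkPiece x (w - x) h]
  | x, h, e :: E => mkPiece x (e.1 - x) h :: skyPieces w e.1 e.2.p E

theorem length_skyPieces (w x h : ℕ) (E : List Entry) : (skyPieces w x h E).length = E.length + 1 := by
  induction E generalizing x h with
  | nil => rfl
  | cons e E ih => simp [skyPieces, ih]

/-- Entries with equal keys produce empty pieces between them; the last of them determines the
height that follows, in agreement with `ev`. -/
theorem tiles_skyPieces {H : ℕ → ℕ} {w x : ℕ} {c : V} {E : List Entry} (hE : SortedE E)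
    (hx : ∀ e ∈ E, x ≤ e.1) (hw : ∀ e ∈ E, e.1 ≤ w) (hxw : x ≤ w)
    (hH : ∀ j, x ≤ j → j < w → H j = (ev c E j).p) : Tiles H x (skyPieces w x c.p E) w := by
  induction E generalizing x c with
  | nil =>
    refine ⟨rfl, fun j a b => ?_, by simp +contextual [mkPiece], by simp [Tiles, mkPiece, Piece.stopAt, hxw]⟩
    simp only [mkPiece, Piece.stopAt] at b ⊢
    rw [if_neg (by omega), hH j a (by omega)]
    rfl
  | cons e E ih =>
    have h1 := hx e (by simp)
    have h2 := hw e (by simp)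
    rw [SortedE, List.pairwise_cons] at hE
    have hs : (mkPiece x (e.1 - x) c.p).stopAt = e.1 := by simp [mkPiece, Piece.stopAt]; omega
    refine ⟨rfl, fun j a b => ?_, by simp +contextual [mkPiece], ?_⟩
    · rw [hs] at b
      rw [hH j a (by omega), ev, if_neg (by omega)]
      simp only [mkPiece]
      rw [if_neg (by omega)]
    · rw [hs]
      refine ih hE.2 hE.1 (fun e he => hw e (by simp [he])) h2 fun j a b => ?_
      rw [hH j (by omega) b, ev, if_pos a]

def pieceBody : Prog :=
  (.load 34 30 ;; .move 60 32 ;; .op .sub 61 34 32 ;; .move 62 33) ;; emitLeaf ;;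
    (.move 32 34 ;; .op .add 36 30 38 ;; .load 33 36 ;; .op .add 30 30 35)

def pieceStep : Prog := .loop (.lt 30 31) pieceBody

def pieceLast : Prog := (.move 60 32 ;; .op .sub 61 1 32 ;; .move 62 33) ;; emitLeaf

def pieceInit : Prog :=
  .move 30 70 ;; .op .add 23 2 2 ;; .const 35 7 ;; .op .mul 31 23 35 ;; .op .add 31 31 30 ;;
    .const 32 0 ;; .const 33 0 ;; .const 38 2 ;; .move 20 3 ;; .const 13 1 ;; .op .add 21 23 13

def pieceProg : Prog := pieceInit ;; pieceStep ;; pieceLast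

theorem emitLeaf_writes {r : ℕ} (hr : r < 62) (h3 : r ≠ 3) : ¬ emitLeaf.writes r := by
  simp [emitLeaf, emitReg, Prog.writes]; omega

/-- The postcondition of the loop is that `pieceLast` completes the list. The final piece, which
reaches to the right border of the board, is the value of `skyPieces` on the empty list, and so the
induction over the entries can include it. -/
theorem pieceStep_spec {W : ℕ} (hW : 7 < 2 ^ W) (E : List Entry) {s : NS}
    (hE : Ents s.mem (s.reg 30) E) (hE3 : s.reg 30 + 7 * E.length ≤ s.reg 3)
    (h31 : s.reg 31 = s.reg 30 + 7 * E.length) (h35 : s.reg 35 = 7) (h38 : s.reg 38 = 2)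
    (hs : SortedE E) (hx : ∀ e ∈ E, s.reg 32 ≤ e.1) (hw : ∀ e ∈ E, e.1 ≤ s.reg 1)
    (hxw : s.reg 32 ≤ s.reg 1) (hb : s.reg 3 + 7 * (E.length + 1) < 2 ^ W) :
    Tri W pieceStep s (27 * E.length + 1) fun s₁ => Tri W pieceLast s₁ 21 fun s' =>
      Ents s'.mem (s.reg 3) ((skyPieces (s.reg 1) (s.reg 32) (s.reg 33) E).map leaf) ∧
      s'.reg 3 = s.reg 3 + 7 * (E.length + 1) ∧ ∀ a < s.reg 3, s'.mem a = s.mem a := by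
  induction E generalizing s with
  | nil =>
    refine Tri.loop_false (by simp [Test.ev, h31]) (Tri.mono (T := 3 + 18) (Tri.seq (Tri.run'
      (by simp [Prog.plain]) ?_ (by simp [Prog.cost]) ((emitLeaf_spec (by omega) ?_).mono
      le_rfl ?_))) le_rfl fun _ h => h)
    · simpa [Prog.ok, Prog.run] using hxw
    · simp [Prog.run]; simpa using hb
    · rintro s' ⟨⟨e1, e2, e3⟩, -⟩
      simp [Prog.run] at e1 e2 e3
      exact ⟨⟨e3, trivial⟩, by simpa using e1, e2⟩
  | cons e E ih =>
    simp only [List.length_cons] at hE3 h31 hb ⊢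
    have hx0 := hx e (by simp)
    have hw0 := hw e (by simp)
    rw [SortedE, List.pairwise_cons] at hs
    obtain ⟨⟨k0, -, k2, -⟩, hE⟩ := hE
    refine (Tri.loop_true (b := .lt 30 31) (T₁ := 4 + (18 + 4)) (T₂ := 27 * E.length + 1)
      (by simp [Test.ev, h31]) (Tri.seq (Tri.run' (by simp [Prog.plain]) ?_ (by simp [Prog.cost])
      (Tri.seq ((emitLeaf_spec (by omega) ?_).mono le_rfl ?_))))).mono (by omega) fun _ h => h
    · simp [Prog.ok, Prog.run, k0]; omega
    · simp [Prog.run]; omega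
    rintro s1 ⟨⟨e1, e2, e3⟩, f1⟩
    simp [Prog.run, k0] at e1 e2 e3
    have g := fun r (hr : r < 60) (h3 : r ≠ 3) => f1 r (emitLeaf_writes (by omega) h3)
    have g34 := g 34 (by omega) (by omega)
    have g30 := g 30 (by omega) (by omega)
    have g31 := g 31 (by omega) (by omega)
    have g35 := g 35 (by omega) (by omega)
    have g38 := g 38 (by omega) (by omega)
    have g1 := g 1 (by omega) (by omega)
    simp [Prog.run, k0] at g34 g30 g31 g35 g38 g1
    have k2' : s1.mem (s.reg 30 + 2) = e.2.p := by rw [e2 _ (by omega), k2]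
    refine Tri.run' (by simp [Prog.plain]) ?_ (by simp [Prog.cost]) ((ih ?_ ?_ ?_ ?_ ?_ hs.2 ?_ ?_ ?_
      ?_).mono le_rfl fun s2 h2 => h2.mono le_rfl ?_)
    · simp [Prog.ok, Prog.run, g30, g35, g38, h35, h38]; omega
    · simpa [Prog.run, g30, g35, h35] using
        hE.congr e2 (by omega)
    all_goals simp [Prog.run, g30, g31, g34, g35, g38, g1, h35, h38, e1, h31, k2']
    any_goals omega
    · simpa using hs.1
    · simpa using fun a b hab => hw (a, b) (by simp [hab])
    intro s3 p1 p2 p3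
    refine ⟨⟨e3.copy fun t ht => p3 _ (by omega), p1⟩, by omega, fun a ha => ?_⟩
    rw [p3 a (by omega), e2 a ha]

theorem pieceProg_spec {W : ℕ} (hW : 7 < 2 ^ W) {E : List Entry} {s : NS}
    (hE : Ents s.mem (s.reg 70) E) (hE3 : s.reg 70 + 7 * E.length ≤ s.reg 3)
    (h2 : s.reg 2 + s.reg 2 = E.length) (hs : SortedE E) (hw : ∀ e ∈ E, e.1 ≤ s.reg 1)
    (hb : s.reg 3 + 7 * (E.length + 1) < 2 ^ W) :
    Tri W pieceProg s (27 * E.length + 33) fun s' =>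
      (Ents s'.mem (s'.reg 20) ((skyPieces (s.reg 1) 0 0 E).map leaf) ∧
      s'.reg 20 + 7 * (E.length + 1) = s'.reg 3 ∧ s'.reg 3 = s.reg 3 + 7 * (E.length + 1) ∧
      s'.reg 21 = E.length + 1 ∧ s'.reg 13 = 1) ∧ s'.reg 6 = s.reg 6 := by
  have hW0 : W ≠ 0 := by rintro rfl; simp at hW
  have key : Tri W pieceProg s (27 * E.length + 33) fun s' =>
      Ents s'.mem (s.reg 3) ((skyPieces (s.reg 1) 0 0 E).map leaf) ∧
      s'.reg 3 = s.reg 3 + 7 * (E.length + 1) ∧ s'.reg 20 = s.reg 3 ∧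
      s'.reg 21 = E.length + 1 ∧ s'.reg 13 = 1 := by
    refine Tri.mono (T := 11 + (27 * E.length + 1 + 21)) (Tri.seq (Tri.run'
      (by simp [pieceInit, Prog.plain]) ?_ (by simp [pieceInit, Prog.cost])
      (Tri.seq (((pieceStep_spec hW E ?_ ?_ ?_ ?_ ?_ hs ?_ ?_ ?_ ?_).frame).mono le_rfl
      fun s1 ⟨h1, f1⟩ => (h1.frame).mono le_rfl ?_)))) (by omega) fun _ h => h
    · simp [pieceInit, Prog.ok, Prog.run, h2, hW0]; omega
    any_goals simp [pieceInit, Prog.run, h2]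
    any_goals omega
    any_goals first | exact hE | simpa using hw
    intro s2 e1 e2 e3 f2
    have g : ∀ r, r = 20 ∨ r = 21 ∨ r = 13 → s2.reg r = (pieceInit.run s).reg r := fun r hr => by
      rw [f2 r (by simp [pieceLast, emitLeaf, emitReg, Prog.writes]; omega),
        f1 r (by simp [pieceStep, pieceBody, emitLeaf, emitReg, Prog.writes]; omega)]
    refine ⟨e1, e2, ?_, ?_, ?_⟩ <;> rw [g _ (by omega)] <;> simp [pieceInit, Prog.run, h2]
  refine (key.frame).mono le_rfl ?_
  rintro s' ⟨⟨e1, e2, e3, e4, e5⟩, f⟩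
  exact ⟨⟨by rwa [e3], by omega, e2, e4, e5⟩, f 6 (by
    simp [pieceProg, pieceInit, pieceStep, pieceBody, pieceLast, emitLeaf, emitReg, Prog.writes])⟩

/-! ### Cutting into blocks -/

def chunkBody : Prog :=
  (.move 22 6 ;; .branch (.lt 21 6) (.move 22 21) .skip ;; .move 40 5 ;; .move 41 5 ;; .move 42 20 ;;
    .move 43 22 ;; .op .mul 23 22 14 ;; .op .add 20 20 23 ;; .op .sub 21 21 22) ;; setBlock

def chunkLoop : Prog := .loop (.lt 9 21) chunkBody

def chunkProg : Prog := (.const 14 7 ;; .const 9 0 ;; .move 4 3 ;; .const 5 0) ;; chunkLoop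

/-- All blocks but the last get `N` pieces, whence the bound on their number. Each new block has the
whole directory copied, so `m` rounds cost `m * L` up to a constant, in addition to the `m` tables.
-/
theorem chunkLoop_spec {W : ℕ} (hW : 7 < 2 ^ W) (j N L m : ℕ) {s : NS} {X : List (List Piece)}
    {P : List Piece} (hN : 0 < N) (hj : N ≤ 2 ^ j) (hD : Dir W s X) (hX : X.length + m ≤ L)
    (hm : P.length ≤ m * N) (hE : Ents s.mem (s.reg 20) (P.map leaf))
    (hE3 : s.reg 20 + 7 * P.length ≤ s.reg 3) (h6 : s.reg 6 = N) (h21 : s.reg 21 = P.length)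
    (h9 : s.reg 9 = 0) (h14 : s.reg 14 = 7) (hend : ∀ c ∈ P, c.stopAt < 2 ^ W)
    (hb : s.reg 3 + m * (j * (N * 96 + 7) + 24 * L + 60) < 2 ^ W) :
    Tri W chunkLoop s (m * (j * (N * 96 + 7) + 24 * L + 72) + 1) fun s' =>
      s'.reg 3 ≤ s.reg 3 + m * (j * (N * 96 + 7) + 24 * L + 60) ∧ s'.reg 6 = N ∧
      ∃ Y, Dir W s' (X ++ Y) ∧ Y.flatten = P ∧ (∀ Q ∈ Y, Q ≠ [] ∧ Q.length ≤ N) ∧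
        (Y.length - 1) * N ≤ P.length := by
  generalize hU : j * (N * 96 + 7) + 24 * L + 60 = U at *
  induction m generalizing s X P with
  | zero =>
    have hP : P = [] := List.eq_nil_of_length_eq_zero (by omega)
    subst hP
    exact (Tri.loop_false (by simp [Test.ev, h9, h21]) ⟨by omega, h6, [], by simpa using hD, rfl,
      by simp, by simp⟩).mono (by omega) fun _ h => h
  | succ m ih =>
    by_cases hP : P = []
    · subst hP
      exact (Tri.loop_false (by simp [Test.ev, h9, h21]) ⟨by omega, h6, [], by simpa using hD, rfl,
        by simp, by simp⟩).mono (by omega) fun _ h => h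
    have hPl := List.length_pos_of_ne_nil hP
    rw [add_mul, one_mul] at hm hb
    obtain ⟨k, hk⟩ : ∃ k, k = min N P.length := ⟨_, rfl⟩
    have hcnt := hD.count
    refine (Tri.loop_true (b := .lt 9 21) (s := s) (T₁ := 10 + U)
      (T₂ := m * (j * (N * 96 + 7) + 24 * L + 72) + 1) (by simp [Test.ev, h9, h21, hPl]) (Tri.seq
      (Tri.run' (by simp [Prog.plain]) ?_ (by simp [Prog.cost]) ?_))).mono
      (by rw [add_mul]; omega) fun _ h => h
    · by_cases h : P.length < N
      · simp [Prog.ok, Prog.run, Test.ev, h6, h14, h21, h]; omega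
      · simp [Prog.ok, Prog.run, Test.ev, h6, h14, h21, h]; omega
    generalize hs1 : Prog.run (.move 22 6 ;; .branch (.lt 21 6) (.move 22 21) .skip ;; .move 40 5 ;;
      .move 41 5 ;; .move 42 20 ;; .move 43 22 ;; .op .mul 23 22 14 ;; .op .add 20 20 23 ;;
      .op .sub 21 21 22) s = s1
    have m1 : s1.mem = s.mem := by rw [← hs1]; simp [Prog.run]; split_ifs <;> rfl
    have fr : ∀ r < 20, s1.reg r = s.reg r := fun r hr => by
      rw [← hs1]
      by_cases h : P.length < N <;>
      simp [Prog.run, Test.ev, h6, h21, h, show r ≠ 20 by omega, show r ≠ 21 by omega, show r ≠ 22 by omega, show r ≠ 23 by omega,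
        show r ≠ 40 by omega, show r ≠ 41 by omega, show r ≠ 42 by omega, show r ≠ 43 by omega]
    have hv : s1.reg 40 = X.length ∧ s1.reg 41 = X.length ∧ s1.reg 42 = s.reg 20 ∧ s1.reg 43 = k ∧
        s1.reg 20 = s.reg 20 + 7 * k ∧ s1.reg 21 = P.length - k := by
      rw [← hs1]
      by_cases h : P.length < N
      · simp [Prog.run, Test.ev, h6, h14, h21, h, hcnt, hk, h.le]; omega
      · simp [Prog.run, Test.ev, h6, h14, h21, h, hcnt, hk, not_lt.1 h]; omega
    clear hs1
    obtain ⟨v1, v2, v3, v4, v5, v6⟩ := hv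
    have hsplit : P.take k ++ P.drop k = P := List.take_append_drop k P
    have l1 : (P.take k).length = k := by rw [List.length_take]; omega
    have l2 : (P.drop k).length = P.length - k := List.length_drop
    have hT : P.take k ≠ [] := List.ne_nil_of_length_pos (by omega)
    have hE' := hE
    rw [← hsplit, List.map_append, Ents_append, List.length_map, l1] at hE'
    have g1 : Grow s s1 0 := ⟨by rw [fr _ (by omega)], by rw [fr _ (by omega)]; omega, by simp [m1]⟩
    refine (setBlock_le hW j (X := X) (Y := []) (Z := []) (P := P.take k) (N := N) (L := L)
      (by simpa using hD.grow g1 (fr _ (by omega)) (fr _ (by omega))) (by omega) hj (by simp; omega) hT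
      v1 v2 (by rw [v3, m1]; exact hE'.1) (by rw [v4, l1])
      (by rw [v3, l1, fr _ (by omega)]; omega) ?_ (by rw [hU, fr _ (by omega)]; omega)).mono
      (by rw [hU]) ?_
    · obtain ⟨Q, c, hQ⟩ := (List.eq_nil_or_concat _).resolve_left hT
      rw [List.concat_eq_append] at hQ
      rw [hQ, stopL_concat]
      exact hend c (List.mem_of_mem_take (i := k) (by rw [hQ]; simp))
    rw [hU]
    rintro s2 ⟨g2, d2, f2⟩
    have f2' : ∀ r, 5 < r → r < 40 → s2.reg r = s1.reg r := fun r h h' =>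
      f2 r h' (by omega) (by omega) (by omega)
    have g := g1.trans g2
    have gle := g.le'
    have gle' := g.le
    refine (ih (s := s2) (X := X ++ [P.take k]) (P := P.drop k) (by simpa using d2)
      (by simp; omega) (by omega) ?_ ?_ ?_ ?_ ?_ ?_ (fun c hc => hend c (List.mem_of_mem_drop hc))
      (by omega)).mono le_rfl ?_
    · rw [f2' _ (by omega) (by omega), v5]
      exact hE'.2.congr g.mem (by rw [List.length_map, l2]; omega)
    · rw [f2' _ (by omega) (by omega), v5, l2]; omega
    · rw [f2' _ (by omega) (by omega), fr _ (by omega), h6]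
    · rw [f2' _ (by omega) (by omega), v6, l2]
    · rw [f2' _ (by omega) (by omega), fr _ (by omega), h9]
    · rw [f2' _ (by omega) (by omega), fr _ (by omega), h14]
    · rintro s3 ⟨a1, a2, Y, a3, a4, a5, a6⟩
      refine ⟨by rw [add_mul]; omega, a2, P.take k :: Y, by simpa using a3, by simp [a4, hsplit],
        fun Q hQ => ?_, ?_⟩
      · rcases List.mem_cons.1 hQ with rfl | hQ
        · exact ⟨hT, by omega⟩
        · exact a5 Q hQ
      · rcases Y with _ | ⟨Q, Y⟩
        · simp
        -- A further block means that pieces were left over, so that `k = N` and the block just made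
        -- is full.
        · have hne : P.drop k ≠ [] := by
            rw [← a4, List.flatten_cons]
            exact List.append_ne_nil_of_left_ne_nil (a5 Q (by simp)).1 _
          have := List.length_pos_of_ne_nil hne
          simp only [List.length_cons, Nat.add_sub_cancel, add_mul] at a6 ⊢
          omega

/-! ### Construction -/

def buildProg : Prog :=
  sizeProg ;; eventProg ;; (.op .add 71 2 2 ;; .const 72 2) ;; sortProg maxComb ;; pieceProg ;;
    chunkProg

/-- An upper bound for the memory used by the construction, for `r` rectangles with `r ≤ 2 ^ i`,
and `m` blocks of size at most `N ≤ 2 ^ j`. -/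
def buildSpace (r i j N m : ℕ) : ℕ :=
  (18 + 14 * i) * r + 14 * r + 7 + m * (j * (N * 96 + 7) + 24 * m + 60)

def buildCost (r i j N m l : ℕ) : ℕ :=
  3 * l + 3 * N + 100 * (r + 1) + i * (174 * r + 7) + m * (j * (N * 96 + 7) + 24 * m + 72)

theorem events_le {L : List Rect} {w : ℕ} (h : ∀ R ∈ L, R.right ≤ w) : ∀ e ∈ events L, e.1 ≤ w := by
  induction L with
  | nil => simp [events]
  | cons R L ih =>
    intro e he
    have hR := h R (by simp)
    simp only [events, List.mem_cons] at he
    rcases he with rfl | rfl | he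
    · exact (Nat.le_add_right _ _).trans hR
    · exact hR
    · exact ih (fun R hR => h R (by simp [hR])) e he

theorem chunkProg_spec {W : ℕ} (hW : 7 < 2 ^ W) (j N m : ℕ) {s : NS} {P : List Piece} (hN : 0 < N)
    (hj : N ≤ 2 ^ j) (hm : P.length ≤ m * N) (hE : Ents s.mem (s.reg 20) (P.map leaf))
    (hE3 : s.reg 20 + 7 * P.length ≤ s.reg 3) (h6 : s.reg 6 = N) (h21 : s.reg 21 = P.length)
    (hend : ∀ c ∈ P, c.stopAt < 2 ^ W)
    (hb : s.reg 3 + m * (j * (N * 96 + 7) + 24 * m + 60) < 2 ^ W) :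
    Tri W chunkProg s (m * (j * (N * 96 + 7) + 24 * m + 72) + 5) fun s' =>
      s'.reg 3 ≤ s.reg 3 + m * (j * (N * 96 + 7) + 24 * m + 60) ∧ s'.reg 6 = N ∧
      ∃ Y, Dir W s' Y ∧ Y.flatten = P ∧ (∀ Q ∈ Y, Q ≠ [] ∧ Q.length ≤ N) ∧
        (Y.length - 1) * N ≤ P.length := by
  refine Tri.mono (T := 4 + (m * (j * (N * 96 + 7) + 24 * m + 72) + 1)) (Tri.seq (Tri.run'
    (by simp [Prog.plain]) ?_ (by simp [Prog.cost])
    ((chunkLoop_spec hW j N m m (X := []) (P := P) hN hj ⟨trivial, ?_, ?_⟩ ?_ hm ?_ ?_ ?_ ?_ ?_ ?_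
    hend ?_).mono le_rfl ?_))) (by omega) fun _ h => h
  · simp [Prog.ok, hW]
  any_goals simp [Prog.run, h21, h6]
  any_goals omega

/-- Sorting starts with one chunk per rectangle and needs `i` passes for at most `2 ^ i` rectangles.
The `2 * L.length` borders cut the board into `2 * L.length + 1` pieces, for which `m` blocks
suffice. -/
theorem Rep.build {W : ℕ} (hW : 7 < 2 ^ W) (i j m : ℕ) {s : NS} {n w : ℕ} {L : List Rect}
    (hR : RectsAt s.mem 0 L) (h0 : s.reg 0 = n) (h1 : s.reg 1 = w) (h2 : s.reg 2 = L.length)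
    (hn : 2 ≤ n) (hw : w < 2 ^ W) (hr : ∀ R ∈ L, R.right ≤ w) (ht : ∀ R ∈ L, R.top < 2 ^ W)
    (hi : L.length ≤ 2 ^ i) (hj : blockSize n ≤ 2 ^ j) (hm : 2 * L.length + 1 ≤ m * blockSize n)
    (hb : buildSpace L.length i j (blockSize n) m < 2 ^ W)
    (hb' : blockSize n * blockSize n < 2 ^ W) (hb'' : n * (Nat.log 2 n + 1) < 2 ^ W) :
    Tri W buildProg s (buildCost L.length i j (blockSize n) m (Nat.log 2 n + 1)) fun s' =>
      s'.reg 3 ≤ buildSpace L.length i j (blockSize n) m ∧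
      ∃ Bs, Rep W s' (sky L.toFinset) w (blockSize n) (2 * L.length + 1) Bs := by
  have hN : 0 < blockSize n := Nat.succ_pos _
  unfold buildSpace at *
  generalize hr' : L.length = r at *
  have hlen : (events L).length = 2 * r := by rw [length_events, hr']
  have hir : (18 + 14 * i) * r = 18 * r + i * (7 * (2 * r)) := by ring
  rw [hir] at hb ⊢
  have hcost : buildCost r i j (blockSize n) m (Nat.log 2 n + 1) =
      3 * (Nat.log 2 n + 1) + 3 * blockSize n + 100 * (r + 1) + i * (2 * r * (7 + 80) + 7) +
        m * (j * (blockSize n * 96 + 7) + 24 * m + 72) := by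
    rw [buildCost]; ring
  rw [hcost]
  refine Tri.mono (T := 3 * (Nat.log 2 n + 1) + 3 * blockSize n + 10 + (40 * r + 13 + (2 +
    (i * (2 * r * (7 + 80) + 7) + 3 + (27 * (2 * r) + 33 +
    (m * (j * (blockSize n * 96 + 7) + 24 * m + 72) + 5)))))) (Tri.seq ((sizeProg_spec hW hn h0
    hb' hb'').mono le_rfl ?_)) (by omega) fun _ h => h
  rintro s1 ⟨⟨e6, m1⟩, f1⟩
  refine Tri.seq ((eventProg_spec hW (L := L) (by rwa [m1]) (by rw [f1 _ (by omega), h2, hr'])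
    (fun R h => (hr R h).trans_lt hw) ht (by omega)).mono (by rw [hr']) ?_)
  rintro s2 ⟨⟨a1, a2, a3⟩, f2⟩
  rw [hr'] at a2 a3
  have v1 : s2.reg 1 = w := by rw [f2 _ (by omega) (by omega), f1 _ (by omega), h1]
  have v2 : s2.reg 2 = r := by rw [f2 _ (by omega) (by omega), f1 _ (by omega), h2]
  have v6 : s2.reg 6 = blockSize n := by rw [f2 _ (by omega) (by omega), e6]
  refine Tri.seq (Tri.run' (by simp [Prog.plain]) (by simp [Prog.ok, v2]; omega)
    (by simp [Prog.cost]) (Tri.seq ((sortProg_spec (maxComb_computes W) hW two_pos i (m := r)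
    (l := events L) (by omega) (by omega) ?_ ?_ ?_ ?_ ?_ (by omega)).mono (by rw [hlen]) ?_)))
  any_goals simp [Prog.run, v2, hlen]
  any_goals omega
  intro s3 b1 b2 b3 o ho hoE ho3 f3
  have v1' : s3.reg 1 = w := by
    rw [f3 _ (by omega) (by omega)]; simp [v1]
  have v2' : s3.reg 2 = r := by
    rw [f3 _ (by omega) (by omega)]; simp [v2]
  have v6' : s3.reg 6 = blockSize n := by
    rw [f3 _ (by omega) (by omega)]; simp [v6]
  have ho' : SortedE o ∧ (∀ k, (ev V.zero o k).p = sky L.toFinset k) ∧ o.length = 2 * r ∧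
      ∀ e ∈ o, e.1 ≤ w := by
    -- Trees are nonempty, so the board without rectangles is a case of its own, with skyline `0`.
    rcases ho with ho | ⟨h, rfl⟩
    · obtain ⟨c1, c2⟩ := ho.skyline (paired_events L)
      refine ⟨c1, fun k => (c2 k).trans (pairedMax_events L k), ho.length_eq.trans hlen, fun e he => ?_⟩
      obtain ⟨x, hx, hx'⟩ := List.mem_map.1 (ho.perm.subset (List.mem_map_of_mem he))
      exact hx' ▸ events_le hr x hx
    · have hL : L = [] := by
        rw [h] at hlen
        exact List.eq_nil_of_length_eq_zero (by simp at hlen; omega)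
      refine ⟨List.Pairwise.nil, fun k => ?_, by rw [h] at hlen; simpa using hlen, by simp⟩
      rw [hL]; rfl
  obtain ⟨c1, c2, c3, c4⟩ := ho'
  refine Tri.seq ((pieceProg_spec hW hoE ho3 (by omega) c1 (by rwa [v1']) (by omega)).mono
    (by rw [c3]) ?_)
  rintro s4 ⟨⟨d1, d2, d3, d4, d5⟩, d6⟩
  rw [v1'] at d1
  have hT : Tiles (sky L.toFinset) 0 (skyPieces w 0 0 o) w :=
    tiles_skyPieces (c := V.zero) c1 (by simp) c4 (by omega) fun k _ _ => (c2 k).symm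
  have hl := length_skyPieces w 0 0 o
  refine (chunkProg_spec hW j (blockSize n) m (P := skyPieces w 0 0 o) hN hj (by omega) d1 (by omega)
    (by rw [d6, v6']) (by omega) (fun c hc => (hT.stop_le c hc).trans_lt hw) (by omega)).mono
    le_rfl ?_
  rintro s5 ⟨g1, g2, Y, g3, g4, g5, g6⟩
  refine ⟨by omega, Y, g3, ⟨by rwa [g4], g5⟩, ?_, g2, by rw [g4]; omega, ?_⟩
  · rintro rfl
    have := congrArg List.length g4
    rw [hl] at this
    simp at this
  · have : (Y.length - 2) * blockSize n ≤ (Y.length - 1) * blockSize n :=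
      Nat.mul_le_mul_right _ (by omega)
    omega

/-! ## Heights and resting positions -/

theorem sky_le_iff {S : Finset Rect} {j t : ℕ} :
    sky S j ≤ t ↔ ∀ R ∈ S, R.left ≤ j → j < R.right → R.top ≤ t := by
  simp [sky, Finset.sup_le_iff]

/-- Borders are integers, so a rectangle of positive width overlaps `(x, x + a)` in positive length
exactly if the two share a unit column; the leftmost shared one is `max x R.left`. -/
theorem restHeight_le_iff {S : Finset Rect} (hS : ∀ R ∈ S, 0 < R.width) {x a t : ℕ} (ha : 0 < a) :
    restHeight S x a ≤ t ↔ ∀ j, x ≤ j → j < x + a → sky S j ≤ t := by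
  simp only [sky_le_iff, restHeight, Finset.sup_le_iff, Finset.mem_filter, and_imp]
  constructor
  · exact fun h j hj hj' R hR h1 h2 => h R hR (by omega) (by omega)
  · intro h R hR h1 h2
    have := hS R hR
    refine h (max x R.left) (le_max_left _ _) (by omega) R hR (le_max_right _ _) ?_
    unfold Rect.right at *
    omega

/-- Over its own columns the new rectangle lies above everything else, as it rests on the maximum;
the other columns do not see it. -/
theorem sky_insert_dropped {S : Finset Rect} (hS : ∀ R ∈ S, 0 < R.width) {x a b : ℕ} (ha : 0 < a) :
    sky (insert (dropped S x a b) S) = raise (sky S) x a (restHeight S x a + b) := by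
  funext j
  unfold raise
  rw [sky, Finset.filter_insert]
  split_ifs with h1 h2 h2
  · rw [Finset.sup_insert]
    have := (restHeight_le_iff hS ha).1 le_rfl j h2.1 h2.2
    exact max_eq_left (this.trans (Nat.le_add_right _ _))
  · exact absurd h1 h2
  · exact absurd h2 h1
  · rfl

/-- If the dropped rectangle were in `S`, it would overlap its own interval and force the resting
height up to its own top. So every update increases the cardinality, which bounds the number of
updates and with it the memory ever used. -/
theorem dropped_notMem {S : Finset Rect} {x a b : ℕ} (ha : 0 < a) (hb : 0 < b) :
    dropped S x a b ∉ S := by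
  intro h
  have : (dropped S x a b).top ≤ restHeight S x a :=
    Finset.le_sup (f := Rect.top) (Finset.mem_filter.2 ⟨h, by
      simp only [dropped, Rect.right]; omega⟩)
  simp only [dropped, Rect.top] at this
  omega

theorem Good.isWidestDrop {S : Finset Rect} (hS : ∀ R ∈ S, 0 < R.width) {w h : ℕ} {v : V}
    (hG : Good (sky S) h 0 w v) : IsWidestDrop w S h v.b v.bp := by
  refine ⟨fun hb => ?_, fun a x ha hx hr => ?_⟩
  · obtain ⟨-, h1, h2⟩ := hG.run hb
    exact ⟨h1, (restHeight_le_iff hS hb).2 h2⟩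
  · exact hG.max x a (Nat.zero_le _) hx ((restHeight_le_iff hS ha).1 hr)

/-! ## The data structure -/

def skylineStructure : DataStructure := ⟨buildProg, updateProg, queryProg⟩

/-- What persists between calls is the memory and the registers 3 to 6: free pointer, address of the
directory, number of blocks, block size. The passing of arguments touches none of them. -/
theorem Rep.congr {W : ℕ} {s s' : NS} {H : ℕ → ℕ} {w N K : ℕ} {Bs : List (List Piece)}
    (h : Rep W s H w N K Bs) (hm : s'.mem = s.mem) (hr : ∀ r, 3 ≤ r → r ≤ 6 → s'.reg r = s.reg r) :
    Rep W s' H w N K Bs :=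
  ⟨h.dir.grow (T := 0) ⟨by rw [hr _ (by omega) (by omega)], by rw [hr _ (by omega) (by omega)]; omega,
    by simp [hm]⟩ (hr _ (by omega) (by omega)) (hr _ (by omega) (by omega)), h.part, h.ne_nil, by
    rw [hr _ (by omega) (by omega), h.size], h.pieces, h.blocks⟩

theorem Rep.mono {W : ℕ} {s : NS} {H : ℕ → ℕ} {w N K K' : ℕ} {Bs : List (List Piece)}
    (h : Rep W s H w N K Bs) (hK : K ≤ K') : Rep W s H w N K' Bs :=
  ⟨h.dir, h.part, h.ne_nil, h.size, h.pieces.trans hK, h.blocks.trans (by omega)⟩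

def logSize (n : ℕ) : ℕ := Nat.log 2 n + 1

/-- An upper bound for the number of blocks. -/
def maxBlocks (c n : ℕ) : ℕ := (8 * (c * n) + 2) / blockSize n + 4

/-- At most `c * n` rectangles have a skyline of at most `2 * (c * n) + 1` pieces, and all blocks
but the last are full. -/
def initBlocks (c n : ℕ) : ℕ := (2 * (c * n) + 1) / blockSize n + 1

def initSpace (c n : ℕ) : ℕ :=
  buildSpace (c * n) (c + logSize n) (logSize n) (blockSize n) (initBlocks c n)

def initCost (c n : ℕ) : ℕ :=
  buildCost (c * n) (c + logSize n) (logSize n) (blockSize n) (initBlocks c n) (logSize n)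

/-- Bounds the time of an update and also the number of cells that it allocates. -/
def dropTime (c n : ℕ) : ℕ := updateCost (logSize n) (blockSize n) (maxBlocks c n)

/-- All numbers that occur fit into words of `W` bits. -/
structure Fits (c d n W w : ℕ) : Prop where
  two_le : 2 ≤ n
  seven_lt : 7 < 2 ^ W
  width_lt : w < 2 ^ W
  height_lt : n ^ d * (c * n + 2) < 2 ^ W
  space_lt : initSpace c n + (c * n + 1) * dropTime c n < 2 ^ W
  sq_lt : blockSize n * blockSize n < 2 ^ W
  log_lt : n * logSize n < 2 ^ W

/-- Each drop adds at most two pieces, `dropTime c n` cells and height `n ^ d`. Since `S.card` is at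
least the number of drops so far, all these bounds can be expressed by it, and the length of the
history need not be recorded. -/
structure Inv (c d n w : ℕ) {W : ℕ} (S : Finset Rect) (σ : State W) : Prop where
  rep : ∃ Bs, Rep W (abs σ) (sky S) w (blockSize n) (2 * (c * n) + 1 + 2 * S.card) Bs
  space : (abs σ).reg 3 ≤ initSpace c n + S.card * dropTime c n
  card_le : S.card ≤ c * n
  width_pos : ∀ R ∈ S, 0 < R.width
  top_le : ∀ R ∈ S, R.top ≤ n ^ d * (S.card + 1)

theorem blockSize_le {n : ℕ} (hn : 2 ≤ n) : blockSize n ≤ n := by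
  have h1 : Nat.log 2 n + 1 ≤ n := Nat.log_lt_self 2 (by omega)
  have h2 : n * (Nat.log 2 n + 1) ≤ n * n := Nat.mul_le_mul_left _ h1
  have h3 : 0 < n * n := by positivity
  have h4 : Nat.sqrt (n * (Nat.log 2 n + 1) - 1) < n := Nat.sqrt_lt.2 (by omega)
  unfold blockSize
  omega

theorem blockSize_lt_pow {n : ℕ} (hn : 2 ≤ n) : blockSize n < 2 ^ logSize n :=
  (blockSize_le hn).trans_lt (Nat.lt_pow_succ_log_self one_lt_two n)

theorem buildSpace_mono {r r' i j N m : ℕ} (h : r ≤ r') :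
    buildSpace r i j N m ≤ buildSpace r' i j N m := by
  unfold buildSpace; gcongr

theorem buildCost_mono {r r' i j N m l : ℕ} (h : r ≤ r') :
    buildCost r i j N m l ≤ buildCost r' i j N m l := by
  unfold buildCost; gcongr

theorem rectsAt_of_getElem {mem : ℕ → ℕ} {a : ℕ} {L : List Rect}
    (h : ∀ (i : ℕ) (hi : i < L.length), mem (a + 4 * i) = L[i].left ∧
      mem (a + 4 * i + 1) = L[i].bottom ∧ mem (a + 4 * i + 2) = L[i].width ∧
      mem (a + 4 * i + 3) = L[i].height) : RectsAt mem a L := by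
  induction L generalizing a with
  | nil => trivial
  | cons R L ih =>
    refine ⟨h 0 (by simp), ih fun i hi => ?_⟩
    have := h (i + 1) (by simpa using hi)
    simpa [mul_add, add_assoc, add_comm, add_left_comm] using this

/-! ### The three procedures preserve the invariant -/

section

variable {c d n W w : ℕ}

theorem Fits.drop_lt (hF : Fits c d n W w) : n ^ d < 2 ^ W :=
  (Nat.le_mul_of_pos_right _ (by omega)).trans_lt hF.height_lt

theorem Fits.build_lt (hF : Fits c d n W w) : initSpace c n < 2 ^ W :=
  (Nat.le_add_right _ _).trans_lt hF.space_lt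

theorem build_spec (hF : Fits c d n W w) {L : List Rect} {σ : State W}
    (hV : ValidInput c d n w L) (hL : Loaded n w L σ) :
    ∃ t σ', Exec buildProg σ t σ' ∧ t ≤ initCost c n ∧ Inv c d n w L.toFinset σ' := by
  have hn := hF.two_le
  have hN : 0 < blockSize n := Nat.succ_pos _
  have hr := hV.length_le
  have hle : 18 * L.length ≤ initSpace c n := by
    have : 18 * L.length ≤ (18 + 14 * (c + logSize n)) * (c * n) :=
      Nat.mul_le_mul (by omega) hr
    unfold initSpace buildSpace; omega
  have hbl := hF.build_lt
  have hnW : n < 2 ^ W :=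
    (Nat.le_mul_of_pos_right _ (Nat.succ_pos _)).trans_lt hF.log_lt
  have ofNat : ∀ {v : BitVec W} {k : ℕ}, v = BitVec.ofNat W k → k < 2 ^ W → v.toNat = k := by
    rintro v k rfl h; simpa using Nat.mod_eq_of_lt h
  have hw := hF.width_lt
  have hdW := hF.drop_lt
  have hR : RectsAt (abs σ).mem 0 L := by
    refine rectsAt_of_getElem fun i hi => ?_
    have h1 := hV.right_le _ (List.getElem_mem hi)
    have h2 := hV.top_le _ (List.getElem_mem hi)
    unfold Rect.right at h1
    unfold Rect.top at h2
    simp only [abs, zero_add]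
    rw [if_pos (by omega), if_pos (by omega), if_pos (by omega), if_pos (by omega)]
    exact ⟨ofNat (hL.left i hi) (by omega), ofNat (hL.bottom i hi) (by omega),
      ofNat (hL.width i hi) (by omega), ofNat (hL.height i hi) (by omega)⟩
  have hi : c * n ≤ 2 ^ (c + logSize n) := by
    rw [pow_add]
    exact Nat.mul_le_mul Nat.lt_two_pow_self.le (Nat.lt_pow_succ_log_self one_lt_two n).le
  have hm : 2 * (c * n) + 1 ≤ initBlocks c n * blockSize n := by
    have := Nat.lt_div_mul_add (a := 2 * (c * n) + 1) hN
    unfold initBlocks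
    rw [add_mul, one_mul]
    exact this.le
  obtain ⟨t, σ', h1, h2, h3, Bs, h4⟩ := Rep.build hF.seven_lt (c + logSize n) (logSize n)
    (initBlocks c n) hR (ofNat hL.reg_zero hnW) (ofNat hL.reg_one hw) (ofNat hL.reg_two (by omega))
    hn hw hV.right_le (fun R h => (hV.top_le R h).trans_lt hdW) (hr.trans hi)
    (blockSize_lt_pow hn).le (by omega) ((buildSpace_mono hr).trans_lt hbl) hF.sq_lt hF.log_lt
    σ rfl
  refine ⟨t, σ', h1, h2.trans (buildCost_mono hr), ⟨Bs, h4.mono (by omega)⟩,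
    (h3.trans (buildSpace_mono hr)).trans (Nat.le_add_right _ _), (List.toFinset_card_le L).trans hr,
    ?_, ?_⟩
  · simpa using hV.width_pos
  · exact fun R h => (hV.top_le R (List.mem_toFinset.1 h)).trans (Nat.le_mul_of_pos_right _ (by omega))

theorem update_spec (hF : Fits c d n W w) {S : Finset Rect} {σ : State W} (hI : Inv c d n w S σ)
    {x a b : ℕ} (hV : ValidDrop c d n w S x a b) :
    ∃ t σ', Exec updateProg (σ.updateCall x a b) t σ' ∧ t ≤ dropTime c n ∧
      Inv c d n w (insert (dropped S x a b) S) σ' := by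
  obtain ⟨Bs, hR⟩ := hI.rep
  obtain ⟨ha, hb, hxa, hbd, hcard⟩ := hV
  have hw := hF.width_lt
  have hn := hF.two_le
  have hN : 0 < blockSize n := Nat.succ_pos _
  have habs : abs (σ.updateCall x a b) = (((abs σ).set 0 x).set 1 a).set 2 b := by
    have hdW := hF.drop_lt
    unfold State.updateCall
    simp only [abs_setReg, BitVec.toNat_ofNat]
    rw [Nat.mod_eq_of_lt (by omega), Nat.mod_eq_of_lt (by omega), Nat.mod_eq_of_lt (by omega)]
  have hsky : ∀ j < w, sky S j ≤ n ^ d * (c * n + 1) := fun j _ =>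
    sky_le_iff.2 fun R hR' _ _ => (hI.top_le R hR').trans (Nat.mul_le_mul_left _ (by omega))
  have hh : n ^ d * (c * n + 1) + b < 2 ^ W := by
    have := hF.height_lt
    rw [show n ^ d * (c * n + 2) = n ^ d * (c * n + 1) + n ^ d by ring] at this
    omega
  -- At most `4 * (c * n) + 1` pieces are possible, because `S.card ≤ c * n`. The `4` in `maxBlocks`
  -- consists of the `2` subtracted in `Rep.blocks` and of the two blocks that the cuts create.
  have hblocks : Bs.length + 2 ≤ maxBlocks c n := by
    have h1 : Bs.length - 2 ≤ (8 * (c * n) + 2) / blockSize n := by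
      rw [Nat.le_div_iff_mul_le hN]
      have := hR.blocks
      omega
    unfold maxBlocks; omega
  have hspace : (abs σ).reg 3 + dropTime c n ≤ initSpace c n + (S.card + 1) * dropTime c n := by
    have := hI.space
    rw [add_mul]; omega
  have hsp : initSpace c n + (S.card + 1) * dropTime c n < 2 ^ W :=
    (Nat.add_le_add_left (Nat.mul_le_mul_right _ (by omega)) _).trans_lt hF.space_lt
  obtain ⟨t, σ', h1, h2, h3, Bs', m, h4, h5⟩ := Rep.update hF.seven_lt (logSize n)
    (s := abs (σ.updateCall x a b)) (x := x) (a := a) (b := b) (hm := n ^ d * (c * n + 1))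
    (L := maxBlocks c n)
    (hR.congr (by rw [habs]; rfl) fun r hr hr' => by
      rw [habs]; simp [show r ≠ 0 by omega, show r ≠ 1 by omega, show r ≠ 2 by omega]) hw hN
    (blockSize_lt_pow hn).le hblocks (by simp [habs]) (by simp [habs]) (by simp [habs]) ha hxa hsky hh
    (by simp only [habs]; simpa [dropTime] using hspace.trans_lt hsp) _ rfl
  -- Two numbers with the same upper bounds are equal.
  have hm : m = restHeight S x a := by
    apply le_antisymm
    · exact (h5 _).2 ((restHeight_le_iff hI.width_pos ha).1 le_rfl)
    · exact (restHeight_le_iff hI.width_pos ha).2 ((h5 _).1 le_rfl)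
  have hc : (insert (dropped S x a b) S).card = S.card + 1 :=
    Finset.card_insert_of_notMem (dropped_notMem ha hb)
  refine ⟨t, σ', h1, h2, ⟨Bs', ?_⟩, ?_, by omega, ?_, ?_⟩
  · rw [sky_insert_dropped hI.width_pos ha, ← hm, hc]
    exact h4
  · rw [hc]
    have := h3.le'
    rw [habs] at this
    simp at this
    unfold dropTime at *
    omega
  · intro R hR
    rcases Finset.mem_insert.1 hR with rfl | hR
    · exact ha
    · exact hI.width_pos R hR
  · intro R hR
    rw [hc]
    rcases Finset.mem_insert.1 hR with rfl | hR
    · have : restHeight S x a ≤ n ^ d * (S.card + 1) :=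
        Finset.sup_le fun R hR => hI.top_le R (Finset.mem_filter.1 hR).1
      simp only [dropped, Rect.top]
      rw [mul_add _ (S.card + 1), mul_one]
      omega
    · exact (hI.top_le R hR).trans (Nat.mul_le_mul_left _ (by omega))

def askTime (c n : ℕ) : ℕ := maxBlocks c n * (8 * logSize n + 46) + 18

theorem query_spec (hF : Fits c d n W w) {S : Finset Rect} {σ : State W} (hI : Inv c d n w S σ)
    {h : ℕ} (hh : h < 2 ^ W) :
    ∃ t σ', Exec queryProg (σ.queryCall h) t σ' ∧ t ≤ askTime c n ∧
      IsWidestDrop w S h (σ'.reg 0).toNat (σ'.reg 1).toNat ∧ Inv c d n w S σ' := by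
  obtain ⟨Bs, hR⟩ := hI.rep
  have hn := hF.two_le
  have hN : 0 < blockSize n := Nat.succ_pos _
  have habs : abs (σ.queryCall h) = (abs σ).set 0 h := by
    unfold State.queryCall
    simp only [abs_setReg, BitVec.toNat_ofNat, Nat.mod_eq_of_lt hh]
  have hcard := hI.card_le
  have hblocks : Bs.length ≤ maxBlocks c n := by
    have h1 : Bs.length - 2 ≤ (8 * (c * n) + 2) / blockSize n := by
      rw [Nat.le_div_iff_mul_le hN]
      have := hR.blocks
      omega
    unfold maxBlocks; omega
  have hR' : Rep W (abs (σ.queryCall h)) (sky S) w (blockSize n) (2 * (c * n) + 1 + 2 * S.card) Bs :=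
    hR.congr (by rw [habs]; rfl) fun r hr hr' => by rw [habs]; simp [show r ≠ 0 by omega]
  obtain ⟨t, σ', h1, h2, ⟨⟨v, hG, e0, e1⟩, hfm⟩, hfr⟩ :=
    ((Rep.query hF.seven_lt (logSize n) hR' hF.width_lt
    (blockSize_lt_pow hn) (abs_reg_lt _ _)).frame_mem queryProg_readOnly).frame
    (σ.queryCall h) rfl
  have hf' : ∀ r, 3 ≤ r → r ≤ 6 → (abs σ').reg r = (abs σ).reg r := fun r hr hr' => by
    rw [hfr r (queryProg_writes (by omega) (by omega)), habs]; simp [show r ≠ 0 by omega]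
  refine ⟨t, σ', h1, h2.trans ?_, ?_, ⟨Bs, hR.congr (by rw [hfm, habs]; rfl) hf'⟩, ?_, hI.card_le,
    hI.width_pos, hI.top_le⟩
  · unfold askTime; gcongr
  · have e0' : (σ'.reg 0).toNat = v.b := e0
    have e1' : (σ'.reg 1).toNat = v.bp := e1
    rw [e0', e1']
    have : (abs (σ.queryCall h)).reg 0 = h := by simp [habs]
    exact (this ▸ hG).isWidestDrop hI.width_pos
  · rw [hf' 3 le_rfl (by omega)]; exact hI.space

/-- The history consists of arbitrary terminating executions; by determinism each of them is the one
whose existence has been shown, so the invariant passes along. -/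
theorem Reachable.inv (hF : Fits c d n W w) {S : Finset Rect} {σ : State W}
    (h : Reachable skylineStructure c d n w S σ) : Inv c d n w S σ := by
  induction h with
  | build hV hL hE =>
    obtain ⟨t, σ', h1, -, h3⟩ := build_spec hF hV hL
    exact (hE.deterministic h1).2 ▸ h3
  | update _ hV hE ih =>
    obtain ⟨t, σ', h1, -, h3⟩ := update_spec hF ih hV
    exact (hE.deterministic h1).2 ▸ h3
  | query _ hh hE ih =>
    obtain ⟨t, σ', h1, -, -, h3⟩ := query_spec hF ih hh
    exact (hE.deterministic h1).2 ▸ h3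

end

/-! ## Bounds -/

/-- Seven block constructions in all: two for each of the two cuts, one for the dropped rectangle,
one for each of the two joins. -/
theorem updateCost_eq (j N L : ℕ) :
    updateCost j N L = 7 * (j * (N * 96 + 7)) + 208 * L + 184 * N + 780 := by
  unfold updateCost dropCost splitCost pairCost
  ring

/-- All parameters are at most small multiples of `x = (c + 1) * n`, and the total is a cubic
polynomial in them. -/
theorem space_le {c n : ℕ} (hn : 2 ≤ n) :
    initSpace c n + (c * n + 1) * dropTime c n ≤ 8000 * (c + 1) ^ 3 * n ^ 3 := by
  obtain ⟨x, hx⟩ : ∃ x, x = (c + 1) * n := ⟨_, rfl⟩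
  have hx' : x = c * n + n := by rw [hx]; ring
  have h1 : logSize n ≤ x := by
    have : Nat.log 2 n < n := Nat.log_lt_self 2 (by omega)
    unfold logSize; omega
  have h2 : blockSize n ≤ x := (blockSize_le hn).trans (by omega)
  have h3 : initBlocks c n ≤ 2 * x := by
    have := Nat.div_le_self (2 * (c * n) + 1) (blockSize n)
    unfold initBlocks; omega
  have h4 : maxBlocks c n ≤ 8 * x := by
    have := Nat.div_le_self (8 * (c * n) + 2) (blockSize n)
    unfold maxBlocks; omega
  have h5 : c + logSize n ≤ x := by
    have h : Nat.log 2 n < n := Nat.log_lt_self 2 (by omega)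
    have : c ≤ c * n := Nat.le_mul_of_pos_right _ (by omega)
    unfold logSize; omega
  have h6 : c * n ≤ x := by omega
  have h7 : c * n + 1 ≤ x := by omega
  calc initSpace c n + (c * n + 1) * dropTime c n
      ≤ ((18 + 14 * x) * x + 14 * x + 7 + 2 * x * (x * (x * 96 + 7) + 24 * (2 * x) + 60)) +
        x * (7 * (x * (x * 96 + 7)) + 208 * (8 * x) + 184 * x + 780) := by
        unfold initSpace buildSpace dropTime
        rw [updateCost_eq]
        gcongr
    _ ≤ 8000 * x ^ 3 := by
        have e1 : x ≤ x ^ 3 := Nat.le_self_pow (by norm_num) x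
        have e2 : x ^ 2 ≤ x ^ 3 := Nat.pow_le_pow_right (by omega) (by norm_num)
        ring_nf
        omega
    _ = 8000 * (c + 1) ^ 3 * n ^ 3 := by rw [hx]; ring

/-- Constant factors are absorbed into the exponent: `A < n ^ A` for `n ≥ 2`, so that a quantity of
at most `A * n ^ e` is below `n ^ (A + e)`. The exponent `K` is chosen at least as large as every `A
+ e` that occurs. -/
theorem exists_fits (c d : ℕ) : ∃ K : ℕ, ∀ n W w : ℕ, 2 ≤ n → n ^ K ≤ 2 ^ W → w ≤ n ^ d →
    Fits c d n W w := by
  refine ⟨8000 * (c + 1) ^ 3 + c + d + 8, fun n W w hn hK hw => ?_⟩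
  have hlt : ∀ (A e : ℕ), A + e ≤ 8000 * (c + 1) ^ 3 + c + d + 8 → ∀ {v}, v ≤ A * n ^ e →
      v < 2 ^ W := fun A e hA v hv => by
    have h1 : A < n ^ A := Nat.lt_pow_self (by omega)
    have h2 : 0 < n ^ e := by positivity
    calc v ≤ A * n ^ e := hv
      _ < n ^ A * n ^ e := Nat.mul_lt_mul_of_pos_right h1 h2
      _ = n ^ (A + e) := (pow_add _ _ _).symm
      _ ≤ 2 ^ W := (Nat.pow_le_pow_right (by omega) hA).trans hK
  have hN := blockSize_le hn
  have hl : logSize n ≤ n := Nat.log_lt_self 2 (by omega)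
  refine ⟨hn, ?_, ?_, ?_, ?_, ?_, ?_⟩
  · have : n ^ 3 ≤ 2 ^ W := (Nat.pow_le_pow_right (by omega) (by omega)).trans hK
    have : 2 ^ 3 ≤ n ^ 3 := Nat.pow_le_pow_left hn 3
    omega
  · exact hlt 1 d (by omega) (by omega)
  · refine hlt (c + 2) (d + 1) (by omega) ?_
    calc n ^ d * (c * n + 2) ≤ n ^ d * (c * n + 2 * n) := by gcongr; omega
      _ = _ := by ring
  · exact hlt _ 3 (by omega) (space_le hn)
  · refine hlt 1 2 (by omega) ?_
    rw [one_mul, sq]; gcongr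
  · refine hlt 1 2 (by omega) ?_
    rw [one_mul, sq]; gcongr

/-- The factor 3 comes from `2 / log 2 < 3`: both the rounded-down binary logarithm and the added
`1` are at most `log n / log 2`. -/
theorem logSize_bounds {n : ℕ} (hn : 2 ≤ n) :
    Real.log n ≤ logSize n ∧ (logSize n : ℝ) ≤ 3 * Real.log n ∧ 1 / 2 ≤ Real.log n := by
  have hn0 : (0 : ℝ) < n := by positivity
  have l1 := Real.log_two_gt_d9
  have l2 := Real.log_two_lt_d9
  have h1 : (n : ℝ) ≤ 2 ^ logSize n := by
    exact_mod_cast (Nat.lt_pow_succ_log_self one_lt_two n).le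
  have h2 : (2 : ℝ) ^ Nat.log 2 n ≤ n := by
    exact_mod_cast Nat.pow_log_le_self 2 (show n ≠ 0 by omega)
  have h3 := Real.log_le_log hn0 h1
  have h4 := Real.log_le_log (by positivity) h2
  have h5 : Real.log 2 ≤ Real.log n := Real.log_le_log (by norm_num) (by exact_mod_cast hn)
  rw [Real.log_pow] at h3 h4
  have h6 : (logSize n : ℝ) = Nat.log 2 n + 1 := by simp [logSize]
  refine ⟨?_, ?_, by linarith⟩
  · have : (0 : ℝ) ≤ logSize n := by positivity
    nlinarith
  · have : (0 : ℝ) ≤ Nat.log 2 n := by positivity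
    nlinarith

/-- The number `p = √(n / log n)` is the order of the number of blocks. In `p` and `l = log n` all
bounds become monomials: `n = p² l`, the block size is about `p l`, a query takes `p l`, an update
`p l²`, and `n log n = p² l²`. -/
theorem exists_scale {n : ℕ} (hn : 2 ≤ n) : ∃ p : ℝ, 1 ≤ p ∧ (n : ℝ) = p ^ 2 * Real.log n ∧
    (n : ℝ) ^ (1 / 2 : ℝ) * Real.log n ^ (1 / 2 : ℝ) = p * Real.log n ∧
    (n : ℝ) ^ (1 / 2 : ℝ) * Real.log n ^ (3 / 2 : ℝ) = p * Real.log n ^ 2 ∧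
    p * Real.log n ≤ blockSize n ∧ (blockSize n : ℝ) ≤ 4 * (p * Real.log n) := by
  obtain ⟨h1, h2, h3⟩ := logSize_bounds hn
  have hn0 : (0 : ℝ) < n := by positivity
  have hln : Real.log n ≤ n := (Real.log_le_sub_one_of_pos hn0).trans (by linarith)
  generalize hl : Real.log n = l at *
  have hl0 : 0 < l := by linarith
  obtain ⟨p, hp⟩ : ∃ p, p = √(n / l) := ⟨_, rfl⟩
  have hp0 : 0 ≤ p := hp ▸ Real.sqrt_nonneg _
  have hp2 : p ^ 2 * l = n := by
    rw [hp, Real.sq_sqrt (by positivity), div_mul_cancel₀ _ hl0.ne']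
  have hp1 : 1 ≤ p := by
    rw [hp, Real.one_le_sqrt, one_le_div hl0]; exact hln
  have hq : √n * √l = p * l := by
    rw [← Real.sqrt_mul hn0.le, ← hp2, show p ^ 2 * l * l = (p * l) ^ 2 by ring,
      Real.sqrt_sq (by positivity)]
  have h32 : l ^ (3 / 2 : ℝ) = √l * l := by
    rw [Real.sqrt_eq_rpow, ← Real.rpow_add_one hl0.ne']; norm_num
  have hpl : 1 / 2 ≤ p * l := by nlinarith
  have hX : 0 < n * logSize n := Nat.mul_pos (by omega) (Nat.succ_pos _)
  have hs1 : n * logSize n ≤ blockSize n * blockSize n := by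
    have := Nat.lt_succ_sqrt (n * (Nat.log 2 n + 1) - 1)
    rw [Nat.succ_eq_add_one] at this
    unfold blockSize logSize at *
    omega
  have hs2 : (blockSize n - 1) * (blockSize n - 1) ≤ n * logSize n := by
    have := Nat.sqrt_le (n * (Nat.log 2 n + 1) - 1)
    unfold blockSize logSize
    simp only [Nat.add_sub_cancel]
    omega
  have hs1' : (n : ℝ) * logSize n ≤ (blockSize n : ℝ) ^ 2 := by
    rw [sq]; exact_mod_cast hs1
  have hs2' : ((blockSize n : ℝ) - 1) ^ 2 ≤ n * logSize n := by
    have : ((blockSize n - 1 : ℕ) : ℝ) = (blockSize n : ℝ) - 1 := by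
      rw [Nat.cast_sub (show 1 ≤ blockSize n from Nat.succ_pos _), Nat.cast_one]
    rw [← this, sq]; exact_mod_cast hs2
  have hql : (p * l) ^ 2 = n * l := by rw [← hp2]; ring
  refine ⟨p, hp1, hp2.symm, ?_, ?_, ?_, ?_⟩
  · rw [← Real.sqrt_eq_rpow, ← Real.sqrt_eq_rpow, hq]
  · rw [h32, ← Real.sqrt_eq_rpow, ← mul_assoc, hq]; ring
  · refine (abs_le_of_sq_le_sq' ?_ (by positivity)).2
    rw [hql]
    exact (mul_le_mul_of_nonneg_left h1 hn0.le).trans hs1'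
  -- From `(B - 1)² ≤ n * logSize n ≤ 3 n l ≤ (2 p l)²`; the remaining `1` is at most `2 p l`, which
  -- makes the factor 4.
  · have h : (blockSize n : ℝ) - 1 ≤ 2 * (p * l) := by
      refine (abs_le_of_sq_le_sq' ?_ (by positivity)).2
      refine hs2'.trans ?_
      rw [mul_pow, hql]
      nlinarith
    linarith

theorem blocks_le {n A b : ℕ} {a p : ℝ} (hp : 1 ≤ p) (hl : 0 < Real.log n)
    (hnp : (n : ℝ) = p ^ 2 * Real.log n) (hN : p * Real.log n ≤ blockSize n)
    (ha : 0 ≤ a) (hA : (A : ℝ) ≤ a * n) : ((A / blockSize n + b : ℕ) : ℝ) ≤ (a + b) * p := by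
  have hq : 0 < p * Real.log n := by positivity
  have h1 : ((A / blockSize n : ℕ) : ℝ) ≤ a * p :=
    calc ((A / blockSize n : ℕ) : ℝ) ≤ A / blockSize n := Nat.cast_div_le
      _ ≤ a * n / (p * Real.log n) := by gcongr
      _ = a * p := by
        rw [div_eq_iff hq.ne']
        conv_lhs => rw [hnp]
        ring
  have h2 : (b : ℝ) * 1 ≤ b * p := by gcongr
  rw [Nat.cast_add, add_mul]
  linarith

/-- The time for one table. With `7 ≤ 14 p l` the constant is `3 * (4 * 96 + 14) = 1194`. -/
theorem blockCost_le {l N p : ℝ} {j : ℝ} (hp : 1 ≤ p) (hl : 1 / 2 ≤ l) (hj : j ≤ 3 * l) (hN0 : 0 ≤ N)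
    (hN : N ≤ 4 * (p * l)) : j * (N * 96 + 7) ≤ 1194 * (p * l ^ 2) := by
  have h : (7 : ℝ) ≤ 14 * (p * l) := by nlinarith
  calc j * (N * 96 + 7) ≤ 3 * l * (4 * (p * l) * 96 + 14 * (p * l)) := by gcongr
    _ = _ := by ring

/-- Every term is compared with `p l²`, by `1 ≤ p` and `1 ≤ 2 l`. The constants add up as `7 * 1194
+ 208 * 4 * (8 * c + 5) + 184 * 8 + 780 * 4`. -/
theorem dropTime_le (c : ℕ) {n : ℕ} (hn : 2 ≤ n) : (dropTime c n : ℝ) ≤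
    (6656 * c + 17110) * ((n : ℝ) ^ (1 / 2 : ℝ) * Real.log n ^ (3 / 2 : ℝ)) := by
  obtain ⟨-, h2, h3⟩ := logSize_bounds hn
  obtain ⟨p, hp, hnp, -, hq, hN1, hN2⟩ := exists_scale hn
  have hn2 : (2 : ℝ) ≤ n := by exact_mod_cast hn
  have hL : (maxBlocks c n : ℝ) ≤ ((8 * c + 1) + (4 : ℕ)) * p :=
    blocks_le hp (by linarith) hnp hN1 (by positivity) (by push_cast; linarith)
  rw [hq, dropTime, updateCost_eq]
  generalize Real.log n = l at *
  have hu := blockCost_le hp h3 h2 (Nat.cast_nonneg _) hN2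
  have e1 : p ≤ 4 * (p * l ^ 2) := by
    have : 1 ≤ 4 * l ^ 2 := by nlinarith
    nlinarith
  have e2 : p * l ≤ 2 * (p * l ^ 2) := by
    have : 0 ≤ p * l := by positivity
    nlinarith
  have e3 : (c : ℝ) * p ≤ c * (4 * (p * l ^ 2)) := by gcongr
  push_cast at hL ⊢
  linarith

/-- There are at most `(8 * c + 5) p` blocks, each takes at most `8 * 3 l + 46 * 2 l = 116 l` steps,
and the final 18 steps are at most `36 p l`. -/
theorem askTime_le (c : ℕ) {n : ℕ} (hn : 2 ≤ n) : (askTime c n : ℝ) ≤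
    (928 * c + 616) * ((n : ℝ) ^ (1 / 2 : ℝ) * Real.log n ^ (1 / 2 : ℝ)) := by
  obtain ⟨-, h2, h3⟩ := logSize_bounds hn
  obtain ⟨p, hp, hnp, hq, -, hN1, hN2⟩ := exists_scale hn
  have hn2 : (2 : ℝ) ≤ n := by exact_mod_cast hn
  have hL : (maxBlocks c n : ℝ) ≤ ((8 * c + 1) + (4 : ℕ)) * p :=
    blocks_le hp (by linarith) hnp hN1 (by positivity) (by push_cast; linarith)
  rw [hq, askTime]
  generalize Real.log n = l at *
  have e2 : 1 / 2 ≤ p * l := by nlinarith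
  push_cast at hL ⊢
  calc (maxBlocks c n : ℝ) * (8 * logSize n + 46) + 18
      ≤ (8 * c + 1 + 4) * p * (8 * (3 * l) + 46 * (2 * l)) + 18 * (2 * (p * l)) := by
        gcongr <;> linarith
    _ = _ := by ring

/-- Sorting the borders takes `O(log n)` passes of `O(n)` steps. The `O(p)` tables cost `O(p l²)`
each, which amounts to `p² l² = n log n`. The directory is copied once per block, in `O(p²)` steps
altogether, and `p² ≤ 4 n log n`. -/
theorem initCost_le (c : ℕ) {n : ℕ} (hn : 2 ≤ n) : (initCost c n : ℝ) ≤
    (600 + 200 * c + (2 * c + 3) * (174 * c + 7) + 1500 * (2 * c + 2) + 96 * (2 * c + 2) ^ 2) *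
      ((n : ℝ) * Real.log n) := by
  obtain ⟨-, h2, h3⟩ := logSize_bounds hn
  obtain ⟨p, hp, hnp, -, -, hN1, hN2⟩ := exists_scale hn
  have hn2 : (2 : ℝ) ≤ n := by exact_mod_cast hn
  have hL : (initBlocks c n : ℝ) ≤ ((2 * c + 1) + (1 : ℕ)) * p :=
    blocks_le hp (by linarith) hnp hN1 (by positivity) (by push_cast; linarith)
  rw [initCost, buildCost]
  generalize Real.log n = l at *
  have hu := blockCost_le hp h3 h2 (Nat.cast_nonneg (blockSize n)) hN2
  have hL' : (initBlocks c n : ℝ) ≤ (2 * c + 2) * p := by push_cast at hL; linarith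
  have hpl : 1 / 2 ≤ p * l := by nlinarith
  have e0 : (n : ℝ) * l = (p * l) ^ 2 := by rw [hnp]; ring
  have e1 : 1 ≤ (n : ℝ) * l := by nlinarith
  have e2 : l ≤ n * l := by nlinarith
  have e3 : p * l ≤ 2 * (n * l) := by rw [e0]; nlinarith
  have e4 : (n : ℝ) ≤ 2 * (n * l) := by nlinarith
  have e5 : p ^ 2 ≤ 4 * (n * l) := by
    rw [e0, mul_pow]
    have : 1 ≤ 4 * l ^ 2 := by nlinarith
    nlinarith [sq_nonneg p]
  have e6 : p ≤ p ^ 2 := by nlinarith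
  have f1 : (c : ℝ) * n ≤ c * (2 * (n * l)) := by gcongr
  have f2 : ((c : ℝ) + logSize n) * (174 * (c * n) + 7) ≤
      (2 * c + 3) * (174 * c + 7) * (n * l) :=
    calc ((c : ℝ) + logSize n) * (174 * (c * n) + 7)
        ≤ (c * (2 * l) + 3 * l) * (174 * (c * n) + 7 * n) := by
          gcongr
          · exact le_mul_of_one_le_right (Nat.cast_nonneg _) (by linarith)
          · linarith
      _ = _ := by ring
  have f3 : (initBlocks c n : ℝ) * (logSize n * (blockSize n * 96 + 7)) ≤
      1194 * (2 * c + 2) * (n * l) :=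
    calc (initBlocks c n : ℝ) * (logSize n * (blockSize n * 96 + 7))
        ≤ (2 * c + 2) * p * (1194 * (p * l ^ 2)) := by gcongr
      _ = _ := by rw [e0]; ring
  have f4 : (initBlocks c n : ℝ) * initBlocks c n ≤ (2 * c + 2) ^ 2 * (4 * (n * l)) :=
    calc (initBlocks c n : ℝ) * initBlocks c n ≤ ((2 * c + 2) * p) * ((2 * c + 2) * p) := by gcongr
      _ = (2 * c + 2) ^ 2 * p ^ 2 := by ring
      _ ≤ _ := by gcongr
  have f5 : (initBlocks c n : ℝ) ≤ (2 * c + 2) * (4 * (n * l)) := by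
    refine hL'.trans ?_
    gcongr
    exact e6.trans e5
  push_cast
  rw [mul_add (initBlocks c n : ℝ), mul_add (initBlocks c n : ℝ)]
  have f6 : 0 ≤ (c : ℝ) * (n * l) := by positivity
  linarith

end RectDrop

/-! ### The three time bounds together -/

theorem mainTheorem3 :
    ∃ D : RectDrop.DataStructure, ∀ c d : ℕ, ∃ (K : ℕ) (C : ℝ),
      ∀ n W w : ℕ, 2 ≤ n → n ^ K ≤ 2 ^ W → w ≤ n ^ d →
        -- construction
        (∀ (L : List RectDrop.Rect) (σ : RectDrop.State W),
          RectDrop.ValidInput c d n w L → RectDrop.Loaded n w L σ →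
            ∃ (t : ℕ) (σ' : RectDrop.State W), RectDrop.Exec D.build σ t σ' ∧
              (t : ℝ) ≤ C * ((n : ℝ) * Real.log n)) ∧
        ∀ (S : Finset RectDrop.Rect) (σ : RectDrop.State W),
          RectDrop.Reachable D c d n w S σ →
            -- update
            (∀ x a b : ℕ, RectDrop.ValidDrop c d n w S x a b →
              ∃ (t : ℕ) (σ' : RectDrop.State W),
                RectDrop.Exec D.update (σ.updateCall x a b) t σ' ∧
                (t : ℝ) ≤ C * ((n : ℝ) ^ (1 / 2 : ℝ) * Real.log n ^ (3 / 2 : ℝ))) ∧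
            -- query
            (∀ h : ℕ, h < 2 ^ W →
              ∃ (t : ℕ) (σ' : RectDrop.State W),
                RectDrop.Exec D.query (σ.queryCall h) t σ' ∧
                (t : ℝ) ≤ C * ((n : ℝ) ^ (1 / 2 : ℝ) * Real.log n ^ (1 / 2 : ℝ)) ∧
                RectDrop.IsWidestDrop w S h (σ'.reg 0).toNat (σ'.reg 1).toNat) := by
  refine ⟨RectDrop.skylineStructure, fun c d => ?_⟩
  obtain ⟨K, hK⟩ := RectDrop.exists_fits c d
  obtain ⟨A, hA⟩ : ∃ A : ℝ, A = 600 + 200 * c + (2 * c + 3) * (174 * c + 7) + 1500 * (2 * c + 2) +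
    96 * (2 * c + 2) ^ 2 := ⟨_, rfl⟩
  have hA0 : 0 ≤ A := by rw [hA]; positivity
  -- The three constants are nonnegative, so their sum serves for all three bounds.
  refine ⟨K, A + (6656 * c + 17110) + (928 * c + 616), fun n W w hn hW hw => ?_⟩
  have hF := hK n W w hn hW hw
  have hlog : 0 ≤ Real.log n := Real.log_natCast_nonneg n
  have hc : (0 : ℝ) ≤ c := Nat.cast_nonneg c
  refine ⟨fun L σ hL hσ => ?_, fun S σ hS => ?_⟩
  · obtain ⟨t, σ', h1, h2, -⟩ := RectDrop.build_spec hF hL hσ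
    refine ⟨t, σ', h1, (Nat.cast_le.2 h2).trans ((RectDrop.initCost_le c hn).trans ?_)⟩
    rw [← hA]
    exact mul_le_mul_of_nonneg_right (by linarith) (by positivity)
  have hI := hS.inv hF
  refine ⟨fun x a b hV => ?_, fun h hh => ?_⟩
  · obtain ⟨t, σ', h1, h2, -⟩ := RectDrop.update_spec hF hI hV
    refine ⟨t, σ', h1, (Nat.cast_le.2 h2).trans ((RectDrop.dropTime_le c hn).trans ?_)⟩
    exact mul_le_mul_of_nonneg_right (by linarith) (by positivity)
  · obtain ⟨t, σ', h1, h2, h3, -⟩ := RectDrop.query_spec hF hI hh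
    refine ⟨t, σ', h1, (Nat.cast_le.2 h2).trans ((RectDrop.askTime_le c hn).trans ?_), h3⟩
    exact mul_le_mul_of_nonneg_right (by linarith) (by positivity)
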